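/- Let $G$ be a connected (finite-dimensional, real) Lie group, $H\le G$ a closed subgroup with Lie algebra $\mathfrak h$, and $\pi:G\to G/H$ the projection, regarded as a principal $H$-bundle. Let $\omega$ be a connection form on it: a smooth $\mathfrak h$-valued 1-form on $G$ with $\omega_{xa}(R_{a*}v)=\mathrm{Ad}(a^{-1})\omega_x(v)$ for $a\in H$, and $\omega_x(x\xi)=\xi$ for $\xi\in\mathfrak h$. Put $\Delta^1(x)=\ker\omega_x$ (horizontal space) and $\Delta^2(x)=x\mathfrak h$ (vertical space). Let $\tfrac12<\alpha\le 1$, $T>0$, let $Z:[0,T]\to\mathbb R$ be $\alpha$-Hölder, and let $A\in\mathfrak g=T_eG$, with right-invariant vector field $x\mapsto Ax$. An $\alpha$-Hölder path $x_t$ solves $dx_t=W_t\,dZ_t$ ($W_t\in T_{x_t}G$) if $f(x_t)=f(x_0)+\int_0^t df(W_s)\,dZ_s$ (Young integral) for every $f\in C^\infty(G)$. The horizontal lift starting at $x$ of a path $m_t$ in $G/H$ with $m_0=\pi(x)$ is an $\alpha$-Hölder path $u_t$ in $G$ with $u_0=x$, $\pi(u_t)=m_t$ and $\int_0^t\omega\,du_s=0$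 for all $t$. The equation $dg_t=Ag_t\,dZ_t$, $g_0=e$, has a solution on $[0,T]$, and $\varphi_t(x)=g_tx$ is the solution flow of $dx_t=Ax_t\,dZ_t$: its solutions are exactly the paths $t\mapsto g_tx_0$. For $\tau\in[0,T]$, a decomposition of $\varphi$ on $[0,\tau]$ according to $(\Delta^1,\Delta^2)$ is a pair of families $\eta_t,\psi_t$ of smooth diffeomorphisms of $G$ with $\varphi_t=\eta_t\circ\psi_t$ for $t\in[0,\tau]$ and $\eta_0=\mathrm{id}$, such that for every $t\in[0,\tau]$ the map $\eta_t$ preserves transversality, i.e. $\Delta^1(p)\cap(\eta_t)_*\Delta^2(p)=\{0\}$ for all $p$, where $(\eta_t)_*\Delta^2(p)=D\eta_t\big(\Delta^2(\eta_t^{-1}(p))\big)$, and such that there is a splitting $Ap=h_t(p)+V_t(p)$ with $h_t(p)\in\Delta^1(p)$, $V_t(p)\in(\eta_t)_*\Delta^2(p)$, for which, for every $x\in G$, on $[0,\tau]$, $$d\eta_t(x)=h_t(\eta_t(x))\,dZ_t,\qquad d\psi_t(x)=\big(\mathrm{Ad}(\eta_t^{-1})V_t\big)(\psi_t(x))\,dZ_t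 ,$$ where $\mathrm{Ad}(\eta_t^{-1})V_t$ is the pull-back of the field $V_t$ by $\eta_t$ (it takes values in $\Delta^2$). Then: 1. For every $x\in G$ there is an $\alpha$-Hölder curve $g^{H,x}:[0,T]\to G$ such that $t\mapsto g^{H,x}_tx$ is a horizontal lift of $t\mapsto\pi(g_tx)$ starting at $x$. 2. A decomposition $\varphi_t=\eta_t\circ\psi_t$ according to $(\Delta^1,\Delta^2)$ exists on the whole of $[0,T]$. 3. For every $\tau\in[0,T]$ and every such decomposition on $[0,\tau]$, every $x\in G$, every curve $g^{H,x}$ such that $t\mapsto g_t^{H,x}x$ is a horizontal lift on $[0,\tau]$ of $\pi(g_tx)$ starting at $x$, and every $t\in[0,\tau]$, $$\eta_t(x)=g^{H,x}_t\,x,\qquad \psi_t(x)=x\,h_t,\qquad h_t=x^{-1}(g^{H,x}_t)^{-1}g_t\,x\in H .$$ -/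

import Mathlib

open Set
open scoped Manifold ContDiff NNReal

noncomputable section YoungCalculus

/-- `f` is Hölder continuous with exponent `α` on the set `s`. -/
def IsHolderOn {F : Type*} [PseudoEMetricSpace F] (α : ℝ≥0) (f : ℝ → F) (s : Set ℝ) : Prop :=
  ∃ C : ℝ≥0, HolderOnWith C α f s

/-- `∫_a^b L_s dy_s = v` as a Riemann-Stieltjes integral in the sense of Young: on `[a, b]` the
integrator `y` is `α`-Hölder, the integrand `L` (with values in linear maps acting on the
increments of `y`) is `β`-Hölder for some `β` with `α + β > 1`, and the tagged Riemann-Stieltjes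
sums converge to `v` as the mesh of the partition tends to `0`. -/
def HasYoungIntegral {E F : Type*} [NormedAddCommGroup E] [NormedSpace ℝ E]
    [NormedAddCommGroup F] [NormedSpace ℝ F]
    (α : ℝ≥0) (L : ℝ → E →L[ℝ] F) (y : ℝ → E) (a b : ℝ) (v : F) : Prop :=
  IsHolderOn α y (Icc a b) ∧
  (∃ β : ℝ≥0, 1 < α + β ∧ IsHolderOn β L (Icc a b)) ∧
  ∀ ε > 0, ∃ δ > 0, ∀ (n : ℕ) (t ξ : ℕ → ℝ), t 0 = a → t n = b →
    (∀ i < n, t i ≤ t (i + 1) ∧ t (i + 1) - t i < δ ∧ ξ i ∈ Icc (t i) (t (i + 1))) →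
    ‖∑ i ∈ Finset.range n, L (ξ i) (y (t (i + 1)) - y (t i)) - v‖ < ε

section Manifold

variable {E : Type*} [NormedAddCommGroup E] [NormedSpace ℝ E]
  {M : Type*} [TopologicalSpace M] [ChartedSpace E M]

/-- A path in a manifold is `α`-Hölder on `s` if it is so after composition with every smooth
real-valued function; no Riemannian metric has to be chosen. -/
def IsHolderPath (E : Type*) [NormedAddCommGroup E] [NormedSpace ℝ E]
    {M : Type*} [TopologicalSpace M] [ChartedSpace E M]
    (α : ℝ≥0) (x : ℝ → M) (s : Set ℝ) : Prop :=
  ∀ f : M → ℝ, ContMDiff 𝓘(ℝ, E) 𝓘(ℝ, ℝ) ∞ f → IsHolderOn α (fun t => f (x t)) s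

/-- The differential at `p` of a real function `f`, applied to a tangent vector `w`. -/
def dirDeriv (f : M → ℝ) (p : M) (w : TangentSpace 𝓘(ℝ, E) p) : ℝ :=
  mvfderiv 𝓘(ℝ, E) f p w

/-- The `α`-Hölder path `x` in `M` satisfies `dx_t = W_t dZ_t` on `[0, T]`, where `W_t` is a
tangent vector at `x_t`: for every smooth `f : M → ℝ` and every `t ∈ [0, T]`,
`f (x_t) - f (x_0) = ∫_0^t (W_s f) dZ_s` as a Young integral.
The equation `dx_t = X(x_t) dZ_t` is the case `W_t = X(x_t)`. -/
def SolvesYDE (α : ℝ≥0) (Z : ℝ → ℝ) (T : ℝ) (x : ℝ → M)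
    (W : ∀ t : ℝ, TangentSpace 𝓘(ℝ, E) (x t)) : Prop :=
  IsHolderPath E α x (Icc 0 T) ∧
  ∀ f : M → ℝ, ContMDiff 𝓘(ℝ, E) 𝓘(ℝ, ℝ) ∞ f → ∀ t ∈ Icc (0 : ℝ) T,
    HasYoungIntegral α
      (fun s => dirDeriv f (x s) (W s) • ContinuousLinearMap.id ℝ ℝ) Z 0 t (f (x t) - f (x 0))

/-- The coordinate expression, in the chart of `M` around `c`, of a 1-form `θ` with values in
`F`: a function on the model space with values in `E →L[ℝ] F`. -/
def formInChart {F : Type*} [NormedAddCommGroup F] [NormedSpace ℝ F]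
    (θ : ∀ p : M, TangentSpace 𝓘(ℝ, E) p →L[ℝ] F) (c : M) (y : E) : E →L[ℝ] F :=
  (θ ((extChartAt 𝓘(ℝ, E) c).symm y)).comp
    (mfderiv 𝓘(ℝ, E) 𝓘(ℝ, E) (extChartAt 𝓘(ℝ, E) c).symm y)

/-- `HasFormIntegral α θ x a b v` means `∫_a^b θ dx_s = v`, the Young integral of the 1-form `θ`
along the path `x`: computed in coordinates when `x([a, b])` lies in a chart domain, and by
additivity over finitely many subintervals in general. -/
inductive HasFormIntegral {F : Type*} [NormedAddCommGroup F] [NormedSpace ℝ F]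
    (α : ℝ≥0) (θ : ∀ p : M, TangentSpace 𝓘(ℝ, E) p →L[ℝ] F) (x : ℝ → M) : ℝ → ℝ → F → Prop
  | chart (c : M) (a b : ℝ) (v : F) (hab : a ≤ b)
      (hmem : ∀ s ∈ Icc a b, x s ∈ (extChartAt 𝓘(ℝ, E) c).source)
      (hint : HasYoungIntegral α (fun s => formInChart θ c (extChartAt 𝓘(ℝ, E) c (x s)))
        (fun s => extChartAt 𝓘(ℝ, E) c (x s)) a b v) :
      HasFormIntegral α θ x a b v
  | add (a b c : ℝ) (v w : F) (h₁ : HasFormIntegral α θ x a b v)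
      (h₂ : HasFormIntegral α θ x b c w) : HasFormIntegral α θ x a c (v + w)

/-- `φ_t = η_t ∘ ψ_t`, `t ∈ [0, τ]`, is the decomposition of the flow `φ` of `dx = X(x) dZ`
according to the pair of complementary distributions `Δ₁`, `Δ₂`. With `h_t` and
`V_t = (η_t)_* w_t` the splitting of the field is, at each point `p = η_t(x)`,
`X(p) = h_t(p) + V_t(p)`, `h_t(p) ∈ Δ₁(p)`, `V_t(p) ∈ (η_t)_* Δ₂ (p)`
(unique, as `η_t` preserves transversality of `Δ₁` and `Δ₂`), and
* `η` is generated by `Δ₁`: `dη_t = h_t(η_t) dZ_t`, `η_0 = id`;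
* `ψ` is generated by `Δ₂`: `dψ_t = w_t(ψ_t) dZ_t`, where `w_t = Ad(η_t⁻¹) V_t` is in `Δ₂`.
In the code `h t x` stands for the value of the field `h_t` at the point `η_t(x)`. -/
def IsFlowDecomposition (α : ℝ≥0) (Z : ℝ → ℝ) (τ : ℝ)
    (X : ∀ p : M, TangentSpace 𝓘(ℝ, E) p)
    (Δ₁ Δ₂ : ∀ p : M, Submodule ℝ (TangentSpace 𝓘(ℝ, E) p))
    (φ : ℝ → M → M) (η ψ : ℝ → (M ≃ₘ⟮𝓘(ℝ, E), 𝓘(ℝ, E)⟯ M)) : Prop :=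
  (∀ t ∈ Icc (0 : ℝ) τ, ∀ x, φ t x = η t (ψ t x)) ∧
  (∀ x, η 0 x = x) ∧
  (∀ t ∈ Icc (0 : ℝ) τ, ∀ x,
    Disjoint (Δ₁ (η t x)) ((Δ₂ x).map (mfderiv 𝓘(ℝ, E) 𝓘(ℝ, E) (η t) x).toLinearMap)) ∧
  ∃ (h : ∀ (t : ℝ) (x : M), TangentSpace 𝓘(ℝ, E) (η t x))
    (w : ∀ (_ : ℝ) (x : M), TangentSpace 𝓘(ℝ, E) x),
    (∀ t ∈ Icc (0 : ℝ) τ, ∀ x,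
      h t x ∈ Δ₁ (η t x) ∧ w t x ∈ Δ₂ x ∧
      X (η t x) = h t x + mfderiv 𝓘(ℝ, E) 𝓘(ℝ, E) (η t) x (w t x)) ∧
    (∀ x, SolvesYDE α Z τ (fun t => η t x) (fun t => h t x)) ∧
    (∀ x, SolvesYDE α Z τ (fun t => ψ t x) (fun t => w t (ψ t x)))

end Manifold

section LieGroup

variable {E : Type*} [NormedAddCommGroup E] [NormedSpace ℝ E]
  {G : Type*} [Group G] [TopologicalSpace G] [ChartedSpace E G]

/-- The right-invariant vector field `g ↦ A g` with value `A` at the identity. -/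
def rightInvariantField (A : GroupLieAlgebra 𝓘(ℝ, E) G) (g : G) : TangentSpace 𝓘(ℝ, E) g :=
  mfderiv 𝓘(ℝ, E) 𝓘(ℝ, E) (fun y : G => y * g) 1 A

/-- The adjoint action `Ad(a)`: the differential at the identity of `y ↦ a y a⁻¹`. -/
def adjointAction (a : G) (ξ : GroupLieAlgebra 𝓘(ℝ, E) G) : GroupLieAlgebra 𝓘(ℝ, E) G :=
  mfderiv 𝓘(ℝ, E) 𝓘(ℝ, E) (fun y : G => a * y * a⁻¹) 1 ξ

/-- The Lie algebra of a closed subgroup `H` of a Lie group, as a subset of the Lie algebra of the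
group: the velocities at `0` of the one-parameter subgroups that stay in `H`. -/
def subgroupLieAlgebra (E : Type*) [NormedAddCommGroup E] [NormedSpace ℝ E]
    {G : Type*} [Group G] [TopologicalSpace G] [ChartedSpace E G]
    (H : Subgroup G) : Set (GroupLieAlgebra 𝓘(ℝ, E) G) :=
  {ξ | ∃ c : ℝ → G, ContMDiff 𝓘(ℝ, ℝ) 𝓘(ℝ, E) ∞ c ∧ (∀ s t, c (s + t) = c s * c t) ∧
    (∀ t, c t ∈ H) ∧ mfderiv 𝓘(ℝ, ℝ) 𝓘(ℝ, E) c 0 (1 : ℝ) = ξ}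

/-- The tangent space at the identity seen as the normed space `E` on which `G` is modelled. -/
def lieAlgebraToModel (E : Type*) [NormedAddCommGroup E] [NormedSpace ℝ E]
    (G : Type*) [Group G] [TopologicalSpace G] [ChartedSpace E G] :
    GroupLieAlgebra 𝓘(ℝ, E) G →L[ℝ] E :=
  ContinuousLinearMap.id ℝ E

/-- A connection form on the principal `H`-bundle `G → G/H`: a smooth 1-form `θ` on `G` with values
in the Lie algebra of `H`, equivariant under right translations by `H`, and reproducing the
generators `x ↦ x ξ` (the left-invariant fields, `ξ` in the Lie algebra of `H`) of the right
action of `H` on `G`. -/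
structure IsConnectionForm [LieGroup 𝓘(ℝ, E) ∞ G] (H : Subgroup G)
    (θ : ∀ x : G, TangentSpace 𝓘(ℝ, E) x →L[ℝ] GroupLieAlgebra 𝓘(ℝ, E) G) : Prop where
  smooth : ContMDiff 𝓘(ℝ, E).tangent 𝓘(ℝ, E) ∞
    (fun p : TangentBundle 𝓘(ℝ, E) G => lieAlgebraToModel E G (θ p.1 p.2))
  mem : ∀ x v, θ x v ∈ subgroupLieAlgebra E H
  equivariant : ∀ (x : G) (v : TangentSpace 𝓘(ℝ, E) x), ∀ a ∈ H,
    θ (x * a) (mfderiv 𝓘(ℝ, E) 𝓘(ℝ, E) (fun y : G => y * a) x v) = adjointAction a⁻¹ (θ x v)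
  calibrated : ∀ ξ ∈ subgroupLieAlgebra E H, ∀ x : G, θ x (mulInvariantVectorField ξ x) = ξ

/-- The vertical space at `x`: the tangent space `x 𝔥` of the fibre `x H` of `G → G/H`
(the set spanned is already a linear subspace when `H` is closed). -/
def verticalSpace (H : Subgroup G) (x : G) : Submodule ℝ (TangentSpace 𝓘(ℝ, E) x) :=
  Submodule.span ℝ ((fun ξ => mulInvariantVectorField ξ x) '' subgroupLieAlgebra E H)

/-- The horizontal space at `x`: the kernel of the connection form. -/
def horizontalSpace (θ : ∀ x : G, TangentSpace 𝓘(ℝ, E) x →L[ℝ] GroupLieAlgebra 𝓘(ℝ, E) G)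
    (x : G) : Submodule ℝ (TangentSpace 𝓘(ℝ, E) x) :=
  LinearMap.ker (θ x).toLinearMap

/-- `u` is the horizontal lift on `[0, T]`, starting at `x`, of the path `m` in `G/H`: an
`α`-Hölder path in `G` over `m` with `u_0 = x` and `∫_0^t θ du_s = 0` for all `t ∈ [0, T]`. -/
structure IsHorizontalLift (α : ℝ≥0) (H : Subgroup G)
    (θ : ∀ x : G, TangentSpace 𝓘(ℝ, E) x →L[ℝ] GroupLieAlgebra 𝓘(ℝ, E) G)
    (T : ℝ) (m : ℝ → G ⧸ H) (x : G) (u : ℝ → G) : Prop where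
  holder : IsHolderPath E α u (Icc 0 T)
  start : u 0 = x
  proj : ∀ t ∈ Icc (0 : ℝ) T, (QuotientGroup.mk (u t) : G ⧸ H) = m t
  horizontal : ∀ t ∈ Icc (0 : ℝ) T,
    HasFormIntegral α (fun p => (lieAlgebraToModel E G).comp (θ p)) u 0 t 0

end LieGroup

end YoungCalculus

/-! Existence. Since `Z` is scalar, a smooth curve `γ` evaluated at `Z t - Z 0` solves the Young
equation with velocity `γ'`; this chain rule (`hasYoungIntegral_comp`, `solvesYDE_of_curve`) uses `α
> 1/2`. Every path to be produced is therefore a time change of an ODE solution. With `c` the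
one-parameter subgroup generated by `A`, the solution is `g t = c (Z t - Z 0)`. Let `Ψ` be the flow
of the horizontal part `X p = A p - p ω(A p)` of the right-invariant field. Both `A p` and `ω`
behave equivariantly under right translation by `H`, so `X` and `Ψ` commute with these translations.
The field `X` differs from `A p` by a vertical vector, so `Ψ z x` lies in the coset `c z x H`. This
makes `X` complete: local flows around the compact arc `c([-R, R]) x` are carried to whole cosets by
`H`, so there is a uniform existence time. Then `η t = Ψ (Z t - Z 0)` is horizontal, maps `x ξ` to
`Ψ z x ξ` for `ξ ∈ 𝔥`, and `ψ t = η t⁻¹ ∘ φ t` is `x ↦ x (Ψ z x)⁻¹ c(z) x`, a vertical motion.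

Uniqueness. Hölder paths are not differentiable, but Young's estimate gives their increments `(x
s)⁻¹ x t` up to `o(t - s)` as `t ↓ s`. The predicate `HasJet` records this: the increments are of
order `ρ = |t - s|^α` with `ρ² = o(t - s)`, so only the linear part matters and products, inverses
and conjugates are computed in the Lie algebra. A path with zero jets is constant
(`eq_of_hasJet_zero`), and a path with jets in `𝔥` stays in a coset of `H`
(`inv_mul_mem_of_hasJet`).

Two horizontal paths `u`, `v` over the same path in `G ⧸ H` differ by `v⁻¹ u`, with values in `H`.
The connection form kills its increments up to `o(t - s)`, while on `H` near the identity the form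
is close to the identity map, by a weak version of Cartan's closed subgroup theorem
(`eventually_norm_sub_le_of_mem`). So these increments are `o(t - s)` and `u = v`
(`IsConnectionForm.eq_of_horizontal`). Any horizontal lift is thus the path of `Ψ`. In any
decomposition `ψ` preserves the cosets of `H`, so `η t x` lies over `g t x`, moves horizontally, and
is the same path. -/

set_option linter.unusedSectionVars false
/-! ### Riemann-Stieltjes sums -/

section Young

open Filter Topology

variable {E F : Type*} [NormedAddCommGroup E] [NormedSpace ℝ E]
  [NormedAddCommGroup F] [NormedSpace ℝ F]

/-- `t` is a partition of `[a, b]` into `n` intervals of mesh less than `δ`, tagged by `ξ`. -/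
def IsFinePartition (a b δ : ℝ) (n : ℕ) (t ξ : ℕ → ℝ) : Prop :=
  t 0 = a ∧ t n = b ∧
    ∀ i < n, t i ≤ t (i + 1) ∧ t (i + 1) - t i < δ ∧ ξ i ∈ Icc (t i) (t (i + 1))

/-- The Riemann-Stieltjes sum of `L dy` along the tagged partition `(t, ξ)`. -/
def stieltjesSum (L : ℝ → E →L[ℝ] F) (y : ℝ → E) (n : ℕ) (t ξ : ℕ → ℝ) : F :=
  ∑ i ∈ Finset.range n, L (ξ i) (y (t (i + 1)) - y (t i))

theorem IsFinePartition.mono {a b δ δ' : ℝ} {n : ℕ} {t ξ : ℕ → ℝ}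
    (h : IsFinePartition a b δ n t ξ) (hδ : δ ≤ δ') : IsFinePartition a b δ' n t ξ :=
  ⟨h.1, h.2.1, fun i hi => ⟨(h.2.2 i hi).1, (h.2.2 i hi).2.1.trans_le hδ, (h.2.2 i hi).2.2⟩⟩

theorem IsFinePartition.mem_Icc {a b δ : ℝ} {n : ℕ} {t ξ : ℕ → ℝ}
    (h : IsFinePartition a b δ n t ξ) {i : ℕ} (hi : i ≤ n) : t i ∈ Icc a b := by
  have h1 : ∀ j ≤ n, a ≤ t j := by
    intro j
    induction j with
    | zero => intro _; exact h.1.ge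
    | succ k ih => intro hk; exact (ih (by omega)).trans (h.2.2 k (by omega)).1
  have h2 : ∀ j ≤ n, t (n - j) ≤ b := by
    intro j
    induction j with
    | zero => intro _; exact h.2.1.le
    | succ k ih =>
      intro hk
      have := (h.2.2 (n - (k + 1)) (by omega)).1
      rw [show n - (k + 1) + 1 = n - k by omega] at this
      exact this.trans (ih (by omega))
  refine ⟨h1 i hi, ?_⟩
  have := h2 (n - i) (by omega)
  rwa [show n - (n - i) = i by omega] at this

theorem IsFinePartition.tag_mem_Icc {a b δ : ℝ} {n : ℕ} {t ξ : ℕ → ℝ}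
    (h : IsFinePartition a b δ n t ξ) {i : ℕ} (hi : i < n) : ξ i ∈ Icc a b :=
  ⟨(h.mem_Icc hi.le).1.trans (h.2.2 i hi).2.2.1,
    (h.2.2 i hi).2.2.2.trans (h.mem_Icc (show i + 1 ≤ n from hi)).2⟩

theorem IsFinePartition.append {a b c δ : ℝ} {n m : ℕ} {t ξ t' ξ' : ℕ → ℝ}
    (h : IsFinePartition a b δ n t ξ) (h' : IsFinePartition b c δ m t' ξ')
    (L : ℝ → E →L[ℝ] F) (y : ℝ → E) :
    ∃ T Ξ, IsFinePartition a c δ (n + m) T Ξ ∧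
      stieltjesSum L y (n + m) T Ξ = stieltjesSum L y n t ξ + stieltjesSum L y m t' ξ' := by
  have e1 : ∀ i ≤ n, (fun i => if i ≤ n then t i else t' (i - n)) i = t i := by
    intro i hi; simp [hi]
  have e2 : ∀ i, (fun i => if i ≤ n then t i else t' (i - n)) (n + i) = t' i := by
    intro i
    rcases Nat.eq_zero_or_pos i with rfl | hi
    · simp [h.2.1, h'.1]
    · simp [hi.ne']
  refine ⟨fun i => if i ≤ n then t i else t' (i - n),
    fun i => if i < n then ξ i else ξ' (i - n), ⟨?_, ?_, ?_⟩, ?_⟩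
  · rw [e1 0 (Nat.zero_le _), h.1]
  · rw [e2, h'.2.1]
  · intro i hi
    by_cases hin : i < n
    · rw [e1 i hin.le, e1 (i + 1) hin]
      simpa [hin] using h.2.2 i hin
    · obtain ⟨j, rfl⟩ := Nat.exists_eq_add_of_le (not_lt.1 hin)
      rw [e2, add_assoc, e2]
      simpa using h'.2.2 j (by omega)
  · unfold stieltjesSum
    rw [Finset.sum_range_add]
    congr 1
    · refine Finset.sum_congr rfl fun i hi => ?_
      have hin := Finset.mem_range.1 hi
      rw [e1 i hin.le, e1 (i + 1) hin]
      simp [hin]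
    · refine Finset.sum_congr rfl fun i _ => ?_
      rw [e2, add_assoc, e2]
      simp

/-- The partition of `[a, b]` into `n` equal intervals. -/
noncomputable def uniformPartition (a b : ℝ) (n : ℕ) (i : ℕ) : ℝ := a + i * ((b - a) / n)

theorem isFinePartition_uniform {a b δ : ℝ} (hab : a ≤ b) {n : ℕ} (hn : n ≠ 0)
    (h : (b - a) / n < δ) :
    IsFinePartition a b δ n (uniformPartition a b n) (uniformPartition a b n) := by
  have hn' : (n : ℝ) ≠ 0 := by exact_mod_cast hn
  have h0 : 0 ≤ (b - a) / n := div_nonneg (sub_nonneg.2 hab) n.cast_nonneg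
  refine ⟨by simp [uniformPartition], by simp only [uniformPartition]; field_simp; ring,
    fun i _ => ?_⟩
  have e : uniformPartition a b n (i + 1) = uniformPartition a b n i + (b - a) / n := by
    simp only [uniformPartition]; push_cast; ring
  rw [e]
  refine ⟨by linarith, by linarith, by constructor <;> linarith⟩

theorem exists_isFinePartition {a b δ : ℝ} (hab : a ≤ b) (hδ : 0 < δ) :
    ∃ n t ξ, IsFinePartition a b δ n t ξ := by
  obtain ⟨n, hn⟩ := exists_nat_gt ((b - a) / δ)
  have hn0 : (0 : ℝ) < n := (div_nonneg (sub_nonneg.2 hab) hδ.le).trans_lt hn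
  refine ⟨n, _, _, isFinePartition_uniform hab (by exact_mod_cast hn0.ne') ?_⟩
  rw [div_lt_iff₀ hn0]
  rw [div_lt_iff₀ hδ] at hn
  linarith

/-! ### Hölder functions and elementary properties of the Young integral. -/

theorem IsHolderOn.mono {Y : Type*} [PseudoEMetricSpace Y] {α : ℝ≥0} {f : ℝ → Y} {s t : Set ℝ}
    (h : IsHolderOn α f s) (hst : t ⊆ s) : IsHolderOn α f t :=
  h.imp fun _ hC => hC.mono hst

theorem IsHolderOn.exists_dist_le {Y : Type*} [PseudoMetricSpace Y] {α : ℝ≥0} {f : ℝ → Y}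
    {s : Set ℝ} (h : IsHolderOn α f s) :
    ∃ C : ℝ, 0 ≤ C ∧ ∀ x ∈ s, ∀ z ∈ s, dist (f x) (f z) ≤ C * |x - z| ^ (α : ℝ) := by
  obtain ⟨C, hC⟩ := h
  refine ⟨C, C.2, fun x hx z hz => ?_⟩
  have := hC x hx z hz
  rw [edist_nndist, edist_nndist, ← ENNReal.coe_rpow_of_nonneg _ α.coe_nonneg, ← ENNReal.coe_mul,
    ENNReal.coe_le_coe] at this
  have h2 : ((nndist (f x) (f z) : ℝ≥0) : ℝ) ≤ ((C * nndist x z ^ (α : ℝ) : ℝ≥0) : ℝ) := by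
    exact_mod_cast this
  simpa [Real.dist_eq] using h2

theorem isHolderOn_of_dist_le {Y : Type*} [PseudoMetricSpace Y] {α : ℝ≥0} {f : ℝ → Y}
    {s : Set ℝ} {C : ℝ}
    (h : ∀ x ∈ s, ∀ z ∈ s, dist (f x) (f z) ≤ C * |x - z| ^ (α : ℝ)) : IsHolderOn α f s := by
  refine ⟨C.toNNReal, fun x hx z hz => ?_⟩
  have h1 : dist (f x) (f z) ≤ C.toNNReal * |x - z| ^ (α : ℝ) :=
    (h x hx z hz).trans (mul_le_mul_of_nonneg_right (Real.le_coe_toNNReal C) (by positivity))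
  rw [edist_nndist, edist_nndist, ← ENNReal.coe_rpow_of_nonneg _ α.coe_nonneg, ← ENNReal.coe_mul,
    ENNReal.coe_le_coe, ← NNReal.coe_le_coe]
  simpa [Real.dist_eq] using h1

theorem IsHolderOn.congr {Y : Type*} [PseudoEMetricSpace Y] {α : ℝ≥0} {f g : ℝ → Y} {s : Set ℝ}
    (h : IsHolderOn α f s) (hfg : ∀ x ∈ s, g x = f x) : IsHolderOn α g s := by
  obtain ⟨C, hC⟩ := h
  exact ⟨C, fun x hx z hz => by rw [hfg x hx, hfg z hz]; exact hC x hx z hz⟩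

theorem hasYoungIntegral_iff {α : ℝ≥0} {L : ℝ → E →L[ℝ] F} {y : ℝ → E} {a b : ℝ} {v : F} :
    HasYoungIntegral α L y a b v ↔ IsHolderOn α y (Icc a b) ∧
      (∃ β : ℝ≥0, 1 < α + β ∧ IsHolderOn β L (Icc a b)) ∧
      ∀ ε > 0, ∃ δ > 0, ∀ n t ξ, IsFinePartition a b δ n t ξ →
        ‖stieltjesSum L y n t ξ - v‖ < ε := by
  constructor
  · rintro ⟨h1, h2, h3⟩
    refine ⟨h1, h2, fun ε hε => ?_⟩
    obtain ⟨δ, hδ, h⟩ := h3 ε hε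
    exact ⟨δ, hδ, fun n t ξ hp => h n t ξ hp.1 hp.2.1 hp.2.2⟩
  · rintro ⟨h1, h2, h3⟩
    refine ⟨h1, h2, fun ε hε => ?_⟩
    obtain ⟨δ, hδ, h⟩ := h3 ε hε
    exact ⟨δ, hδ, fun n t ξ ha hb hp => h n t ξ ⟨ha, hb, hp⟩⟩

theorem HasYoungIntegral.unique {α : ℝ≥0} {L : ℝ → E →L[ℝ] F} {y : ℝ → E} {a b : ℝ} {v w : F}
    (hab : a ≤ b) (hv : HasYoungIntegral α L y a b v) (hw : HasYoungIntegral α L y a b w) :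
    v = w := by
  rw [← sub_eq_zero, ← norm_eq_zero]
  refine le_antisymm (le_of_forall_pos_le_add fun ε hε => ?_) (norm_nonneg _)
  obtain ⟨δ, hδ, h⟩ := (hasYoungIntegral_iff.1 hv).2.2 (ε / 2) (half_pos hε)
  obtain ⟨δ', hδ', h'⟩ := (hasYoungIntegral_iff.1 hw).2.2 (ε / 2) (half_pos hε)
  obtain ⟨n, t, ξ, hp⟩ := exists_isFinePartition hab (lt_min hδ hδ')
  have h1 := h n t ξ (hp.mono (min_le_left _ _))
  have h2 := h' n t ξ (hp.mono (min_le_right _ _))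
  calc ‖v - w‖ = ‖(stieltjesSum L y n t ξ - w) - (stieltjesSum L y n t ξ - v)‖ := by
        congr 1; abel
    _ ≤ 0 + ε := by have := norm_sub_le (stieltjesSum L y n t ξ - w)
                      (stieltjesSum L y n t ξ - v); linarith

theorem HasYoungIntegral.self {α : ℝ≥0} {L : ℝ → E →L[ℝ] F} {y : ℝ → E} {a : ℝ} {v : F}
    (hv : HasYoungIntegral α L y a a v) : v = 0 := by
  rw [← norm_eq_zero]
  refine le_antisymm (le_of_forall_pos_le_add fun ε hε => ?_) (norm_nonneg _)
  obtain ⟨δ, hδ, h⟩ := (hasYoungIntegral_iff.1 hv).2.2 ε hε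
  have := h 0 (fun _ => a) (fun _ => a) ⟨rfl, rfl, by simp⟩
  simpa [stieltjesSum] using this.le

/-- The Young integral over an interval restricts to the initial subintervals. -/
theorem HasYoungIntegral.exists_initial [CompleteSpace F] {α : ℝ≥0} {L : ℝ → E →L[ℝ] F}
    {y : ℝ → E} {a b : ℝ} {v : F} (hv : HasYoungIntegral α L y a b v) {t : ℝ}
    (ht : t ∈ Icc a b) : ∃ w, HasYoungIntegral α L y a t w := by
  obtain ⟨h1, ⟨β, hβ, h2⟩, h3⟩ := hasYoungIntegral_iff.1 hv
  -- Two fine partitions of `[a, t]` are completed by the same partition of `[t, b]`. The common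
  -- tail cancels, so the sums over `[a, t]` satisfy the Cauchy criterion.
  have key : ∀ ε > 0, ∃ δ > 0, ∀ n p ξ m q η, IsFinePartition a t δ n p ξ →
      IsFinePartition a t δ m q η →
      ‖stieltjesSum L y n p ξ - stieltjesSum L y m q η‖ < ε := by
    intro ε hε
    obtain ⟨δ, hδ, h⟩ := h3 (ε / 2) (half_pos hε)
    obtain ⟨k, r, ζ, hr⟩ := exists_isFinePartition ht.2 hδ
    refine ⟨δ, hδ, fun n p ξ m q η hp hq => ?_⟩
    obtain ⟨P, Ξ, hP, eP⟩ := hp.append hr L y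
    obtain ⟨Q, H, hQ, eQ⟩ := hq.append hr L y
    have i1 := h _ _ _ hP
    have i2 := h _ _ _ hQ
    rw [eP] at i1
    rw [eQ] at i2
    have e : stieltjesSum L y n p ξ - stieltjesSum L y m q η =
      (stieltjesSum L y n p ξ + stieltjesSum L y k r ζ - v) -
        (stieltjesSum L y m q η + stieltjesSum L y k r ζ - v) := by abel
    rw [e]
    refine (norm_sub_le _ _).trans_lt (by linarith)
  have hex : ∀ k : ℕ, ∃ n p ξ, IsFinePartition a t (1 / ((k : ℝ) + 1)) n p ξ := fun k =>
    exists_isFinePartition ht.1 (by positivity)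
  choose n p ξ hp using hex
  have hc : CauchySeq fun k => stieltjesSum L y (n k) (p k) (ξ k) := by
    rw [Metric.cauchySeq_iff]
    intro ε hε
    obtain ⟨δ, hδ, h⟩ := key ε hε
    obtain ⟨N, hN⟩ := exists_nat_one_div_lt hδ
    refine ⟨N, fun i hi j hj => ?_⟩
    rw [dist_eq_norm]
    have hle : ∀ i ≥ N, 1 / ((i : ℝ) + 1) ≤ δ := fun i hi =>
      (one_div_le_one_div_of_le (by positivity)
        (by have : (N : ℝ) ≤ i := by exact_mod_cast hi
            linarith)).trans hN.le
    exact h _ _ _ _ _ _ ((hp i).mono (hle i hi)) ((hp j).mono (hle j hj))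
  obtain ⟨w, hw⟩ := cauchySeq_tendsto_of_complete hc
  have hsub : Icc a t ⊆ Icc a b := Icc_subset_Icc_right ht.2
  refine ⟨w, hasYoungIntegral_iff.2 ⟨h1.mono hsub, ⟨β, hβ, h2.mono hsub⟩, fun ε hε => ?_⟩⟩
  obtain ⟨δ, hδ, h⟩ := key (ε / 2) (half_pos hε)
  refine ⟨δ, hδ, fun m q η hq => ?_⟩
  have hlim : Tendsto (fun k => ‖stieltjesSum L y m q η - stieltjesSum L y (n k) (p k) (ξ k)‖)
      atTop (𝓝 ‖stieltjesSum L y m q η - w‖) := (tendsto_const_nhds.sub hw).norm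
  refine (le_of_tendsto hlim ?_).trans_lt (half_lt_self hε)
  obtain ⟨N, hN⟩ := exists_nat_one_div_lt hδ
  filter_upwards [eventually_ge_atTop N] with i hi
  refine (h _ _ _ _ _ _ hq ((hp i).mono ?_)).le
  exact (one_div_le_one_div_of_le (by positivity)
        (by have : (N : ℝ) ≤ i := by exact_mod_cast hi
            linarith)).trans hN.le

/-! ### Young's estimate and the chain rule for Young integrals. -/

theorem sum_range_two_mul {M : Type*} [AddCommMonoid M] (f : ℕ → M) (n : ℕ) :
    ∑ i ∈ Finset.range (2 * n), f i = ∑ i ∈ Finset.range n, (f (2 * i) + f (2 * i + 1)) := by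
  induction n with
  | zero => simp
  | succ k ih =>
    rw [Nat.mul_succ, Finset.sum_range_succ, Finset.sum_range_succ, ih, Finset.sum_range_succ]
    rw [add_assoc]

/-- Young's estimate for the sums along the dyadic partitions of an interval. -/
theorem norm_dyadicSum_sub_le {L : ℝ → E →L[ℝ] F} {y : ℝ → E} {s t α β CL Cy : ℝ}
    (hst : s ≤ t) (hCL : 0 ≤ CL) (hCy : 0 ≤ Cy) (hα : 0 ≤ α) (hβ : 0 ≤ β) (hαβ : 1 < α + β)
    (hL : ∀ x ∈ Icc s t, ∀ z ∈ Icc s t, ‖L x - L z‖ ≤ CL * |x - z| ^ β)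
    (hy : ∀ x ∈ Icc s t, ∀ z ∈ Icc s t, ‖y x - y z‖ ≤ Cy * |x - z| ^ α) (n : ℕ) :
    ‖stieltjesSum L y (2 ^ n) (uniformPartition s t (2 ^ n)) (uniformPartition s t (2 ^ n))
      - L s (y t - y s)‖ ≤
      CL * Cy * (1 - 2 * (1 / 2 : ℝ) ^ (α + β))⁻¹ * (t - s) ^ (α + β) := by
  set γ := α + β with hγ
  set r : ℝ := (1 / 2 : ℝ) ^ γ with hr
  have hr0 : 0 ≤ r := by positivity
  -- This is where `α + β > 1` enters: refining doubles the number of terms and multiplies each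
  -- error by `r`, so the errors form a geometric series of ratio `2 * r < 1`.
  have hr1 : r < 1 / 2 := by
    have := Real.rpow_lt_rpow_of_exponent_gt (x := (1 / 2 : ℝ)) (by norm_num) (by norm_num) hαβ
    rwa [Real.rpow_one] at this
  set h := t - s with hh
  have hh0 : 0 ≤ h := sub_nonneg.2 hst
  have step : ∀ k : ℕ,
      ‖stieltjesSum L y (2 ^ (k + 1)) (uniformPartition s t (2 ^ (k + 1)))
          (uniformPartition s t (2 ^ (k + 1))) -
        stieltjesSum L y (2 ^ k) (uniformPartition s t (2 ^ k)) (uniformPartition s t (2 ^ k))‖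
        ≤ CL * Cy * h ^ γ * (2 * r) ^ k := by
    intro k
    set P := uniformPartition s t (2 ^ (k + 1)) with hP
    have e0 : ∀ i, uniformPartition s t (2 ^ k) i = P (2 * i) := by
      intro i
      simp only [hP, uniformPartition]
      push_cast
      rw [pow_succ]
      field_simp
    have hfine := isFinePartition_uniform (δ := h / (2 ^ (k + 1) : ℕ) + 1) hst
      (n := 2 ^ (k + 1)) (by positivity) (by linarith)
    have hmem : ∀ i ≤ 2 ^ (k + 1), P i ∈ Icc s t := fun i hi => hfine.mem_Icc hi
    set d : ℝ := h / 2 ^ (k + 1) with hd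
    have hd0 : 0 ≤ d := by positivity
    have hinc : ∀ i, P (i + 1) - P i = d := by
      intro i; simp only [hP, uniformPartition, hd]; push_cast; ring
    unfold stieltjesSum
    rw [pow_succ' 2 k, sum_range_two_mul, ← Finset.sum_sub_distrib]
    have bound : ∀ i ∈ Finset.range (2 ^ k),
        ‖L (P (2 * i)) (y (P (2 * i + 1)) - y (P (2 * i))) +
            L (P (2 * i + 1)) (y (P (2 * i + 1 + 1)) - y (P (2 * i + 1))) -
          L (uniformPartition s t (2 ^ k) i)
            (y (uniformPartition s t (2 ^ k) (i + 1)) - y (uniformPartition s t (2 ^ k) i))‖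
          ≤ CL * Cy * d ^ γ := by
      intro i hi
      have hi' := Finset.mem_range.1 hi
      have hpow : 2 ^ (k + 1) = 2 * 2 ^ k := pow_succ' 2 k
      rw [e0, e0, show 2 * (i + 1) = 2 * i + 1 + 1 by ring]
      -- Inserting the midpoint changes the tag only on the right half, so the error is a product of
      -- one increment of `L` and one of `y`.
      have e : L (P (2 * i)) (y (P (2 * i + 1)) - y (P (2 * i))) +
            L (P (2 * i + 1)) (y (P (2 * i + 1 + 1)) - y (P (2 * i + 1))) -
          L (P (2 * i)) (y (P (2 * i + 1 + 1)) - y (P (2 * i))) =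
          (L (P (2 * i + 1)) - L (P (2 * i))) (y (P (2 * i + 1 + 1)) - y (P (2 * i + 1))) := by
        simp only [map_sub, sub_apply]; abel
      rw [e]
      have m0 := hmem (2 * i) (by omega)
      have m1 := hmem (2 * i + 1) (by omega)
      have m2 := hmem (2 * i + 1 + 1) (by omega)
      have b1 := hL _ m1 _ m0
      have b2 := hy _ m2 _ m1
      rw [hinc, abs_of_nonneg hd0] at b1 b2
      calc _ ≤ ‖L (P (2 * i + 1)) - L (P (2 * i))‖ *
              ‖y (P (2 * i + 1 + 1)) - y (P (2 * i + 1))‖ := ContinuousLinearMap.le_opNorm _ _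
        _ ≤ (CL * d ^ β) * (Cy * d ^ α) := by gcongr
        _ = CL * Cy * d ^ γ := by
          rw [hγ, add_comm α β, Real.rpow_add_of_nonneg hd0 hβ hα]; ring
    refine (norm_sum_le_of_le _ bound).trans ?_
    have hdγ : d ^ γ = h ^ γ * r ^ (k + 1) := by
      rw [hd, div_eq_mul_one_div, Real.mul_rpow hh0 (by positivity), hr, ← one_div_pow,
        ← Real.rpow_natCast, ← Real.rpow_mul (by norm_num), ← Real.rpow_natCast,
        ← Real.rpow_mul (by norm_num), mul_comm γ]
    rw [Finset.sum_const, Finset.card_range, nsmul_eq_mul, hdγ]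
    push_cast
    have : 0 ≤ CL * Cy * h ^ γ * (2 * r) ^ k := by positivity
    calc (2 : ℝ) ^ k * (CL * Cy * (h ^ γ * r ^ (k + 1)))
        = CL * Cy * h ^ γ * (2 * r) ^ k * r := by rw [mul_pow]; ring
      _ ≤ CL * Cy * h ^ γ * (2 * r) ^ k * 1 := by gcongr; linarith
      _ = _ := mul_one _
  have total : ∀ k : ℕ,
      ‖stieltjesSum L y (2 ^ k) (uniformPartition s t (2 ^ k)) (uniformPartition s t (2 ^ k)) -
        L s (y t - y s)‖ ≤ CL * Cy * h ^ γ * ∑ i ∈ Finset.range k, (2 * r) ^ i := by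
    intro k
    induction k with
    | zero =>
      simp [stieltjesSum, uniformPartition]
    | succ k ih =>
      rw [Finset.sum_range_succ, mul_add]
      refine (norm_sub_le_norm_sub_add_norm_sub _ _ _).trans ((add_le_add (step k) ih).trans ?_)
      rw [add_comm]
  refine (total n).trans ?_
  have hsum : ∑ i ∈ Finset.range n, (2 * r) ^ i ≤ (1 - 2 * r)⁻¹ := by
    rw [← tsum_geometric_of_lt_one (by positivity) (by linarith)]
    exact (summable_geometric_of_lt_one (by positivity) (by linarith)).sum_le_tsum _
      (fun i _ => by positivity)
  calc _ ≤ CL * Cy * h ^ γ * (1 - 2 * r)⁻¹ := by gcongr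
    _ = _ := by ring

/-- Young's estimate for the increments of an indefinite Young integral. -/
theorem exists_norm_increment_le {α β : ℝ≥0} {L : ℝ → E →L[ℝ] F} {y : ℝ → E} {a b : ℝ}
    (hαβ : 1 < α + β) (hy : IsHolderOn α y (Icc a b)) (hL : IsHolderOn β L (Icc a b)) :
    ∃ C : ℝ, 0 ≤ C ∧ ∀ s t : ℝ, a ≤ s → s ≤ t → t ≤ b → ∀ v w : F,
      HasYoungIntegral α L y a s v → HasYoungIntegral α L y a t w →
      ‖w - v - L s (y t - y s)‖ ≤ C * (t - s) ^ (α + β : ℝ) := by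
  obtain ⟨CL, hCL, hL⟩ := hL.exists_dist_le
  obtain ⟨Cy, hCy, hy⟩ := hy.exists_dist_le
  have hαβ' : 1 < (α : ℝ) + β := by exact_mod_cast hαβ
  refine ⟨CL * Cy * (1 - 2 * (1 / 2 : ℝ) ^ (α + β : ℝ))⁻¹, ?_, fun s t has hst htb v w hv hw => ?_⟩
  · have := Real.rpow_lt_rpow_of_exponent_gt (x := (1 / 2 : ℝ)) (by norm_num) (by norm_num) hαβ'
    rw [Real.rpow_one] at this
    have : 0 ≤ (1 - 2 * (1 / 2 : ℝ) ^ (α + β : ℝ))⁻¹ := inv_nonneg.2 (by linarith)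
    positivity
  refine le_of_forall_pos_le_add fun ε hε => ?_
  obtain ⟨δ, hδ, h⟩ := (hasYoungIntegral_iff.1 hv).2.2 (ε / 2) (half_pos hε)
  obtain ⟨δ', hδ', h'⟩ := (hasYoungIntegral_iff.1 hw).2.2 (ε / 2) (half_pos hε)
  obtain ⟨n, p, ξ, hp⟩ := exists_isFinePartition has (lt_min hδ hδ')
  obtain ⟨k, hk⟩ := exists_nat_gt ((t - s) / min δ δ')
  have hmin := lt_min hδ hδ'
  have hq := isFinePartition_uniform (δ := min δ δ') hst (n := 2 ^ k) (by positivity) (by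
    have h2 : (k : ℝ) < 2 ^ k := by exact_mod_cast Nat.lt_two_pow_self
    push_cast
    rw [div_lt_iff₀ (by positivity)]
    rw [div_lt_iff₀ hmin] at hk
    nlinarith)
  -- A partition of `[a, s]` followed by a dyadic partition of `[s, t]`: the two sums are near `v`
  -- and `w`, so the dyadic part is near `w - v`, and it is controlled by the previous estimate.
  obtain ⟨P, Ξ, hP, eP⟩ := hp.append hq L y
  have i1 := h _ _ _ (hp.mono (min_le_left _ _))
  have i2 := h' _ _ _ (hP.mono (min_le_right _ _))
  have sub : Icc s t ⊆ Icc a b := Icc_subset_Icc has htb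
  have i3 := norm_dyadicSum_sub_le (L := L) (y := y) hst hCL hCy α.coe_nonneg β.coe_nonneg hαβ'
    (fun x hx z hz => by rw [← dist_eq_norm]; exact hL x (sub hx) z (sub hz))
    (fun x hx z hz => by rw [← dist_eq_norm]; exact hy x (sub hx) z (sub hz)) k
  rw [eP] at i2
  set S := stieltjesSum L y n p ξ
  set D := stieltjesSum L y (2 ^ k) (uniformPartition s t (2 ^ k)) (uniformPartition s t (2 ^ k))
  have e : w - v - L s (y t - y s) = (S - v) - (S + D - w) + (D - L s (y t - y s)) := by abel
  rw [e]
  have i4 := norm_add_le ((S - v) - (S + D - w)) (D - L s (y t - y s))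
  have i5 := norm_sub_le (S - v) (S + D - w)
  exact i4.trans (by linarith [i3])

/-- A criterion for Young integrability: the increments of `V` are given by `L dy` up to an error
of order larger than one. -/
theorem hasYoungIntegral_of_increments {α β : ℝ≥0} {L : ℝ → E →L[ℝ] F} {y : ℝ → E} {a b : ℝ}
    (hαβ : 1 < α + β) (hy : IsHolderOn α y (Icc a b)) (hL : IsHolderOn β L (Icc a b))
    (V : ℝ → F) {C γ : ℝ} (hγ : 1 < γ)
    (h : ∀ s ξ t, a ≤ s → s ≤ ξ → ξ ≤ t → t ≤ b →
      ‖L ξ (y t - y s) - (V t - V s)‖ ≤ C * (t - s) ^ γ) :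
    HasYoungIntegral α L y a b (V b - V a) := by
  refine hasYoungIntegral_iff.2 ⟨hy, ⟨β, hαβ, hL⟩, fun ε hε => ?_⟩
  -- With mesh at most `δ`, each error is at most `|C| δ^(γ-1)` times the length of its interval,
  -- and the lengths add up to `b - a`.
  have hlim : Filter.Tendsto (fun δ : ℝ => |C| * δ ^ (γ - 1) * (b - a)) (𝓝 0) (𝓝 0) := by
    have : ContinuousAt (fun δ : ℝ => |C| * δ ^ (γ - 1) * (b - a)) 0 := by
      refine ContinuousAt.mul (continuousAt_const.mul ?_) continuousAt_const
      exact Real.continuousAt_rpow_const _ _ (Or.inr (by linarith))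
    simpa [ContinuousAt, Real.zero_rpow (show γ - 1 ≠ 0 by linarith)] using this
  obtain ⟨δ, hδ, hδε⟩ := Metric.eventually_nhds_iff.1 (hlim.eventually (gt_mem_nhds hε))
  refine ⟨δ / 2, half_pos hδ, fun n t ξ hp => ?_⟩
  have hδε := hδε (y := δ / 2) (by rw [Real.dist_eq, sub_zero, abs_of_pos] <;> linarith)
  have e : V b - V a = ∑ i ∈ Finset.range n, (V (t (i + 1)) - V (t i)) := by
    rw [Finset.sum_range_sub (fun i => V (t i)), hp.1, hp.2.1]
  rw [stieltjesSum, e, ← Finset.sum_sub_distrib]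
  refine lt_of_le_of_lt (norm_sum_le_of_le (f := fun i => L (ξ i) (y (t (i + 1)) - y (t i)) -
      (V (t (i + 1)) - V (t i)))
    (n := fun i => |C| * (δ / 2) ^ (γ - 1) * (t (i + 1) - t i)) _ fun i hi => ?_) ?_
  · have hi := Finset.mem_range.1 hi
    obtain ⟨h1, h2, h3⟩ := hp.2.2 i hi
    have h0 : 0 ≤ t (i + 1) - t i := sub_nonneg.2 h1
    refine (h _ _ _ (hp.mem_Icc hi.le).1 h3.1 h3.2 (hp.mem_Icc (Nat.succ_le_of_lt hi)).2).trans ?_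
    have e : (t (i + 1) - t i) ^ γ = (t (i + 1) - t i) ^ (γ - 1) * (t (i + 1) - t i) := by
      conv_lhs => rw [show γ = γ - 1 + 1 by ring,
        Real.rpow_add_of_nonneg h0 (by linarith) zero_le_one, Real.rpow_one]
    rw [e, ← mul_assoc]
    gcongr
    exact le_abs_self C
  · rw [← Finset.mul_sum, Finset.sum_range_sub (fun i => t i), hp.1, hp.2.1]
    exact hδε

theorem HasYoungIntegral.congr {α : ℝ≥0} {L L' : ℝ → E →L[ℝ] F} {y y' : ℝ → E} {a b : ℝ} {v : F}
    (h : HasYoungIntegral α L y a b v) (hL : ∀ s ∈ Icc a b, L' s = L s)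
    (hy : ∀ s ∈ Icc a b, y' s = y s) : HasYoungIntegral α L' y' a b v := by
  obtain ⟨h1, ⟨β, hβ, h2⟩, h3⟩ := hasYoungIntegral_iff.1 h
  refine hasYoungIntegral_iff.2 ⟨h1.congr hy, ⟨β, hβ, h2.congr hL⟩, fun ε hε => ?_⟩
  obtain ⟨δ, hδ, h⟩ := h3 ε hε
  refine ⟨δ, hδ, fun n t ξ hp => ?_⟩
  have e : stieltjesSum L' y' n t ξ = stieltjesSum L y n t ξ := by
    refine Finset.sum_congr rfl fun i hi => ?_
    have hi := Finset.mem_range.1 hi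
    rw [hL _ (hp.tag_mem_Icc hi), hy _ (hp.mem_Icc hi.le), hy _ (hp.mem_Icc hi)]
  rw [e]
  exact h n t ξ hp

/-- A `C¹` function is locally Lipschitz, hence Lipschitz on the compact image of `Z`.
Differentiability is asked only on that image because functions read in a chart are defined only
there. -/
theorem ContDiffAt.isHolderOn_comp {Y : Type*} [NormedAddCommGroup Y] [NormedSpace ℝ Y]
    {α : ℝ≥0} (hα : 0 < α) {Z : ℝ → ℝ} {a b : ℝ} (hZ : IsHolderOn α Z (Icc a b)) {f : ℝ → Y}
    (hf : ∀ z ∈ Z '' Icc a b, ContDiffAt ℝ 1 f z) :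
    IsHolderOn α (fun s => f (Z s)) (Icc a b) := by
  obtain ⟨C, hC⟩ := hZ
  have hK : IsCompact (Z '' Icc a b) := isCompact_Icc.image_of_continuousOn (hC.continuousOn hα)
  have hloc : LocallyLipschitzOn (Z '' Icc a b) f := by
    intro z hz
    obtain ⟨K, t, ht, hKt⟩ := (hf z hz).exists_lipschitzOnWith
    exact ⟨K, t, mem_nhdsWithin_of_mem_nhds ht, hKt⟩
  obtain ⟨K, hKf⟩ := hloc.exists_lipschitzOnWith_of_compact hK
  refine ⟨K * C, ?_⟩
  have := (holderOnWith_one.2 hKf).comp hC (mapsTo_image Z (Icc a b))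
  rw [one_mul, NNReal.coe_one, NNReal.rpow_one] at this
  exact this

/-- The chain rule for Young integrals along a function of a scalar path. -/
theorem hasYoungIntegral_comp {α : ℝ≥0} (hα : 1 / 2 < α) {Z : ℝ → ℝ} {a b : ℝ} (hab : a ≤ b)
    (hZ : IsHolderOn α Z (Icc a b)) {Λ : ℝ → E →L[ℝ] F} {Y : ℝ → E} {V : ℝ → F}
    (hΛ : ∀ z ∈ Z '' Icc a b, ContDiffAt ℝ 1 Λ z) (hY : ∀ z ∈ Z '' Icc a b, ContDiffAt ℝ 1 Y z)
    (hV : ∀ z ∈ Z '' Icc a b, HasDerivAt V (Λ z (deriv Y z)) z) :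
    HasYoungIntegral α (fun s => Λ (Z s)) (fun s => Y (Z s)) a b (V (Z b) - V (Z a)) := by
  have hα0 : 0 < α := lt_trans (by positivity) hα
  have hα' : (1 : ℝ) / 2 < α := by
    have : ((1 / 2 : ℝ≥0) : ℝ) < α := by exact_mod_cast hα
    simpa using this
  have h2 : 1 < α + α := by
    rw [← NNReal.coe_lt_coe]; push_cast; linarith
  have hΛZ := ContDiffAt.isHolderOn_comp hα0 hZ hΛ
  have hYZ := ContDiffAt.isHolderOn_comp hα0 hZ hY
  have hZc : ContinuousOn Z (Icc a b) := by
    obtain ⟨C, hC⟩ := hZ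
    exact hC.continuousOn hα0
  have hKc : IsCompact (Z '' Icc a b) := isCompact_Icc.image_of_continuousOn hZc
  have hKo : OrdConnected (Z '' Icc a b) :=
    ((isPreconnected_Icc).image Z hZc).ordConnected
  obtain ⟨CZ, hCZ, hZ'⟩ := hZ.exists_dist_le
  obtain ⟨KΛ, hKΛ⟩ : ∃ K, LipschitzOnWith K Λ (Z '' Icc a b) := by
    refine LocallyLipschitzOn.exists_lipschitzOnWith_of_compact hKc fun z hz => ?_
    obtain ⟨K, t, ht, hKt⟩ := (hΛ z hz).exists_lipschitzOnWith
    exact ⟨K, t, mem_nhdsWithin_of_mem_nhds ht, hKt⟩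
  obtain ⟨M, hM⟩ := hKc.exists_bound_of_continuousOn (f := deriv Y) fun z hz =>
    ((hY z hz).derivWithin (m := 0) (by norm_num)).continuousAt.continuousWithinAt
  have hM0 : 0 ≤ M := (norm_nonneg _).trans (hM _ (mem_image_of_mem Z (left_mem_Icc.2 hab)))
  refine hasYoungIntegral_of_increments h2 hYZ hΛZ (fun s => V (Z s)) (C := KΛ * CZ * M * CZ)
    (γ := α + α) (by linarith) fun s ξ t has hsξ hξt htb => ?_
  have ms : s ∈ Icc a b := ⟨has, by linarith⟩
  have mξ : ξ ∈ Icc a b := ⟨by linarith, by linarith⟩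
  have mt : t ∈ Icc a b := ⟨by linarith, htb⟩
  have hts : 0 ≤ t - s := by linarith
  set D := CZ * (t - s) ^ (α : ℝ) with hD
  have dist_le : ∀ p ∈ Icc s t, ∀ q ∈ Icc s t, |Z p - Z q| ≤ D := by
    intro p hp q hq
    rw [← Real.dist_eq]
    refine (hZ' p ⟨has.trans hp.1, hp.2.trans htb⟩ q ⟨has.trans hq.1, hq.2.trans htb⟩).trans ?_
    rw [hD]
    gcongr
    rw [abs_le]; constructor <;> linarith [hp.1, hp.2, hq.1, hq.2]
  -- The image of an interval is connected, so the mean value inequality between `Z s` and `Z t`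
  -- uses only points of the image.
  have hseg : uIcc (Z s) (Z t) ⊆ Z '' Icc a b :=
    hKo.uIcc_subset (mem_image_of_mem Z ms) (mem_image_of_mem Z mt)
  have hconv : Convex ℝ (uIcc (Z s) (Z t)) := convex_uIcc _ _
  -- With `Λ` frozen at `Z ξ`, the derivative of the defect is `(Λ (Z ξ) - Λ r) (Y' r)`, of size
  -- `D`. The segment also has length at most `D`, so the defect is of order `D²`, that is `(t -
  -- s)^(2α)`.
  have key := hconv.norm_image_sub_le_of_norm_hasDerivWithin_le
    (f := fun r => Λ (Z ξ) (Y r) - V r) (f' := fun r => Λ (Z ξ) (deriv Y r) - Λ r (deriv Y r))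
    (C := KΛ * D * M) (fun r hr => by
      have hYd := ((hY r (hseg hr)).differentiableAt (by norm_num)).hasDerivAt
      exact (((Λ (Z ξ)).hasFDerivAt.comp_hasDerivAt r hYd).sub (hV r (hseg hr))).hasDerivWithinAt)
    (fun r hr => by
      rw [← sub_apply]
      refine (ContinuousLinearMap.le_opNorm _ _).trans ?_
      have h1 := hKΛ.norm_sub_le (mem_image_of_mem Z mξ) (hseg hr)
      have h3 : ‖Z ξ - r‖ ≤ D := by
        have e1 := dist_le ξ ⟨hsξ, hξt⟩ s ⟨le_rfl, by linarith⟩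
        have e2 := dist_le ξ ⟨hsξ, hξt⟩ t ⟨by linarith, le_rfl⟩
        rw [Real.norm_eq_abs]
        rw [abs_le] at e1 e2 ⊢
        rcases mem_uIcc.1 hr with h | h <;> constructor <;> linarith [h.1, h.2]
      have h4 : ‖Λ (Z ξ) - Λ r‖ ≤ KΛ * D := h1.trans (by gcongr)
      have h5 := hM r (hseg hr)
      gcongr)
    left_mem_uIcc right_mem_uIcc
  have e : Λ (Z ξ) (Y (Z t) - Y (Z s)) - (V (Z t) - V (Z s)) =
      Λ (Z ξ) (Y (Z t)) - V (Z t) - (Λ (Z ξ) (Y (Z s)) - V (Z s)) := by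
    rw [map_sub]; abel
  rw [e]
  refine key.trans ?_
  have h6 : ‖Z t - Z s‖ ≤ D := dist_le t ⟨by linarith, le_rfl⟩ s ⟨le_rfl, by linarith⟩
  have h7 : 0 ≤ D := by positivity
  calc KΛ * D * M * ‖Z t - Z s‖ ≤ KΛ * D * M * D := by gcongr
    _ = KΛ * CZ * M * CZ * (t - s) ^ (α + α : ℝ) := by
      rw [Real.rpow_add_of_nonneg hts α.coe_nonneg α.coe_nonneg, hD]; ring

end Young

/-! ### First-order calculus of increments on a Lie group. -/

section Jets

open Filter Topology Asymptotics

/-! ### Derivatives of maps between manifolds, as maps between the model spaces -/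

section TDeriv

variable (E E' : Type*) [NormedAddCommGroup E] [NormedSpace ℝ E]
  [NormedAddCommGroup E'] [NormedSpace ℝ E']
  {M : Type*} [TopologicalSpace M] [ChartedSpace E M]
  {N : Type*} [TopologicalSpace N] [ChartedSpace E' N]

/-- The manifold derivative seen as a continuous linear map between the model spaces. -/
noncomputable def tderiv (f : M → N) (p : M) : E →L[ℝ] E' :=
  mfderiv 𝓘(ℝ, E) 𝓘(ℝ, E') f p

variable {E E'}

theorem tderiv_comp {E'' : Type*} [NormedAddCommGroup E''] [NormedSpace ℝ E'']
    {P : Type*} [TopologicalSpace P] [ChartedSpace E'' P] {g : N → P} {f : M → N} {p : M}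
    (hg : MDifferentiableAt 𝓘(ℝ, E') 𝓘(ℝ, E'') g (f p))
    (hf : MDifferentiableAt 𝓘(ℝ, E) 𝓘(ℝ, E') f p) :
    tderiv E E'' (fun x => g (f x)) p = (tderiv E' E'' g (f p)).comp (tderiv E E' f p) :=
  mfderiv_comp p hg hf

theorem tderiv_comp_apply {E'' : Type*} [NormedAddCommGroup E''] [NormedSpace ℝ E'']
    {P : Type*} [TopologicalSpace P] [ChartedSpace E'' P] {g : N → P} {f : M → N} {p : M}
    (hg : MDifferentiableAt 𝓘(ℝ, E') 𝓘(ℝ, E'') g (f p))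
    (hf : MDifferentiableAt 𝓘(ℝ, E) 𝓘(ℝ, E') f p) (v : E) :
    tderiv E E'' (fun x => g (f x)) p v = tderiv E' E'' g (f p) (tderiv E E' f p v) := by
  rw [tderiv_comp hg hf]; rfl

theorem tderiv_eq_fderiv {f : E → E'} {p : E} : tderiv E E' f p = fderiv ℝ f p := mfderiv_eq_fderiv

theorem tderiv_id {p : M} : tderiv E E (fun x : M => x) p = ContinuousLinearMap.id ℝ E := mfderiv_id

theorem Filter.EventuallyEq.tderiv_eq {f g : M → N} {p : M} (h : f =ᶠ[𝓝 p] g) :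
    tderiv E E' f p = tderiv E E' g p := by
  have := h.mfderiv_eq (I := 𝓘(ℝ, E)) (I' := 𝓘(ℝ, E'))
  exact this

theorem tderiv_extChartAt_self [IsManifold 𝓘(ℝ, E) 1 M] {p : M} :
    tderiv E E (extChartAt 𝓘(ℝ, E) p) p = ContinuousLinearMap.id ℝ E :=
  mfderiv_extChartAt_self

theorem hasDerivAt_comp_curve {F : Type*} [NormedAddCommGroup F] [NormedSpace ℝ F]
    {f : M → F} {γ : ℝ → M} {s : ℝ}
    (hf : MDifferentiableAt 𝓘(ℝ, E) 𝓘(ℝ, F) f (γ s))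
    (hγ : MDifferentiableAt 𝓘(ℝ, ℝ) 𝓘(ℝ, E) γ s) :
    HasDerivAt (fun r => f (γ r)) (tderiv E F f (γ s) (tderiv ℝ E γ s 1)) s := by
  have h1 : MDifferentiableAt 𝓘(ℝ, ℝ) 𝓘(ℝ, F) (fun r => f (γ r)) s := hf.comp s hγ
  have h2 := h1.differentiableAt.hasFDerivAt.hasDerivAt
  rw [← tderiv_eq_fderiv, tderiv_comp_apply hf hγ] at h2
  exact h2

end TDeriv

theorem two_le_infty : (2 : WithTop ℕ∞) ≤ ∞ := by
  exact WithTop.coe_le_coe.2 (le_top : (2 : ℕ∞) ≤ ⊤)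

/-! ### Second order Taylor estimate -/

/-- The derivative is Lipschitz near `x`, so on the ball of radius `‖y - x‖` it varies by `O(‖y -
x‖)`; the mean value inequality supplies the second factor. -/
theorem ContDiffAt.isBigO_sub_fderiv {E F : Type*} [NormedAddCommGroup E] [NormedSpace ℝ E]
    [NormedAddCommGroup F] [NormedSpace ℝ F] {f : E → F} {x : E} (hf : ContDiffAt ℝ 2 f x) :
    (fun y => f y - f x - fderiv ℝ f x (y - x)) =O[𝓝 x] fun y => ‖y - x‖ ^ 2 := by
  obtain ⟨K, t, ht, hK⟩ := (hf.fderiv_right (m := 1) (by norm_num)).exists_lipschitzOnWith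
  have hd : ∀ᶠ y in 𝓝 x, DifferentiableAt ℝ f y :=
    ((hf.of_le (m := 1) (by norm_num)).eventually (by norm_num)).mono fun y hy =>
      hy.differentiableAt (by norm_num)
  obtain ⟨r, hr, hrt⟩ := Metric.nhds_basis_ball.mem_iff.1 (inter_mem ht hd)
  refine IsBigO.of_bound K ?_
  filter_upwards [Metric.ball_mem_nhds x hr] with y hy
  have hsub : Metric.closedBall x ‖y - x‖ ⊆ Metric.ball x r :=
    Metric.closedBall_subset_ball (by rwa [Metric.mem_ball, dist_eq_norm] at hy)
  have := (convex_closedBall x ‖y - x‖).norm_image_sub_le_of_norm_hasFDerivWithin_le'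
    (f := f) (f' := fderiv ℝ f) (φ := fderiv ℝ f x) (C := K * ‖y - x‖) (x := x) (y := y)
    (fun z hz => (hrt (hsub hz)).2.hasFDerivAt.hasFDerivWithinAt)
    (fun z hz => by
      refine (hK.norm_sub_le (hrt (hsub hz)).1 (mem_of_mem_nhds ht)).trans ?_
      rw [mem_closedBall_iff_norm] at hz
      gcongr)
    (by simp) (by simp [dist_eq_norm])
  rw [Real.norm_eq_abs, abs_of_nonneg (by positivity)]
  calc _ ≤ _ := this
    _ = _ := by ring

/-! ### A coordinate at the identity of a Lie group -/

variable {E : Type*} [NormedAddCommGroup E] [NormedSpace ℝ E] [FiniteDimensional ℝ E]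
  {F : Type*} [NormedAddCommGroup F] [NormedSpace ℝ F]
  {G : Type*} [Group G] [TopologicalSpace G] [ChartedSpace E G] [LieGroup 𝓘(ℝ, E) ∞ G]
  [T2Space G]

variable (E) in
/-- A smooth function on the group which is a coordinate near the identity. -/
noncomputable def groupCoord (k : G) : E :=
  (Classical.arbitrary (SmoothBumpFunction 𝓘(ℝ, E) (1 : G))) k •
    (extChartAt 𝓘(ℝ, E) (1 : G) k - extChartAt 𝓘(ℝ, E) (1 : G) 1)

variable (E G) in
/-- The local inverse of `groupCoord`. -/
noncomputable def groupChart (v : E) : G :=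
  (extChartAt 𝓘(ℝ, E) (1 : G)).symm (v + extChartAt 𝓘(ℝ, E) (1 : G) 1)

@[simp] theorem groupCoord_one : groupCoord E (1 : G) = 0 := by simp [groupCoord]

@[simp] theorem groupChart_zero : groupChart E G 0 = 1 := by simp [groupChart]

theorem contMDiff_groupCoord : ContMDiff 𝓘(ℝ, E) 𝓘(ℝ, E) ∞ (groupCoord E : G → E) := by
  refine SmoothBumpFunction.contMDiff_smul _ ?_
  exact (contMDiffOn_extChartAt (x := (1 : G))).sub contMDiffOn_const

theorem groupCoord_eventuallyEq :
    (groupCoord E : G → E) =ᶠ[𝓝 1]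
      fun k => extChartAt 𝓘(ℝ, E) (1 : G) k - extChartAt 𝓘(ℝ, E) (1 : G) 1 := by
  filter_upwards [(Classical.arbitrary (SmoothBumpFunction 𝓘(ℝ, E) (1 : G))).eventuallyEq_one] with k hk
  simp [groupCoord, hk]

theorem groupChart_groupCoord : ∀ᶠ k : G in 𝓝 1, groupChart E G (groupCoord E k) = k := by
  filter_upwards [groupCoord_eventuallyEq (E := E) (G := G),
    extChartAt_source_mem_nhds (I := 𝓘(ℝ, E)) (1 : G)] with k hk hs
  rw [groupChart, hk, sub_add_cancel, (extChartAt 𝓘(ℝ, E) (1 : G)).left_inv hs]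

theorem contMDiffAt_groupChart : ContMDiffAt 𝓘(ℝ, E) 𝓘(ℝ, E) ∞ (groupChart E G) 0 := by
  have h1 : ContMDiffAt 𝓘(ℝ, E) 𝓘(ℝ, E) ∞ (extChartAt 𝓘(ℝ, E) (1 : G)).symm
      (0 + extChartAt 𝓘(ℝ, E) (1 : G) 1) := by
    rw [zero_add]
    exact (contMDiffOn_extChartAt_symm (1 : G)).contMDiffAt (extChartAt_target_mem_nhds _)
  have h2 : ContMDiffAt 𝓘(ℝ, E) 𝓘(ℝ, E) ∞
      (fun v : E => v + extChartAt 𝓘(ℝ, E) (1 : G) 1) 0 :=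
    (contDiff_id.add contDiff_const).contMDiff.contMDiffAt
  exact h1.comp (0 : E) h2

theorem groupCoord_groupChart : ∀ᶠ v : E in 𝓝 0, groupCoord E (groupChart E G v) = v := by
  have h1 : Tendsto (groupChart E G) (𝓝 0) (𝓝 1) := by
    simpa using! (contMDiffAt_groupChart (E := E) (G := G)).continuousAt.tendsto
  have h2 : Tendsto (fun v : E => v + extChartAt 𝓘(ℝ, E) (1 : G) 1) (𝓝 0)
      (𝓝 (extChartAt 𝓘(ℝ, E) (1 : G) 1)) := by
    have : Continuous fun v : E => v + extChartAt 𝓘(ℝ, E) (1 : G) 1 := by fun_prop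
    simpa using this.tendsto 0
  filter_upwards [h1.eventually (groupCoord_eventuallyEq (E := E) (G := G)),
    h2.eventually (extChartAt_target_mem_nhds (I := 𝓘(ℝ, E)) (1 : G))] with v hv hv2
  rw [hv, groupChart, (extChartAt 𝓘(ℝ, E) (1 : G)).right_inv hv2, add_sub_cancel_right]

theorem tendsto_groupCoord : Tendsto (groupCoord E : G → E) (𝓝 1) (𝓝 0) := by
  simpa using (contMDiff_groupCoord (E := E) (G := G)).continuous.tendsto 1

theorem tderiv_groupCoord_one :
    tderiv E E (groupCoord E : G → E) 1 = ContinuousLinearMap.id ℝ E := by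
  have : IsManifold 𝓘(ℝ, E) 1 G := IsManifold.of_le (n := ∞) (by simp)
  rw [groupCoord_eventuallyEq.tderiv_eq]
  have h : tderiv E E (fun k : G => extChartAt 𝓘(ℝ, E) (1 : G) k - extChartAt 𝓘(ℝ, E) (1 : G) 1)
      1 = (tderiv E E (fun y : E => y - extChartAt 𝓘(ℝ, E) (1 : G) 1)
          (extChartAt 𝓘(ℝ, E) (1 : G) 1)).comp
        (tderiv E E (extChartAt 𝓘(ℝ, E) (1 : G)) 1) := by
    refine tderiv_comp (g := fun y : E => y - extChartAt 𝓘(ℝ, E) (1 : G) 1) ?_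
      (mdifferentiableAt_extChartAt (by simp))
    exact ((differentiable_id (𝕜 := ℝ) (E := E)).sub_const _).differentiableAt.mdifferentiableAt
  rw [h, tderiv_extChartAt_self, tderiv_eq_fderiv, fderiv_sub_const]
  simp

theorem tderiv_groupChart_zero :
    tderiv E E (groupChart E G) 0 = ContinuousLinearMap.id ℝ E := by
  have h1 : (fun v : E => groupCoord E (groupChart E G v)) =ᶠ[𝓝 0] fun v => v :=
    groupCoord_groupChart
  have h2 := h1.tderiv_eq (E := E) (E' := E)
  rw [tderiv_comp (contMDiff_groupCoord.mdifferentiable (by simp) _)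
    (contMDiffAt_groupChart.mdifferentiableAt (by simp)), tderiv_id, groupChart_zero,
    tderiv_groupCoord_one] at h2
  simpa using h2

/-- Quadratic Taylor estimate at the identity of a Lie group. -/
theorem isBigO_sub_tderiv {f : G → F} (hf : ContMDiffAt 𝓘(ℝ, E) 𝓘(ℝ, F) ∞ f 1) :
    (fun k => f k - f 1 - tderiv E F f 1 (groupCoord E k)) =O[𝓝 1]
      fun k => ‖groupCoord E k‖ ^ 2 := by
  have h1 : ContMDiffAt 𝓘(ℝ, E) 𝓘(ℝ, F) ∞ (fun v => f (groupChart E G v)) 0 := by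
    refine ContMDiffAt.comp (0 : E) ?_ contMDiffAt_groupChart
    rwa [groupChart_zero]
  have h2 := (h1.contDiffAt.of_le (m := 2) two_le_infty).isBigO_sub_fderiv
  have h3 : fderiv ℝ (fun v => f (groupChart E G v)) 0 = tderiv E F f 1 := by
    rw [← tderiv_eq_fderiv, tderiv_comp _ (contMDiffAt_groupChart.mdifferentiableAt (by simp)),
      tderiv_groupChart_zero, groupChart_zero, ContinuousLinearMap.comp_id]
    rw [groupChart_zero]
    exact hf.mdifferentiableAt (by simp)
  rw [h3] at h2
  have h4 := h2.comp_tendsto (tendsto_groupCoord (E := E) (G := G))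
  refine h4.congr' ?_ ?_
  · filter_upwards [groupChart_groupCoord (E := E) (G := G)] with k hk
    simp [hk]
  · filter_upwards with k
    simp

/-- Multiplication read in coordinates restricts to the identity on each of the two axes, so its
differential at the origin is addition. The rest is the quadratic Taylor remainder. -/
theorem isBigO_groupCoord_mul :
    (fun k : G × G => groupCoord E (k.1 * k.2) - (groupCoord E k.1 + groupCoord E k.2))
      =O[𝓝 1] fun k => ‖groupCoord E k.1‖ ^ 2 + ‖groupCoord E k.2‖ ^ 2 := by
  set m : E × E → E := fun v => groupCoord E (groupChart E G v.1 * groupChart E G v.2) with hm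
  have hm1 : ContMDiffAt 𝓘(ℝ, E × E) 𝓘(ℝ, E) ∞ m 0 := by
    have a1 : ContMDiffAt 𝓘(ℝ, E × E) 𝓘(ℝ, E) ∞ (fun v : E × E => groupChart E G v.1) 0 :=
      ContMDiffAt.comp (0 : E × E) (g := groupChart E G) contMDiffAt_groupChart
        contDiff_fst.contMDiff.contMDiffAt
    have a2 : ContMDiffAt 𝓘(ℝ, E × E) 𝓘(ℝ, E) ∞ (fun v : E × E => groupChart E G v.2) 0 :=
      ContMDiffAt.comp (0 : E × E) (g := groupChart E G) contMDiffAt_groupChart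
        contDiff_snd.contMDiff.contMDiffAt
    exact contMDiff_groupCoord.contMDiffAt.comp (0 : E × E) (a1.mul a2)
  have h2 := (hm1.contDiffAt.of_le (m := 2) two_le_infty).isBigO_sub_fderiv
  have hmd := (hm1.contDiffAt.differentiableAt (by simp)).hasFDerivAt
  have p1 : ∀ u, fderiv ℝ m 0 (u, 0) = u := by
    intro u
    have c : HasFDerivAt (fun u : E => m (u, 0)) ((fderiv ℝ m 0).comp
        (ContinuousLinearMap.inl ℝ E E)) 0 :=
      HasFDerivAt.comp (0 : E) (g := m) (by simpa using! hmd)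
        (ContinuousLinearMap.inl ℝ E E).hasFDerivAt
    have c2 : (fun u : E => m (u, 0)) =ᶠ[𝓝 0] id := by
      filter_upwards [groupCoord_groupChart (E := E) (G := G)] with v hv
      simp [hm, hv]
    have := (c.congr_of_eventuallyEq c2.symm).unique (hasFDerivAt_id (0 : E))
    exact DFunLike.congr_fun this u
  have p2 : ∀ u, fderiv ℝ m 0 (0, u) = u := by
    intro u
    have c : HasFDerivAt (fun u : E => m (0, u)) ((fderiv ℝ m 0).comp
        (ContinuousLinearMap.inr ℝ E E)) 0 :=
      HasFDerivAt.comp (0 : E) (g := m) (by simpa using! hmd)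
        (ContinuousLinearMap.inr ℝ E E).hasFDerivAt
    have c2 : (fun u : E => m (0, u)) =ᶠ[𝓝 0] id := by
      filter_upwards [groupCoord_groupChart (E := E) (G := G)] with v hv
      simp [hm, hv]
    have := (c.congr_of_eventuallyEq c2.symm).unique (hasFDerivAt_id (0 : E))
    exact DFunLike.congr_fun this u
  have p : ∀ u : E × E, fderiv ℝ m 0 u = u.1 + u.2 := by
    intro u
    conv_lhs => rw [show u = (u.1, 0) + (0, u.2) by simp, map_add, p1, p2]
  have ht : Tendsto (fun k : G × G => (groupCoord E k.1, groupCoord E k.2)) (𝓝 1) (𝓝 0) := by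
    rw [Prod.one_eq_mk, nhds_prod_eq, show (0 : E × E) = (0, 0) from rfl, nhds_prod_eq]
    exact tendsto_groupCoord.prodMap tendsto_groupCoord
  have h4 := h2.comp_tendsto ht
  have e1 : ∀ᶠ k : G × G in 𝓝 1, groupChart E G (groupCoord E k.1) = k.1 :=
    continuous_fst.tendsto (1 : G × G) |>.eventually groupChart_groupCoord
  have e2 : ∀ᶠ k : G × G in 𝓝 1, groupChart E G (groupCoord E k.2) = k.2 :=
    continuous_snd.tendsto (1 : G × G) |>.eventually groupChart_groupCoord
  refine (h4.congr' ?_ EventuallyEq.rfl).trans ?_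
  · filter_upwards [e1, e2] with k hk1 hk2
    simp only [Function.comp_apply, sub_zero, p]
    simp [hm, hk1, hk2]
  · refine IsBigO.of_bound 1 (Eventually.of_forall fun k => ?_)
    simp only [Function.comp_apply, sub_zero, Prod.norm_def, norm_pow, Real.norm_eq_abs,
      one_mul]
    rw [abs_of_nonneg (le_max_of_le_left (norm_nonneg _)), abs_of_nonneg (by positivity)]
    rcases max_cases ‖groupCoord E k.1‖ ‖groupCoord E k.2‖ with h | h <;> rw [h.1] <;>
      nlinarith [sq_nonneg ‖groupCoord E k.1‖, sq_nonneg ‖groupCoord E k.2‖]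

/-! ### Jets of paths through the identity -/

variable {ι : Type*} {l : Filter ι} {ρ r : ι → ℝ} {k k' : ι → G} {v v' : ι → E}

/-- Along the filter `l`, the path `k` tends to the identity, is of order `ρ`, and is described
up to `o(r)` by the path `v` in the Lie algebra. -/
structure HasJet (l : Filter ι) (ρ r : ι → ℝ) (k : ι → G) (v : ι → E) : Prop where
  tendsto : Tendsto k l (𝓝 1)
  isBigO : (fun t => groupCoord E (k t)) =O[l] ρ
  isLittleO : (fun t => groupCoord E (k t) - v t) =o[l] r

/-- There are two errors: the Taylor remainder, which is `O(ρ²)` and hence `o(r)`, and the image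
under the differential of the `o(r)` error in `v`. -/
theorem HasJet.comp_isLittleO (h : HasJet l ρ r k v) (hρ : (fun t => ρ t ^ 2) =o[l] r) {f : G → F}
    (hf : ContMDiffAt 𝓘(ℝ, E) 𝓘(ℝ, F) ∞ f 1) :
    (fun t => f (k t) - f 1 - tderiv E F f 1 (v t)) =o[l] r := by
  have h1 := (isBigO_sub_tderiv hf).comp_tendsto h.tendsto
  have h2 : (fun t => f (k t) - f 1 - tderiv E F f 1 (groupCoord E (k t))) =o[l] r :=
    (h1.trans (h.isBigO.norm_left.pow 2)).trans_isLittleO hρ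
  have h3 : (fun t => tderiv E F f 1 (groupCoord E (k t) - v t)) =o[l] r :=
    ((tderiv E F f 1).isBigO_comp _ _).trans_isLittleO h.isLittleO
  refine (h2.add h3).congr_left fun t => ?_
  rw [map_sub]; abel

theorem HasJet.comp_isBigO (h : HasJet l ρ r k v) {f : G → F}
    (hf : ContMDiffAt 𝓘(ℝ, E) 𝓘(ℝ, F) ∞ f 1) :
    (fun t => f (k t) - f 1) =O[l] ρ := by
  have h1 := (isBigO_sub_tderiv hf).comp_tendsto h.tendsto
  have h0 : Tendsto (fun t => groupCoord E (k t)) l (𝓝 0) := tendsto_groupCoord.comp h.tendsto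
  have h2 : (fun t => ‖groupCoord E (k t)‖ ^ 2) =O[l] fun t => groupCoord E (k t) := by
    have := (h0.norm.isBigO_one ℝ).mul (isBigO_refl (fun t => ‖groupCoord E (k t)‖) l)
    exact (this.congr (fun t => by ring) (fun t => by rw [one_mul])).of_norm_right
  have h3 : (fun t => tderiv E F f 1 (groupCoord E (k t))) =O[l] fun t => groupCoord E (k t) :=
    (tderiv E F f 1).isBigO_comp _ _
  refine (((h1.trans h2).add h3).trans h.isBigO).congr_left fun t => ?_
  simp

theorem HasJet.congr_jet (h : HasJet l ρ r k v) (hv : (fun t => v t - v' t) =o[l] r) :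
    HasJet l ρ r k v' :=
  ⟨h.tendsto, h.isBigO, (h.isLittleO.add hv).congr_left fun t => by abel⟩

theorem HasJet.congr (h : HasJet l ρ r k v) (hk : k' =ᶠ[l] k) : HasJet l ρ r k' v :=
  ⟨h.tendsto.congr' hk.symm,
    h.isBigO.congr' (hk.symm.fun_comp (groupCoord E)) EventuallyEq.rfl,
    h.isLittleO.congr' ((hk.symm.fun_comp (groupCoord E)).sub EventuallyEq.rfl) EventuallyEq.rfl⟩

theorem HasJet.map (h : HasJet l ρ r k v) (hρ : (fun t => ρ t ^ 2) =o[l] r) {Q : G → G}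
    (hQ : ContMDiffAt 𝓘(ℝ, E) 𝓘(ℝ, E) ∞ Q 1) (hQ1 : Q 1 = 1) :
    HasJet l ρ r (fun t => Q (k t)) (fun t => tderiv E E Q 1 (v t)) := by
  have hf : ContMDiffAt 𝓘(ℝ, E) 𝓘(ℝ, E) ∞ (fun k => groupCoord E (Q k)) 1 :=
    contMDiff_groupCoord.contMDiffAt.comp (1 : G) hQ
  have hd : tderiv E E (fun k => groupCoord E (Q k)) 1 = tderiv E E Q 1 := by
    rw [tderiv_comp (contMDiff_groupCoord.mdifferentiable (by simp) _)
      (hQ.mdifferentiableAt (by simp)), hQ1, tderiv_groupCoord_one, ContinuousLinearMap.id_comp]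
  refine ⟨?_, ?_, ?_⟩
  · have := hQ.continuousAt.tendsto
    rw [hQ1] at this
    exact this.comp h.tendsto
  · simpa [hQ1] using h.comp_isBigO hf
  · simpa [hQ1, hd] using h.comp_isLittleO hρ hf

theorem HasJet.mul (h : HasJet l ρ r k v) (h' : HasJet l ρ r k' v')
    (hρ : (fun t => ρ t ^ 2) =o[l] r) :
    HasJet l ρ r (fun t => k t * k' t) (fun t => v t + v' t) := by
  have : IsTopologicalGroup G := topologicalGroup_of_lieGroup 𝓘(ℝ, E) ∞
  have ht : Tendsto (fun t => (k t, k' t)) l (𝓝 1) := by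
    rw [Prod.one_eq_mk, nhds_prod_eq]
    exact h.tendsto.prodMk h'.tendsto
  have h1 := (isBigO_groupCoord_mul (E := E) (G := G)).comp_tendsto ht
  have h2 : (fun t => groupCoord E (k t * k' t) - (groupCoord E (k t) + groupCoord E (k' t)))
      =O[l] fun t => ρ t ^ 2 :=
    h1.trans ((h.isBigO.norm_left.pow 2).add (h'.isBigO.norm_left.pow 2))
  have h0 : Tendsto (fun t => groupCoord E (k t)) l (𝓝 0) := tendsto_groupCoord.comp h.tendsto
  have h0' : Tendsto (fun t => groupCoord E (k' t)) l (𝓝 0) := tendsto_groupCoord.comp h'.tendsto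
  have hsq : ∀ {u : ι → E}, Tendsto u l (𝓝 0) → u =O[l] ρ → (fun t => ‖u t‖ ^ 2) =O[l] ρ := by
    intro u hu huρ
    have := (hu.norm.isBigO_one ℝ).mul huρ.norm_left
    exact this.congr (fun t => by ring) (fun t => by rw [one_mul])
  refine ⟨?_, ?_, ?_⟩
  · simpa using h.tendsto.mul h'.tendsto
  · have h3 := (h1.trans ((hsq h0 h.isBigO).add (hsq h0' h'.isBigO))).add
      (h.isBigO.add h'.isBigO)
    exact h3.congr_left fun t => by simp
  · refine ((h2.trans_isLittleO hρ).add (h.isLittleO.add h'.isLittleO)).congr_left fun t => ?_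
    abel

theorem contMDiff_conj (a b : G) : ContMDiff 𝓘(ℝ, E) 𝓘(ℝ, E) ∞ (fun y : G => a * y * b) :=
  (contMDiff_mul_right (I := 𝓘(ℝ, E)) (n := ∞) (a := b)).comp
    (contMDiff_mul_left (I := 𝓘(ℝ, E)) (n := ∞) (a := a))

/-- The differential of inversion need not be computed: the jets of `k` and `k⁻¹` add up to the jet
of the constant path `1`, so they are opposite up to `o(r)`. -/
theorem HasJet.inv (h : HasJet l ρ r k v) (hρ : (fun t => ρ t ^ 2) =o[l] r) :
    HasJet l ρ r (fun t => (k t)⁻¹) (fun t => -v t) := by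
  have h1 := h.map hρ (Q := fun y => y⁻¹) (contMDiff_inv 𝓘(ℝ, E) ∞).contMDiffAt inv_one
  refine h1.congr_jet ?_
  have h2 := (h.mul h1 hρ).isLittleO
  simp only [mul_inv_cancel, groupCoord_one, zero_sub] at h2
  refine h2.neg_left.congr_left fun t => ?_
  abel

variable (E) in
/-- The adjoint action in the model space. -/
noncomputable def modelAd (a : G) : E →L[ℝ] E := tderiv E E (fun y : G => a * y * a⁻¹) 1

theorem modelAd_mul (a b : G) : modelAd E (a * b) = (modelAd E a).comp (modelAd E b) := by
  have := tderiv_comp (E := E) (E' := E) (g := fun y : G => a * y * a⁻¹)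
    (f := fun y : G => b * y * b⁻¹) (p := 1)
    ((contMDiff_conj _ _).mdifferentiable (by simp) _)
    ((contMDiff_conj _ _).mdifferentiable (by simp) _)
  simp only [mul_one, mul_inv_cancel] at this
  rw [modelAd, modelAd, modelAd, ← this]
  congr 1
  ext y
  group

theorem HasJet.conj (h : HasJet l ρ r k v) (hρ : (fun t => ρ t ^ 2) =o[l] r) (a : G) :
    HasJet l ρ r (fun t => a * k t * a⁻¹) (fun t => modelAd E a (v t)) :=
  h.map hρ (contMDiff_conj a a⁻¹).contMDiffAt (by simp)

/-! ### Constancy criteria -/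

/-- Smooth functions separate points. -/
theorem exists_contMDiff_separating {M : Type*} [TopologicalSpace M] [ChartedSpace E M]
    [IsManifold 𝓘(ℝ, E) ∞ M] [T2Space M] {p : M} {U : Set M} (hU : U ∈ 𝓝 p) :
    ∃ f : M → ℝ, ContMDiff 𝓘(ℝ, E) 𝓘(ℝ, ℝ) ∞ f ∧ HasCompactSupport f ∧ f p = 1 ∧
      (∀ x, 0 ≤ f x) ∧ ∀ x ∉ U, f x = 0 := by
  obtain ⟨f, -, hf⟩ := (SmoothBumpFunction.nhds_basis_support (I := 𝓘(ℝ, E)) hU).mem_iff.1 hU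
  exact ⟨f, f.contMDiff, f.hasCompactSupport, f.eq_one, fun x => f.nonneg,
    fun x hx => Function.notMem_support.1 fun h => hx (hf h)⟩

theorem hasDerivWithinAt_zero_of_isLittleO {f : ℝ → F} {s : ℝ}
    (h : (fun t => f t - f s) =o[𝓝[>] s] fun t => t - s) : HasDerivWithinAt f 0 (Ici s) s := by
  rw [hasDerivWithinAt_iff_isLittleO, ← Ioi_insert, nhdsWithin_insert,
    isLittleO_sup]
  simpa using! h

/-- A path whose increments vanish to first order is constant. -/
theorem eq_of_hasJet_zero {p : ℝ → G} {a b : ℝ} (hp : ContinuousOn p (Icc a b))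
    (h : ∀ s ∈ Ico a b, ∃ ρ : ℝ → ℝ, (fun t => ρ t ^ 2) =o[𝓝[>] s] (fun t => t - s) ∧
      HasJet (𝓝[>] s) ρ (fun t => t - s) (fun t => (p s)⁻¹ * p t) (fun _ => (0 : E))) :
    ∀ t ∈ Icc a b, p t = p a := by
  -- Along each smooth function the path has right derivative zero, hence is constant. Smooth
  -- functions separate points, so the path itself is constant.
  have key : ∀ f : G → ℝ, ContMDiff 𝓘(ℝ, E) 𝓘(ℝ, ℝ) ∞ f → ∀ t ∈ Icc a b, f (p t) = f (p a) := by
    intro f hf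
    refine constant_of_has_deriv_right_zero (f := fun t => f (p t))
      (hf.continuous.comp_continuousOn hp) fun s hs => ?_
    refine hasDerivWithinAt_zero_of_isLittleO ?_
    obtain ⟨ρ, hρ, hj⟩ := h s hs
    have hc : ContMDiffAt 𝓘(ℝ, E) 𝓘(ℝ, ℝ) ∞ (fun y => f (p s * y)) 1 :=
      (hf.comp (contMDiff_mul_left (I := 𝓘(ℝ, E)) (n := ∞) (a := p s))).contMDiffAt
    simpa using hj.comp_isLittleO hρ hc
  intro t ht
  by_contra hne
  obtain ⟨f, hf, -, h1, -, h0⟩ := exists_contMDiff_separating (E := E) (p := p a) (U := {p t}ᶜ)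
    (isOpen_compl_singleton.mem_nhds (Ne.symm hne))
  have := key f hf t ht
  rw [h1, h0 _ (by simp)] at this
  exact zero_ne_one this

end Jets

/-! ### Closed subgroups: paths tangent to cosets and a weak Cartan theorem. -/

section Cosets

open Filter Topology Asymptotics

variable {E : Type*} [NormedAddCommGroup E] [NormedSpace ℝ E] [FiniteDimensional ℝ E]
  {F : Type*} [NormedAddCommGroup F] [NormedSpace ℝ F]
  {G : Type*} [Group G] [TopologicalSpace G] [ChartedSpace E G] [LieGroup 𝓘(ℝ, E) ∞ G]
  [T2Space G]

/-! ### Uniform estimates for translations of test functions -/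

/-- In coordinates, `f (y q⁻¹ m q)` is a smooth, so locally Lipschitz, function of `(m, q, y)`.
Comparing `m` with the identity while `q`, `y` stay fixed leaves only the coordinate of `m` on the
right. -/
theorem exists_eventually_conj_le {f : G → ℝ} (hf : ContMDiff 𝓘(ℝ, E) 𝓘(ℝ, ℝ) ∞ f) (q₀ y₀ : G) :
    ∃ K : ℝ, ∀ᶠ x : G × (G × G) in 𝓝 1 ×ˢ 𝓝 (q₀, y₀),
      |f (x.2.2 * (x.2.1⁻¹ * x.1 * x.2.1)) - f x.2.2| ≤ K * ‖groupCoord E x.1‖ := by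
  have : IsTopologicalGroup G := topologicalGroup_of_lieGroup 𝓘(ℝ, E) ∞
  set Ψ : E × E × E → ℝ := fun v => f (y₀ * groupChart E G v.2.2 *
    ((q₀ * groupChart E G v.2.1)⁻¹ * groupChart E G v.1 * (q₀ * groupChart E G v.2.1))) with hΨ
  have a1 : ContMDiffAt 𝓘(ℝ, E × E × E) 𝓘(ℝ, E) ∞ (fun v : E × E × E => groupChart E G v.1) 0 :=
    ContMDiffAt.comp (0 : E × E × E) (g := groupChart E G) contMDiffAt_groupChart
      contDiff_fst.contMDiff.contMDiffAt
  have a2 : ContMDiffAt 𝓘(ℝ, E × E × E) 𝓘(ℝ, E) ∞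
      (fun v : E × E × E => q₀ * groupChart E G v.2.1) 0 := by
    refine contMDiffAt_const.mul ?_
    exact ContMDiffAt.comp (0 : E × E × E) (g := groupChart E G) contMDiffAt_groupChart
      (contDiff_fst.comp contDiff_snd).contMDiff.contMDiffAt
  have a3 : ContMDiffAt 𝓘(ℝ, E × E × E) 𝓘(ℝ, E) ∞
      (fun v : E × E × E => y₀ * groupChart E G v.2.2) 0 := by
    refine contMDiffAt_const.mul ?_
    exact ContMDiffAt.comp (0 : E × E × E) (g := groupChart E G) contMDiffAt_groupChart
      (contDiff_snd.comp contDiff_snd).contMDiff.contMDiffAt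
  have hΨs : ContMDiffAt 𝓘(ℝ, E × E × E) 𝓘(ℝ, ℝ) ∞ Ψ 0 :=
    hf.contMDiffAt.comp (0 : E × E × E) (a3.mul ((a2.inv.mul a1).mul a2))
  obtain ⟨K, t, ht, hK⟩ := (hΨs.contDiffAt.of_le (m := 1) (by simp)).exists_lipschitzOnWith
  refine ⟨K, ?_⟩
  have c1 : Tendsto (fun x : G × (G × G) => x.1) (𝓝 1 ×ˢ 𝓝 (q₀, y₀)) (𝓝 1) := tendsto_fst
  have c2 : Tendsto (fun x : G × (G × G) => q₀⁻¹ * x.2.1) (𝓝 1 ×ˢ 𝓝 (q₀, y₀)) (𝓝 1) := by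
    have : Tendsto (fun x : G × G => q₀⁻¹ * x.1) (𝓝 (q₀, y₀)) (𝓝 (q₀⁻¹ * q₀)) :=
      (by fun_prop : Continuous fun x : G × G => q₀⁻¹ * x.1).tendsto _
    rw [inv_mul_cancel] at this
    exact this.comp tendsto_snd
  have c3 : Tendsto (fun x : G × (G × G) => y₀⁻¹ * x.2.2) (𝓝 1 ×ˢ 𝓝 (q₀, y₀)) (𝓝 1) := by
    have : Tendsto (fun x : G × G => y₀⁻¹ * x.2) (𝓝 (q₀, y₀)) (𝓝 (y₀⁻¹ * y₀)) :=
      (by fun_prop : Continuous fun x : G × G => y₀⁻¹ * x.2).tendsto _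
    rw [inv_mul_cancel] at this
    exact this.comp tendsto_snd
  have d1 := (tendsto_groupCoord (E := E) (G := G)).comp c1
  have d2 := (tendsto_groupCoord (E := E) (G := G)).comp c2
  have d3 := (tendsto_groupCoord (E := E) (G := G)).comp c3
  have d : Tendsto (fun x : G × (G × G) => (groupCoord E x.1, groupCoord E (q₀⁻¹ * x.2.1),
      groupCoord E (y₀⁻¹ * x.2.2))) (𝓝 1 ×ˢ 𝓝 (q₀, y₀)) (𝓝 (0 : E × E × E)) := by
    have := d1.prodMk_nhds (d2.prodMk_nhds d3)
    exact this
  have d' : Tendsto (fun x : G × (G × G) => ((0 : E), groupCoord E (q₀⁻¹ * x.2.1),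
      groupCoord E (y₀⁻¹ * x.2.2))) (𝓝 1 ×ˢ 𝓝 (q₀, y₀)) (𝓝 (0 : E × E × E)) := by
    have := (tendsto_const_nhds (x := (0 : E))).prodMk_nhds (d2.prodMk_nhds d3)
    exact this
  filter_upwards [d.eventually ht, d'.eventually ht,
    c1.eventually (groupChart_groupCoord (E := E) (G := G)),
    c2.eventually (groupChart_groupCoord (E := E) (G := G)),
    c3.eventually (groupChart_groupCoord (E := E) (G := G))] with x h1 h2 h3 h4 h5
  have := hK.norm_sub_le h1 h2
  simp only [hΨ, h3, h4, h5, mul_inv_cancel_left, groupChart_zero, mul_one, inv_mul_cancel] at this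
  refine this.trans (le_of_eq ?_)
  congr 1
  simp [Prod.norm_def]

theorem exists_eventually_forall_conj_le {f : G → ℝ} (hf : ContMDiff 𝓘(ℝ, E) 𝓘(ℝ, ℝ) ∞ f)
    {C : Set (G × G)} (hC : IsCompact C) :
    ∃ K : ℝ, ∀ᶠ m : G in 𝓝 1, ∀ x ∈ C,
      |f (x.2 * (x.1⁻¹ * m * x.1)) - f x.2| ≤ K * ‖groupCoord E m‖ := by
  refine hC.induction_on (p := fun C => ∃ K : ℝ, ∀ᶠ m : G in 𝓝 1, ∀ x ∈ C,
      |f (x.2 * (x.1⁻¹ * m * x.1)) - f x.2| ≤ K * ‖groupCoord E m‖) ⟨0, by simp⟩ ?_ ?_ ?_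
  · rintro s t hst ⟨K, hK⟩
    exact ⟨K, hK.mono fun m hm x hx => hm x (hst hx)⟩
  · rintro s t ⟨K, hK⟩ ⟨K', hK'⟩
    refine ⟨max K K', ?_⟩
    filter_upwards [hK, hK'] with m h1 h2 x hx
    rcases hx with hx | hx
    · exact (h1 x hx).trans (by gcongr; exact le_max_left _ _)
    · exact (h2 x hx).trans (by gcongr; exact le_max_right _ _)
  · rintro ⟨q₀, y₀⟩ -
    obtain ⟨K, hK⟩ := exists_eventually_conj_le hf q₀ y₀
    obtain ⟨p, hp, q, hq, h⟩ := eventually_prod_iff.1 hK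
    refine ⟨{x | q x}, mem_nhdsWithin_of_mem_nhds hq, K, ?_⟩
    filter_upwards [hp] with m hm x hx
    exact h hm hx

/-- For a test function `f`, the difference `f (y m q) - f (y q)` is of the order of the distance
of `m` to the identity, uniformly in `y` and in `q` in a compact set. -/
theorem exists_eventually_mul_le {f : G → ℝ} (hf : ContMDiff 𝓘(ℝ, E) 𝓘(ℝ, ℝ) ∞ f)
    (hc : HasCompactSupport f) {Q : Set G} (hQ : IsCompact Q) :
    ∃ K : ℝ, ∀ᶠ m : G in 𝓝 1, ∀ q ∈ Q, ∀ y : G,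
      |f (y * m * q) - f (y * q)| ≤ K * ‖groupCoord E m‖ := by
  have : IsTopologicalGroup G := topologicalGroup_of_lieGroup 𝓘(ℝ, E) ∞
  have : LocallyCompactSpace G := Manifold.locallyCompact_of_finiteDimensional 𝓘(ℝ, E)
  obtain ⟨V, hVc, hV⟩ := exists_compact_mem_nhds (1 : G)
  -- The compact set `K'` contains every `y q` with `q ∈ Q` for which some `y m q`, `m ∈ V`, meets
  -- the support of `f`. Outside `K'` and the support both values vanish, so the bound on a compact
  -- set becomes uniform in `y`.
  set K' : Set G := (fun x : G × G × G => x.2.1 * (x.1⁻¹ * x.2.2 * x.1)⁻¹) ''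
    (Q ×ˢ (tsupport f ×ˢ V)) with hK'
  have hK'c : IsCompact K' := (hQ.prod (hc.isCompact.prod hVc)).image (by fun_prop)
  obtain ⟨K, hK⟩ := exists_eventually_forall_conj_le hf (hQ.prod (hK'c.union hc.isCompact))
  refine ⟨max K 0, ?_⟩
  filter_upwards [hK, hV] with m hm hmV q hq y
  have e : y * m * q = y * q * (q⁻¹ * m * q) := by group
  by_cases hy : y * q ∈ K' ∪ tsupport f
  · have := hm (q, y * q) ⟨hq, hy⟩
    simp only at this
    rw [e]
    exact this.trans (by gcongr; exact le_max_left _ _)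
  · have h1 : f (y * q) = 0 := image_eq_zero_of_notMem_tsupport fun h => hy (Or.inr h)
    have h2 : f (y * m * q) = 0 := by
      refine image_eq_zero_of_notMem_tsupport fun h => hy (Or.inl ⟨(q, y * m * q, m),
        ⟨hq, h, hmV⟩, ?_⟩)
      simp only
      group
    rw [h1, h2]
    simp only [sub_self, abs_zero]
    positivity

/-! ### Paths tangent to the cosets of a closed subgroup -/

/-- The Taylor remainder is `O(z²)`, and `z` may be as rough as the increments of a Hölder function,
provided `ρ²` is negligible. -/
theorem HasJet.of_curve {ι : Type*} {l : Filter ι} {ρ r z : ι → ℝ} {c : ℝ → G}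
    (hc : ContMDiffAt 𝓘(ℝ, ℝ) 𝓘(ℝ, E) ∞ c 0) (hc0 : c 0 = 1) (hρ : (fun t => ρ t ^ 2) =o[l] r)
    (hz : z =O[l] ρ) (hz0 : Tendsto z l (𝓝 0)) :
    HasJet l ρ r (fun t => c (z t)) (fun t => z t • tderiv ℝ E c 0 1) := by
  have h1 : ContMDiffAt 𝓘(ℝ, ℝ) 𝓘(ℝ, E) ∞ (fun s => groupCoord E (c s)) 0 :=
    contMDiff_groupCoord.contMDiffAt.comp (0 : ℝ) hc
  have h2 := (h1.contDiffAt.of_le (m := 2) two_le_infty).isBigO_sub_fderiv.comp_tendsto hz0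
  have h3 : fderiv ℝ (fun s => groupCoord E (c s)) 0 = tderiv ℝ E c 0 := by
    rw [← tderiv_eq_fderiv, tderiv_comp (contMDiff_groupCoord.mdifferentiable (by simp) _)
      (hc.mdifferentiableAt (by simp)), hc0, tderiv_groupCoord_one, ContinuousLinearMap.id_comp]
  have h4 : (fun t => groupCoord E (c (z t)) - z t • tderiv ℝ E c 0 1) =O[l] fun t => z t ^ 2 := by
    refine h2.congr (fun t => ?_) (fun t => by simp)
    simp only [Function.comp_apply, h3, sub_zero, hc0, groupCoord_one]
    rw [← map_smul, smul_eq_mul, mul_one]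
  refine ⟨?_, ?_, h4.trans_isLittleO ((hz.pow 2).trans_isLittleO hρ)⟩
  · have := hc.continuousAt.tendsto.comp hz0
    rwa [hc0] at this
  · have h5 : (fun t => z t • tderiv ℝ E c 0 1) =O[l] z :=
      IsBigO.of_bound ‖tderiv ℝ E c 0 1‖ (Eventually.of_forall fun t => by
        rw [norm_smul, mul_comm])
    have h6 : (fun t => z t ^ 2) =O[l] z := by
      have := (hz0.isBigO_one ℝ).mul (isBigO_refl z l)
      exact this.congr (fun t => by ring) (fun t => by rw [one_mul])
    exact ((h4.trans h6).add h5 |>.congr_left fun t => by abel).trans hz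

theorem abs_ciSup_sub_ciSup_le {ι : Type*} [Nonempty ι] {f g : ι → ℝ} (hf : BddAbove (range f))
    (hg : BddAbove (range g)) {c : ℝ} (h : ∀ i, |f i - g i| ≤ c) :
    |(⨆ i, f i) - ⨆ i, g i| ≤ c := by
  rw [abs_sub_le_iff]
  constructor
  · rw [sub_le_iff_le_add]
    refine ciSup_le fun i => ?_
    linarith [(abs_le.1 (h i)).2, le_ciSup hg i]
  · rw [sub_le_iff_le_add]
    refine ciSup_le fun i => ?_
    linarith [(abs_le.1 (h i)).1, le_ciSup hf i]

/-- A path whose increments are, to first order, in the Lie algebra of a closed subgroup stays in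
a coset of this subgroup. -/
theorem inv_mul_mem_of_hasJet {H : Subgroup G} (hH : IsClosed (H : Set G)) {p : ℝ → G} {a b : ℝ}
    (hp : ContinuousOn p (Icc a b))
    (h : ∀ s ∈ Ico a b, ∃ ρ z : ℝ → ℝ, ∃ ζ : E, (fun t => ρ t ^ 2) =o[𝓝[>] s] (fun t => t - s) ∧
      z =O[𝓝[>] s] ρ ∧ Tendsto z (𝓝[>] s) (𝓝 0) ∧ ζ ∈ subgroupLieAlgebra E H ∧
      HasJet (𝓝[>] s) ρ (fun t => t - s) (fun t => (p s)⁻¹ * p t) (fun t => z t • ζ)) :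
    ∀ t ∈ Icc a b, (p a)⁻¹ * p t ∈ H := by
  have : IsTopologicalGroup G := topologicalGroup_of_lieGroup 𝓘(ℝ, E) ∞
  intro t ht
  by_contra hne
  have hcl : IsClosed {y : G | (p t)⁻¹ * y ∈ H} := hH.preimage (by fun_prop)
  obtain ⟨F, hF, hFc, hF1, hF0, hFU⟩ := exists_contMDiff_separating (E := E) (p := p a)
    (U := {y : G | (p t)⁻¹ * y ∈ H}ᶜ) (hcl.isOpen_compl.mem_nhds fun hmem => hne (by
      have := H.inv_mem hmem
      simpa using this))
  -- The supremum over the fibre makes the bump function invariant under `H` on the right. It is at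
  -- least `1` at `p a` and vanishes on the coset of `p t`. It need not be smooth: Lipschitz control
  -- under small left translations suffices to differentiate along the path.
  set f : G → ℝ := fun y => ⨆ x : H, F (y * x) with hf
  obtain ⟨B, hB⟩ := hFc.exists_bound_of_continuous hF.continuous
  have hbdd : ∀ y : G, BddAbove (range fun x : H => F (y * x)) := fun y =>
    ⟨B, by rintro _ ⟨x, rfl⟩; exact (le_abs_self _).trans (hB _)⟩
  have hinv : ∀ y : G, ∀ x ∈ H, f (y * x) = f y := by
    intro y x hx
    simp only [hf, mul_assoc]
    exact (Equiv.mulLeft (⟨x, hx⟩ : H)).iSup_congr (fun _ => rfl)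
  -- The uniform estimate leaves the left factor free, whereas here the right factor `y x` must be
  -- free. Passing to inverses exchanges the two sides.
  have hF' : ContMDiff 𝓘(ℝ, E) 𝓘(ℝ, ℝ) ∞ (fun y => F y⁻¹) :=
    hF.comp (contMDiff_inv 𝓘(ℝ, E) ∞)
  obtain ⟨K, hK⟩ := exists_eventually_mul_le hF'
    (hFc.comp_homeomorph (Homeomorph.inv G)) (isCompact_singleton (x := (1 : G)))
  have hfK : ∀ᶠ m : G in 𝓝 1, ∀ y : G, |f (m⁻¹ * y) - f y| ≤ K * ‖groupCoord E m‖ := by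
    filter_upwards [hK] with m hm y
    refine abs_ciSup_sub_ciSup_le (hbdd _) (hbdd _) fun x => ?_
    have := hm 1 rfl (y * x)⁻¹
    simpa [mul_assoc] using this
  have hfc : Continuous f := by
    refine continuous_iff_continuousAt.2 fun y => ?_
    have c1 : Tendsto (fun w : G => y * w⁻¹) (𝓝 y) (𝓝 1) := by
      have : Tendsto (fun w : G => y * w⁻¹) (𝓝 y) (𝓝 (y * y⁻¹)) :=
        (by fun_prop : Continuous fun w : G => y * w⁻¹).tendsto _
      rwa [mul_inv_cancel] at this
    have c2 : Tendsto (fun w : G => K * ‖groupCoord E (y * w⁻¹)‖) (𝓝 y) (𝓝 0) := by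
      have := ((tendsto_groupCoord (E := E) (G := G)).comp c1).norm.const_mul K
      simpa using! this
    rw [ContinuousAt, tendsto_iff_norm_sub_tendsto_zero]
    refine squeeze_zero' (Eventually.of_forall fun _ => norm_nonneg _) ?_ c2
    filter_upwards [c1.eventually hfK] with w hw
    simpa using hw y
  have key : f (p t) = f (p a) := by
    refine constant_of_has_deriv_right_zero (f := fun t => f (p t))
      (hfc.comp_continuousOn hp) (fun s hs => ?_) t ht
    refine hasDerivWithinAt_zero_of_isLittleO ?_
    obtain ⟨ρ, z, ζ, hρ, hz, hz0, ⟨c, hc, hcadd, hcH, hcd⟩, hj⟩ := h s hs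
    have hc0 : c 0 = 1 := by simpa using hcadd 0 0
    have hj2 := HasJet.of_curve hc.contMDiffAt hc0 hρ hz hz0
    have hcd' : tderiv ℝ E c 0 1 = ζ := hcd
    rw [hcd'] at hj2
    -- Correcting `p t` on the right by an element of `H` does not change `f` and cancels the linear
    -- part of the increment. The corrected point is a left translate of `p s` by an element whose
    -- coordinate is `o(t - s)`.
    have hj3 := (((hj.mul (hj2.inv hρ) hρ).conj hρ (p s)).inv hρ)
    have ho : (fun t => groupCoord E (p s * ((p s)⁻¹ * p t * (c (z t))⁻¹) * (p s)⁻¹)⁻¹)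
        =o[𝓝[>] s] fun t => t - s := by
      simpa using hj3.isLittleO
    have hO : (fun t => f (p t) - f (p s)) =O[𝓝[>] s]
        fun t => groupCoord E (p s * ((p s)⁻¹ * p t * (c (z t))⁻¹) * (p s)⁻¹)⁻¹ := by
      refine IsBigO.of_bound K ?_
      filter_upwards [hj3.tendsto.eventually hfK] with t ht
      have := ht (p s)
      rw [inv_inv] at this
      have e : p s * ((p s)⁻¹ * p t * (c (z t))⁻¹) * (p s)⁻¹ * p s = p t * (c (z t))⁻¹ := by
        group
      rw [e, hinv _ _ (H.inv_mem (hcH _))] at this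
      exact this
    exact hO.trans_isLittleO ho
  have h1 : (1 : ℝ) ≤ f (p a) := by
    have := le_ciSup (hbdd (p a)) 1
    simpa [hF1] using this
  have h0 : f (p t) = 0 := by
    have : ∀ x : H, F (p t * x) = 0 := fun x => hFU _ (by simp)
    simp [hf, this]
  rw [key] at h0
  linarith

/-! ### Tangent directions of a closed subgroup -/

/-- If `k n ∈ H` agrees with `c (ε n)` up to `o(ε n)`, then `k n ^ N` with `N = ⌊t / ε n⌋`
approximates `c t`: the `N` errors are each `o(ε n)` and add up to `o(1)`. A limit of elements of
`H` is in `H`, which is tested with a bump function at `c t` vanishing on `H`. -/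
theorem mem_of_tendsto_rescaled {H : Subgroup G} (hH : IsClosed (H : Set G)) {c : ℝ → G} {v : E}
    (hc : ContMDiff 𝓘(ℝ, ℝ) 𝓘(ℝ, E) ∞ c) (hadd : ∀ s t, c (s + t) = c s * c t)
    (hcd : tderiv ℝ E c 0 1 = v) {k : ℕ → G} {ε : ℕ → ℝ} (hkH : ∀ n, k n ∈ H)
    (hk : Tendsto k atTop (𝓝 1)) (hε : ∀ n, 0 < ε n) (hε0 : Tendsto ε atTop (𝓝 0))
    (hkv : (fun n => groupCoord E (k n) - ε n • v) =o[atTop] ε) (t : ℝ) : c t ∈ H := by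
  have : IsTopologicalGroup G := topologicalGroup_of_lieGroup 𝓘(ℝ, E) ∞
  have hc0 : c 0 = 1 := by simpa using hadd 0 0
  have hcinv : ∀ s, c (-s) = (c s)⁻¹ := fun s => by
    rw [eq_inv_iff_mul_eq_one, ← hadd, neg_add_cancel, hc0]
  have hmul : ∀ (n : ℕ) s, c (n * s) = c s ^ n := by
    intro n s
    induction n with
    | zero => simp [hc0]
    | succ n ih => rw [pow_succ, ← ih, ← hadd]; push_cast; ring_nf
  suffices hpos : ∀ t, 0 ≤ t → c t ∈ H by
    rcases le_total 0 t with ht | ht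
    · exact hpos t ht
    · rw [← neg_neg t, hcinv]
      exact H.inv_mem (hpos _ (by linarith))
  intro t ht
  by_contra hne
  obtain ⟨F, hF, hFc, hF1, hF0, hFU⟩ := exists_contMDiff_separating (E := E) (p := c t)
    (U := (H : Set G)ᶜ) (hH.isOpen_compl.mem_nhds hne)
  obtain ⟨K, hK⟩ := exists_eventually_mul_le hF hFc
    ((isCompact_Icc (a := (0 : ℝ)) (b := t)).image hc.continuous)
  have hρ : (fun n => ε n ^ 2) =o[atTop] ε := by
    have := (isLittleO_one_iff ℝ).2 hε0 |>.mul_isBigO (isBigO_refl ε atTop)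
    exact this.congr (fun n => by ring) (fun n => by rw [one_mul])
  have hεv : (fun n => ε n • v) =O[atTop] ε :=
    IsBigO.of_bound ‖v‖ (Eventually.of_forall fun t => by rw [norm_smul, mul_comm])
  have hj : HasJet atTop ε ε k (fun n => ε n • v) :=
    ⟨hk, (hkv.isBigO.add hεv).congr_left fun n => by abel, hkv⟩
  have hj2 := HasJet.of_curve hc.contMDiffAt hc0 hρ (isBigO_refl ε atTop) hε0
  rw [hcd] at hj2
  have hm := hj.mul (hj2.inv hρ) hρ
  have hmo : (fun n => groupCoord E (k n * (c (ε n))⁻¹)) =o[atTop] ε := by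
    simpa using hm.isLittleO
  set N : ℕ → ℕ := fun n => ⌊t / ε n⌋₊ with hN
  have hNle : ∀ n, N n * ε n ≤ t := fun n => by
    rw [← le_div_iff₀ (hε n)]
    exact Nat.floor_le (div_nonneg ht (hε n).le)
  have hNlim : Tendsto (fun n => (N n : ℝ) * ε n) atTop (𝓝 t) := by
    refine tendsto_of_tendsto_of_tendsto_of_le_of_le (g := fun n => t - ε n)
      (by simpa using tendsto_const_nhds.sub hε0) tendsto_const_nhds (fun n => ?_) hNle
    have := Nat.lt_floor_add_one (t / ε n)
    rw [div_lt_iff₀ (hε n)] at this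
    simp only [hN]
    linarith
  have hbound : ∀ᶠ n in atTop, |F (k n ^ N n) - F (c (N n * ε n))| ≤
      |K| * (t * (‖groupCoord E (k n * (c (ε n))⁻¹)‖ / ε n)) := by
    filter_upwards [hm.tendsto.eventually hK] with n hn
    set m := k n * (c (ε n))⁻¹ with hmdef
    -- Telescoping: one factor `c (ε n)` at a time is replaced by `k n`. The left factor `k n ^ j`
    -- is uncontrolled, which is why the estimate had to be uniform in `y`; the right factor stays
    -- in the compact arc `c '' Icc 0 t`.
    have step : ∀ j ≤ N n, |F (k n ^ j * c ((N n - j : ℝ) * ε n)) - F (c (N n * ε n))| ≤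
        j * (|K| * ‖groupCoord E m‖) := by
      intro j
      induction j with
      | zero => intro _; simp
      | succ j ih =>
        intro hj
        have ih := ih (by omega)
        have hj' : (j : ℝ) + 1 ≤ N n := by exact_mod_cast hj
        have hmem : c ((N n - j : ℝ) * ε n) ∈ c '' Icc 0 t :=
          ⟨_, ⟨mul_nonneg (by linarith) (hε n).le,
            le_trans (mul_le_mul_of_nonneg_right (by linarith [j.cast_nonneg (α := ℝ)])
              (hε n).le) (hNle n)⟩, rfl⟩
        have h1 := hn _ hmem (k n ^ j)
        have e : k n ^ j * m * c ((N n - j : ℝ) * ε n) =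
            k n ^ (j + 1) * c ((N n - (j + 1 : ℕ) : ℝ) * ε n) := by
          have : ((N n : ℝ) - j) * ε n = ε n + (N n - (j + 1 : ℕ) : ℝ) * ε n := by push_cast; ring
          rw [this, hadd, hmdef, pow_succ]
          group
        rw [e] at h1
        calc _ ≤ _ := abs_sub_le _ (F (k n ^ j * c ((N n - j : ℝ) * ε n))) _
          _ ≤ |K| * ‖groupCoord E m‖ + j * (|K| * ‖groupCoord E m‖) :=
            add_le_add (h1.trans (by gcongr; exact le_abs_self K)) ih
          _ = _ := by push_cast; ring
    have := step (N n) le_rfl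
    rw [sub_self, zero_mul, hc0, mul_one] at this
    refine this.trans ?_
    have h2 : (N n : ℝ) ≤ t / ε n := Nat.floor_le (div_nonneg ht (hε n).le)
    calc (N n : ℝ) * (|K| * ‖groupCoord E m‖) ≤ t / ε n * (|K| * ‖groupCoord E m‖) := by gcongr
      _ = _ := by ring
  have hlim0 : Tendsto (fun n => |K| * (t * (‖groupCoord E (k n * (c (ε n))⁻¹)‖ / ε n))) atTop
      (𝓝 0) := by
    have := (hmo.norm_left.tendsto_div_nhds_zero.const_mul t).const_mul |K|
    simpa using this
  have hlim1 : Tendsto (fun n => F (k n ^ N n) - F (c (N n * ε n))) atTop (𝓝 0) :=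
    squeeze_zero_norm' hbound hlim0
  have hlim2 : Tendsto (fun n => F (c (N n * ε n))) atTop (𝓝 (F (c t))) :=
    (hF.continuous.comp hc.continuous).tendsto t |>.comp hNlim
  have hlim3 := hlim1.add hlim2
  have hzero : ∀ n, F (k n ^ N n) = 0 := fun n => hFU _ fun h => h (H.pow_mem (hkH n) _)
  simp only [hzero, sub_add_cancel, zero_add, hF1] at hlim3
  exact zero_ne_one (tendsto_nhds_unique tendsto_const_nhds hlim3)

/-- A weak form of Cartan's theorem: near the identity, a closed subgroup is close to its
Lie algebra. -/
theorem eventually_norm_sub_le_of_mem [FirstCountableTopology G] {H : Subgroup G}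
    (hH : IsClosed (H : Set G))
    (hexp : ∀ v : E, ∃ c : ℝ → G, ContMDiff 𝓘(ℝ, ℝ) 𝓘(ℝ, E) ∞ c ∧
      (∀ s t, c (s + t) = c s * c t) ∧ tderiv ℝ E c 0 1 = v)
    {P : E →L[ℝ] E} (hP : ∀ ξ : E, ξ ∈ subgroupLieAlgebra E H → P ξ = ξ) {δ : ℝ} (hδ : 0 < δ) :
    ∀ᶠ h in 𝓝[(H : Set G)] 1,
      ‖groupCoord E h - P (groupCoord E h)‖ ≤ δ * ‖groupCoord E h‖ := by
  by_contra hcon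
  rw [not_eventually] at hcon
  obtain ⟨u, hu, hup⟩ := exists_seq_forall_of_frequently
    (hcon.and_eventually self_mem_nhdsWithin)
  have hpos : ∀ n, 0 < ‖groupCoord E (u n)‖ := by
    intro n
    rw [norm_pos_iff]
    intro h0
    apply (hup n).1
    simp [h0]
  -- A sequence in `H` violating the bound is normalised in coordinates. A limit direction `v` on
  -- the unit sphere generates a one-parameter group inside `H`, so `P v = v`, whereas the violated
  -- bound forces `‖v - P v‖ ≥ δ`.
  set w : ℕ → E := fun n => ‖groupCoord E (u n)‖⁻¹ • groupCoord E (u n) with hw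
  have hws : ∀ n, w n ∈ Metric.sphere (0 : E) 1 := by
    intro n
    simp only [hw, mem_sphere_zero_iff_norm, norm_smul, norm_inv, norm_norm]
    exact inv_mul_cancel₀ (hpos n).ne'
  obtain ⟨v, hv, φ, hφ, hlim⟩ := (isCompact_sphere (0 : E) 1).tendsto_subseq hws
  have hu1 : Tendsto u atTop (𝓝 1) := hu.mono_right nhdsWithin_le_nhds
  obtain ⟨c, hc, hadd, hcd⟩ := hexp v
  have hmem : v ∈ subgroupLieAlgebra E H := by
    refine ⟨c, hc, hadd, fun t => ?_, hcd⟩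
    refine mem_of_tendsto_rescaled hH hc hadd hcd (k := u ∘ φ)
      (ε := fun n => ‖groupCoord E (u (φ n))‖) (fun n => (hup _).2)
      (hu1.comp hφ.tendsto_atTop) (fun n => hpos _) ?_ ?_ t
    · have := ((tendsto_groupCoord (E := E) (G := G)).comp hu1).norm.comp hφ.tendsto_atTop
      simpa using! this
    · have h1 : Tendsto (fun n => w (φ n) - v) atTop (𝓝 0) := by
        simpa using hlim.sub_const v
      have h2 := (isBigO_refl (fun n => ‖groupCoord E (u (φ n))‖) atTop).smul_isLittleO
        ((isLittleO_one_iff ℝ).2 h1)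
      refine h2.congr (fun n => ?_) (fun n => by simp)
      simp only [hw, smul_sub, smul_smul, Function.comp_apply]
      rw [mul_inv_cancel₀ (hpos _).ne', one_smul]
  have hlim2 : Tendsto (fun n => ‖w (φ n) - P (w (φ n))‖) atTop (𝓝 ‖v - P v‖) :=
    (hlim.sub ((P.continuous.tendsto v).comp hlim)).norm
  have hge : ∀ n, δ ≤ ‖w (φ n) - P (w (φ n))‖ := by
    intro n
    have := (hup (φ n)).1
    rw [not_le] at this
    simp only [hw]
    rw [map_smul, ← smul_sub, norm_smul, norm_inv, norm_norm, inv_mul_eq_div,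
      le_div_iff₀ (hpos _)]
    exact this.le
  have := ge_of_tendsto' hlim2 hge
  rw [hP v hmem, sub_self, norm_zero] at this
  linarith

end Cosets

/-! ### Smooth dependence on initial conditions, by inverting the integral equation in a Banach
space. -/

section SmoothFlow

open Filter Topology Asymptotics MeasureTheory

universe u

/-! ### Smoothness of composition operators -/

theorem norm_sub_sub_fderiv_le {E F : Type*} [NormedAddCommGroup E] [NormedSpace ℝ E]
    [NormedAddCommGroup F] [NormedSpace ℝ F] {f : E → F} (hf : Differentiable ℝ f) {K : ℝ≥0}
    (hK : LipschitzWith K (fderiv ℝ f)) (x y : E) :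
    ‖f y - f x - fderiv ℝ f x (y - x)‖ ≤ K * ‖y - x‖ * ‖y - x‖ :=
  (convex_closedBall x ‖y - x‖).norm_image_sub_le_of_norm_hasFDerivWithin_le'
    (fun z _ => (hf z).hasFDerivAt.hasFDerivWithinAt)
    (fun z hz => by
      refine (hK.norm_sub_le _ _).trans ?_
      rw [mem_closedBall_iff_norm] at hz
      gcongr)
    (by simp) (by simp [dist_eq_norm])

/-- Pointwise application of a continuous family of linear maps to a continuous function. -/
noncomputable def pointwiseApply (X : Type*) [TopologicalSpace X] [CompactSpace X]
    (E F : Type*) [NormedAddCommGroup E] [NormedSpace ℝ E]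
    [NormedAddCommGroup F] [NormedSpace ℝ F] : C(X, E →L[ℝ] F) →L[ℝ] C(X, E) →L[ℝ] C(X, F) :=
  LinearMap.mkContinuous₂
    (LinearMap.mk₂ ℝ (fun (L : C(X, E →L[ℝ] F)) (γ : C(X, E)) =>
        (⟨fun x => L x (γ x), L.continuous.clm_apply γ.continuous⟩ : C(X, F)))
      (fun _ _ _ => by ext; simp) (fun _ _ _ => by ext; simp)
      (fun _ _ _ => by ext; simp) (fun _ _ _ => by ext; simp)) 1
    (fun L γ => by
      rw [one_mul]
      refine (ContinuousMap.norm_le _ (by positivity)).2 fun x => ?_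
      exact ((L x).le_opNorm _).trans
        (mul_le_mul (L.norm_coe_le_norm x) (γ.norm_coe_le_norm x) (norm_nonneg _) (by positivity)))

theorem norm_pointwiseApply_le {X : Type*} [TopologicalSpace X] [CompactSpace X]
    {E F : Type*} [NormedAddCommGroup E] [NormedSpace ℝ E]
    [NormedAddCommGroup F] [NormedSpace ℝ F] (L : C(X, E →L[ℝ] F)) :
    ‖pointwiseApply X E F L‖ ≤ ‖L‖ := by
  refine ContinuousLinearMap.opNorm_le_bound _ (by positivity) fun γ => ?_
  refine (ContinuousMap.norm_le _ (by positivity)).2 fun x => ?_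
  exact ((L x).le_opNorm _).trans
        (mul_le_mul (L.norm_coe_le_norm x) (γ.norm_coe_le_norm x) (norm_nonneg _) (by positivity))

/-- Compact support makes the derivative of `f` globally Lipschitz, so the pointwise quadratic
remainder is quadratic in the supremum norm. -/
theorem hasFDerivAt_postcomp {X : Type*} [TopologicalSpace X] [CompactSpace X]
    {E F : Type*} [NormedAddCommGroup E] [NormedSpace ℝ E]
    [NormedAddCommGroup F] [NormedSpace ℝ F] (f : C(E, F)) (hf : ContDiff ℝ ∞ f)
    (hfc : HasCompactSupport f) (γ : C(X, E)) :
    HasFDerivAt (fun γ : C(X, E) => f.comp γ)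
      (pointwiseApply X E F ((⟨fderiv ℝ f, hf.continuous_fderiv (by simp)⟩ : C(E, E →L[ℝ] F)).comp
        γ)) γ := by
  obtain ⟨K, hK⟩ := ContDiff.lipschitzWith_of_hasCompactSupport (hfc.fderiv ℝ)
    (hf.fderiv_right (m := 1) two_le_infty) one_ne_zero
  rw [hasFDerivAt_iff_isLittleO]
  have h1 : (fun γ' : C(X, E) => f.comp γ' - f.comp γ -
      pointwiseApply X E F ((⟨fderiv ℝ f, hf.continuous_fderiv (by simp)⟩ :
        C(E, E →L[ℝ] F)).comp γ) (γ' - γ)) =O[𝓝 γ] fun γ' => ‖γ' - γ‖ * ‖γ' - γ‖ := by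
    refine IsBigO.of_bound K (Eventually.of_forall fun γ' => ?_)
    rw [Real.norm_eq_abs, abs_of_nonneg (by positivity)]
    refine (ContinuousMap.norm_le _ (by positivity)).2 fun x => ?_
    refine (norm_sub_sub_fderiv_le (hf.differentiable (by simp)) hK (γ x) (γ' x)).trans ?_
    have := (γ' - γ).norm_coe_le_norm x
    rw [ContinuousMap.sub_apply] at this
    rw [mul_assoc]
    gcongr
  refine h1.trans_isLittleO ?_
  have h2 : (fun γ' : C(X, E) => ‖γ' - γ‖) =o[𝓝 γ] fun _ => (1 : ℝ) := by
    rw [isLittleO_one_iff]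
    have : Continuous fun γ' : C(X, E) => ‖γ' - γ‖ := by fun_prop
    simpa using this.tendsto γ
  have h3 := h2.mul_isBigO (isBigO_refl (fun γ' : C(X, E) => ‖γ' - γ‖) (𝓝 γ))
  exact (h3.congr_right fun γ' => one_mul _).trans_isBigO (isBigO_norm_left.2 (isBigO_refl _ _))

/-- Induction on the order: the derivative is again a postcomposition, with `fderiv ℝ f`, followed
by a bounded linear map. The target changes to `E →L[ℝ] F` at each step, so `F` is quantified inside
the induction and shares the universe of `E`. -/
theorem contDiff_postcomp {X : Type*} [TopologicalSpace X] [CompactSpace X] {E : Type u}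
    [NormedAddCommGroup E] [NormedSpace ℝ E] (n : ℕ) :
    ∀ {F : Type u} [NormedAddCommGroup F] [NormedSpace ℝ F] (f : C(E, F)), ContDiff ℝ ∞ f →
      HasCompactSupport f → ContDiff ℝ n (fun γ : C(X, E) => f.comp γ) := by
  induction n with
  | zero =>
    intro F _ _ f _ _
    exact contDiff_zero.2 (ContinuousMap.continuous_postcomp f)
  | succ n ih =>
    intro F _ _ f hf hfc
    rw [Nat.cast_succ, contDiff_succ_iff_hasFDerivAt]
    refine ⟨_, ?_, hasFDerivAt_postcomp f hf hfc⟩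
    exact (pointwiseApply X E F).contDiff.comp
      (ih ⟨fderiv ℝ f, hf.continuous_fderiv (by simp)⟩ (hf.fderiv_right (by simp)) (hfc.fderiv ℝ))

/-! ### The flow of a compactly supported smooth vector field on a normed space -/

variable {E : Type u} [NormedAddCommGroup E] [NormedSpace ℝ E] [FiniteDimensional ℝ E]

variable (E) in
/-- Integration from `0` on a symmetric interval. -/
noncomputable def volterra {ε : ℝ} (hε : 0 ≤ ε) : C(Icc (-ε) ε, E) →L[ℝ] C(Icc (-ε) ε, E) :=
  have hle : -ε ≤ ε := by linarith
  LinearMap.mkContinuous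
    { toFun := fun γ => ⟨fun t => ∫ s in (0 : ℝ)..t, γ (projIcc (-ε) ε hle s), by
        have hc : Continuous fun s : ℝ => γ (projIcc (-ε) ε hle s) :=
          γ.continuous.comp continuous_projIcc
        exact (intervalIntegral.continuous_primitive
          (fun a b => hc.intervalIntegrable a b) 0).comp continuous_subtype_val⟩
      map_add' := fun γ δ => by
        have hc : ∀ γ : C(Icc (-ε) ε, E), Continuous fun s : ℝ => γ (projIcc (-ε) ε hle s) :=
          fun γ => γ.continuous.comp continuous_projIcc
        ext t
        simpa using! intervalIntegral.integral_add ((hc γ).intervalIntegrable 0 t)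
          ((hc δ).intervalIntegrable 0 t)
      map_smul' := fun c γ => by
        ext t
        simp } ε
    (fun γ => by
      refine (ContinuousMap.norm_le _ (by positivity)).2 fun t => ?_
      have h1 := intervalIntegral.norm_integral_le_of_norm_le_const (a := 0) (b := (t : ℝ))
        (f := fun s => γ (projIcc (-ε) ε hle s)) (C := ‖γ‖) (fun s _ => γ.norm_coe_le_norm _)
      refine h1.trans ?_
      rw [mul_comm]
      gcongr
      rw [sub_zero, abs_le]
      exact t.2)

theorem norm_volterra_le {ε : ℝ} (hε : 0 ≤ ε) : ‖volterra E hε‖ ≤ ε := by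
  unfold volterra
  exact LinearMap.mkContinuous_norm_le _ hε _

/-- A compactly supported smooth vector field has a flow, for small times, which depends smoothly
on the initial condition. -/
theorem exists_smooth_flow {f : E → E} (hf : ContDiff ℝ ∞ f) (hfc : HasCompactSupport f) :
    ∃ ε > 0, ∃ Φ : ℝ → E → E, (∀ x, Φ 0 x = x) ∧
      (∀ x, ∀ t ∈ Ioo (-ε) ε, HasDerivAt (fun s => Φ s x) (f (Φ t x)) t) ∧
      (∀ t, ContDiff ℝ ∞ (Φ t)) ∧ ∃ B, ∀ t ∈ Ioo (-ε) ε, ∀ x, ‖Φ t x - x‖ ≤ B * |t| := by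
  obtain ⟨K, hK⟩ := ContDiff.lipschitzWith_of_hasCompactSupport hfc hf (by simp)
  obtain ⟨B, hB⟩ := hfc.exists_bound_of_continuous hf.continuous
  -- Chosen so that `ε K ≤ 1/2`, which makes the integral operator a contraction; the `+ 1` covers
  -- `K = 0`.
  set ε : ℝ := 1 / (2 * (K + 1)) with hεdef
  have hε : 0 < ε := by positivity
  have hle : -ε ≤ ε := by linarith
  have hεK : ε * K ≤ 1 / 2 := by
    rw [hεdef, one_div_mul_eq_div, div_le_div_iff₀ (by positivity) (by positivity)]
    linarith
  set fc : C(E, E) := ⟨f, hf.continuous⟩ with hfcdef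
  set V := volterra E hε.le with hV
  have hVn : ‖V‖ ≤ ε := norm_volterra_le hε.le
  -- A curve `γ` is an integral curve starting at `x` exactly when `Ξ γ` is the constant `x`. Hence
  -- the flow is the inverse of `Ξ` applied to constants, and its smoothness is that of the inverse.
  set Ξ : C(Icc (-ε) ε, E) → C(Icc (-ε) ε, E) := fun γ => γ - V (fc.comp γ) with hΞ
  have hΞs : ContDiff ℝ ∞ Ξ := by
    refine contDiff_id.sub (V.contDiff.comp ?_)
    exact contDiff_infty.2 fun n => contDiff_postcomp n fc hf hfc
  have hlip : ∀ γ δ : C(Icc (-ε) ε, E), ‖fc.comp γ - fc.comp δ‖ ≤ K * ‖γ - δ‖ := by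
    intro γ δ
    refine (ContinuousMap.norm_le _ (by positivity)).2 fun x => ?_
    refine (hK.norm_sub_le (γ x) (δ x)).trans ?_
    have := (γ - δ).norm_coe_le_norm x
    rw [ContinuousMap.sub_apply] at this
    gcongr
  have happ : ApproximatesLinearOn Ξ
      ((ContinuousLinearEquiv.refl ℝ C(Icc (-ε) ε, E) : C(Icc (-ε) ε, E) →L[ℝ] C(Icc (-ε) ε, E)))
      univ (1 / 2 : ℝ≥0) := by
    rw [ApproximatesLinearOn.approximatesLinearOn_iff_lipschitzOnWith]
    refine LipschitzOnWith.of_dist_le_mul fun γ _ δ _ => ?_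
    rw [dist_eq_norm, dist_eq_norm]
    have e : (Ξ - ((ContinuousLinearEquiv.refl ℝ C(Icc (-ε) ε, E) :
        C(Icc (-ε) ε, E) →L[ℝ] C(Icc (-ε) ε, E)))) γ - (Ξ - ((ContinuousLinearEquiv.refl ℝ
          C(Icc (-ε) ε, E) : C(Icc (-ε) ε, E) →L[ℝ] C(Icc (-ε) ε, E)))) δ =
        - V (fc.comp γ - fc.comp δ) := by
      simp [hΞ]; abel
    rw [e, norm_neg]
    calc ‖V (fc.comp γ - fc.comp δ)‖ ≤ ε * (K * ‖γ - δ‖) :=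
          (V.le_opNorm _).trans (mul_le_mul hVn (hlip γ δ) (norm_nonneg _) hε.le)
      _ = ε * K * ‖γ - δ‖ := by ring
      _ ≤ 1 / 2 * ‖γ - δ‖ := by gcongr
      _ = _ := by simp
  have hcase : Subsingleton C(Icc (-ε) ε, E) ∨ (1 / 2 : ℝ≥0) <
      ‖((ContinuousLinearEquiv.refl ℝ C(Icc (-ε) ε, E)).symm :
        C(Icc (-ε) ε, E) →L[ℝ] C(Icc (-ε) ε, E))‖₊⁻¹ := by
    rcases subsingleton_or_nontrivial C(Icc (-ε) ε, E) with h | h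
    · exact Or.inl h
    · right
      have : ‖((ContinuousLinearEquiv.refl ℝ C(Icc (-ε) ε, E)).symm :
        C(Icc (-ε) ε, E) →L[ℝ] C(Icc (-ε) ε, E))‖₊ = 1 := by
        ext
        exact ContinuousLinearMap.norm_id
      rw [this, inv_one]
      exact NNReal.half_lt_self one_ne_zero
  set Θ := ApproximatesLinearOn.toHomeomorph Ξ happ hcase with hΘ
  have hΘΞ : ∀ γ, Θ γ = Ξ γ := fun γ => rfl
  have hΘsymm : ContDiff ℝ ∞ Θ.symm := by
    have hinv : ∀ γ : C(Icc (-ε) ε, E), ∃ A : C(Icc (-ε) ε, E) ≃L[ℝ] C(Icc (-ε) ε, E),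
        HasFDerivAt Θ (A : C(Icc (-ε) ε, E) →L[ℝ] C(Icc (-ε) ε, E)) γ := by
      intro γ
      set D := pointwiseApply (Icc (-ε) ε) E E
        ((⟨fderiv ℝ fc, hf.continuous_fderiv (by simp)⟩ : C(E, E →L[ℝ] E)).comp γ) with hD
      have hDn : ‖D‖ ≤ K := by
        refine (norm_pointwiseApply_le _).trans ?_
        refine (ContinuousMap.norm_le _ K.coe_nonneg).2 fun x => ?_
        exact norm_fderiv_le_of_lipschitz ℝ hK
      -- The differential of `Ξ` is `1 - V D`, invertible by the Neumann series; so the inverse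
      -- homeomorphism is smooth.
      have hVD : ‖V.comp D‖ < 1 := by
        refine (V.opNorm_comp_le D).trans_lt ?_
        calc ‖V‖ * ‖D‖ ≤ ε * K := by gcongr
          _ < 1 := by linarith
      refine ⟨ContinuousLinearEquiv.unitsEquiv ℝ _ (Units.oneSub (V.comp D) hVD), ?_⟩
      have h1 := (hasFDerivAt_id γ).sub
        (V.hasFDerivAt.comp γ (hasFDerivAt_postcomp fc hf hfc γ))
      exact h1
    choose A hA using hinv
    exact Θ.contDiff_symm hA hΞs
  set cst : E →L[ℝ] C(Icc (-ε) ε, E) := ContinuousLinearMap.const ℝ (Icc (-ε) ε) with hcst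
  set Γ : E → C(Icc (-ε) ε, E) := fun x => Θ.symm (cst x) with hΓ
  have hΓs : ContDiff ℝ ∞ Γ := hΘsymm.comp cst.contDiff
  have hΓeq : ∀ x (t : Icc (-ε) ε),
      Γ x t = x + ∫ s in (0 : ℝ)..t, f (Γ x (projIcc (-ε) ε hle s)) := by
    intro x t
    have h1 : Ξ (Γ x) = cst x := by
      rw [← hΘΞ]; exact Θ.apply_symm_apply _
    have h2 := DFunLike.congr_fun h1 t
    simp only [hΞ, ContinuousMap.sub_apply] at h2
    rw [sub_eq_iff_eq_add] at h2
    rw [h2]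
    rfl
  have hcont : ∀ x, Continuous fun s : ℝ => f (Γ x (projIcc (-ε) ε hle s)) := fun x =>
    hf.continuous.comp ((Γ x).continuous.comp continuous_projIcc)
  have hΦeq : ∀ x, ∀ t ∈ Icc (-ε) ε, Γ x (projIcc (-ε) ε hle t) =
      x + ∫ s in (0 : ℝ)..t, f (Γ x (projIcc (-ε) ε hle s)) := by
    intro x t ht
    rw [hΓeq, projIcc_of_mem hle ht]
  refine ⟨ε, hε, fun t x => Γ x (projIcc (-ε) ε hle t), fun x => ?_, fun x t ht => ?_,
    fun t => ?_, B, fun t ht x => ?_⟩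
  · show Γ x (projIcc (-ε) ε hle 0) = x
    rw [hΦeq x 0 ⟨by linarith, hε.le⟩]
    simp
  · have h1 : HasDerivAt (fun t => x + ∫ s in (0 : ℝ)..t, f (Γ x (projIcc (-ε) ε hle s)))
        (f (Γ x (projIcc (-ε) ε hle t))) t :=
      (intervalIntegral.integral_hasDerivAt_right ((hcont x).intervalIntegrable _ _)
        (hcont x).stronglyMeasurable.stronglyMeasurableAtFilter
        (hcont x).continuousAt).const_add x
    refine h1.congr_of_eventuallyEq ?_
    filter_upwards [Ioo_mem_nhds ht.1 ht.2] with s hs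
    exact hΦeq x s ⟨hs.1.le, hs.2.le⟩
  · exact (ContinuousMap.evalCLM ℝ (projIcc (-ε) ε hle t)).contDiff.comp hΓs
  · simp only
    rw [hΦeq x t ⟨ht.1.le, ht.2.le⟩, add_sub_cancel_left]
    have := intervalIntegral.norm_integral_le_of_norm_le_const (a := 0) (b := t)
        (f := fun s => f (Γ x (projIcc (-ε) ε hle s))) (C := B) (fun s _ => hB _)
    simpa using this

end SmoothFlow

/-! ### Smooth vector fields on the group and their local flows. -/

section SmoothFields

open Filter Topology Asymptotics Bundle

variable {E : Type*} [NormedAddCommGroup E] [NormedSpace ℝ E] [FiniteDimensional ℝ E]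
  {F : Type*} [NormedAddCommGroup F] [NormedSpace ℝ F]
  {G : Type*} [Group G] [TopologicalSpace G] [ChartedSpace E G] [LieGroup 𝓘(ℝ, E) ∞ G]
  [T2Space G]

/-- A function with values in the model space, seen as a vector field on `G`. -/
def modelField (X : G → E) (p : G) : TangentSpace 𝓘(ℝ, E) p := X p

/-- A vector field on `G` is smooth if it is a smooth section of the tangent bundle. -/
def IsSmoothField (X : G → E) : Prop :=
  ContMDiff 𝓘(ℝ, E) 𝓘(ℝ, E).tangent ∞ (fun p => (⟨p, modelField X p⟩ : TangentBundle 𝓘(ℝ, E) G))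

theorem tangentBundle_ext {a : TangentBundle 𝓘(ℝ, E) G} {p : G} {v : E}
    (h₁ : a.1 = p) (h₂ : @Eq E a.2 v) : (⟨p, v⟩ : TangentBundle 𝓘(ℝ, E) G) = a := by
  obtain ⟨q, w⟩ := a
  change q = p at h₁
  subst h₁
  change @Eq E w v at h₂
  subst h₂
  rfl

theorem IsSmoothField.sub {X Y : G → E} (hX : IsSmoothField X)
    (hY : IsSmoothField Y) : IsSmoothField (fun p => X p - Y p) :=
  ContMDiff.sub_section hX hY

theorem IsSmoothField.contMDiff_tderiv {X : G → E}
    (hX : IsSmoothField X) {f : G → F} (hf : ContMDiff 𝓘(ℝ, E) 𝓘(ℝ, F) ∞ f) :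
    ContMDiff 𝓘(ℝ, E) 𝓘(ℝ, F) ∞ (fun p => tderiv E F f p (X p)) := by
  have h1 : ContMDiff 𝓘(ℝ, E).tangent 𝓘(ℝ, F).tangent ∞ (tangentMap 𝓘(ℝ, E) 𝓘(ℝ, F) f) :=
    hf.contMDiff_tangentMap (by simp)
  exact (contMDiff_snd_tangentBundle_modelSpace F 𝓘(ℝ, F)).comp (h1.comp hX)

theorem contMDiff_constFiber {w : G → E} (hw : ContMDiff 𝓘(ℝ, E) 𝓘(ℝ, E) ∞ w) (q : G) :
    ContMDiff 𝓘(ℝ, E) 𝓘(ℝ, E).tangent ∞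
      (fun p => (⟨q, w p⟩ : TangentBundle 𝓘(ℝ, E) G)) := by
  intro p
  rw [contMDiffAt_totalSpace]
  refine ⟨contMDiffAt_const, ?_⟩
  let L : E →L[ℝ] E := (trivializationAt E (TangentSpace 𝓘(ℝ, E)) q).continuousLinearMapAt ℝ q
  have h1 : ContMDiff 𝓘(ℝ, E) 𝓘(ℝ, E) ∞ (fun p => L (w p)) := L.contMDiff.comp hw
  refine (h1 p).congr_of_eventuallyEq (Eventually.of_forall fun p' => ?_)
  have h2 := Trivialization.linearMapAt_apply (R := ℝ)
    (trivializationAt E (TangentSpace 𝓘(ℝ, E)) q) (b := q) (w p')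
  rw [if_pos (mem_baseSet_trivializationAt E (TangentSpace 𝓘(ℝ, E)) q)] at h2
  exact h2.symm

theorem contMDiff_tangentMap_mul {σ τ : G → TangentBundle 𝓘(ℝ, E) G}
    (hσ : ContMDiff 𝓘(ℝ, E) 𝓘(ℝ, E).tangent ∞ σ) (hτ : ContMDiff 𝓘(ℝ, E) 𝓘(ℝ, E).tangent ∞ τ) :
    ContMDiff 𝓘(ℝ, E) 𝓘(ℝ, E).tangent ∞ (fun p =>
      tangentMap (𝓘(ℝ, E).prod 𝓘(ℝ, E)) 𝓘(ℝ, E) (fun x : G × G => x.1 * x.2)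
        ((equivTangentBundleProd 𝓘(ℝ, E) G 𝓘(ℝ, E) G).symm (σ p, τ p))) := by
  have h1 : ContMDiff (𝓘(ℝ, E).prod 𝓘(ℝ, E)).tangent 𝓘(ℝ, E).tangent ∞
      (tangentMap (𝓘(ℝ, E).prod 𝓘(ℝ, E)) 𝓘(ℝ, E) (fun x : G × G => x.1 * x.2)) :=
    (contMDiff_mul 𝓘(ℝ, E) ∞).contMDiff_tangentMap (by simp)
  exact h1.comp (contMDiff_equivTangentBundleProd_symm.comp (hσ.prodMk hτ))

theorem tangentMap_mul_snd (x y : G) (v w : E) :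
    @Eq E (tangentMap (𝓘(ℝ, E).prod 𝓘(ℝ, E)) 𝓘(ℝ, E) (fun x : G × G => x.1 * x.2)
        ((equivTangentBundleProd 𝓘(ℝ, E) G 𝓘(ℝ, E) G).symm
          ((⟨x, v⟩ : TangentBundle 𝓘(ℝ, E) G), (⟨y, w⟩ : TangentBundle 𝓘(ℝ, E) G)))).2
      (tderiv E E (fun z => z * y) x v + tderiv E E (fun z => x * z) y w) :=
  mfderiv_prod_eq_add_apply (p := (x, y)) (v := (v, w))
    ((contMDiff_mul 𝓘(ℝ, E) (∞ : WithTop ℕ∞) (G := G)).mdifferentiableAt (by simp))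

/-- The field is the tangent map of multiplication applied to the zero vector at `p` and the vector
`w p` at the identity, both of which depend smoothly on `p`. -/
theorem isSmoothField_mul_left {w : G → E} (hw : ContMDiff 𝓘(ℝ, E) 𝓘(ℝ, E) ∞ w) :
    IsSmoothField (fun p : G => tderiv E E (fun z => p * z) 1 (w p)) := by
  refine (contMDiff_tangentMap_mul (contMDiff_zeroSection ℝ (TangentSpace 𝓘(ℝ, E) (M := G)))
    (contMDiff_constFiber hw 1)).congr fun p => ?_
  refine tangentBundle_ext (mul_one p) ?_
  refine (tangentMap_mul_snd p 1 0 (w p)).trans ?_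
  change tderiv E E (fun z => z * 1) p (0 : E) + _ = _
  rw [map_zero, zero_add]
  rfl

theorem isSmoothField_mul_right (A : E) :
    IsSmoothField (fun p : G => tderiv E E (fun y => y * p) 1 A) := by
  refine (contMDiff_tangentMap_mul (contMDiff_constFiber (contMDiff_const (c := A)) 1)
    (contMDiff_zeroSection ℝ (TangentSpace 𝓘(ℝ, E) (M := G)))).congr fun p => ?_
  refine tangentBundle_ext (one_mul p) ?_
  refine (tangentMap_mul_snd 1 p (A) 0).trans ?_
  rw [map_zero, add_zero]
  rfl

theorem contMDiff_mul_left' (a : G) : ContMDiff 𝓘(ℝ, E) 𝓘(ℝ, E) ∞ (fun y : G => a * y) :=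
  contMDiff_mul_left

theorem contMDiff_mul_right' (a : G) : ContMDiff 𝓘(ℝ, E) 𝓘(ℝ, E) ∞ (fun y : G => y * a) :=
  contMDiff_mul_right

theorem ContMDiff.mdiffAt {M N E E' : Type*} [NormedAddCommGroup E] [NormedSpace ℝ E]
    [NormedAddCommGroup E'] [NormedSpace ℝ E'] [TopologicalSpace M] [ChartedSpace E M]
    [TopologicalSpace N] [ChartedSpace E' N] {f : M → N}
    (hf : ContMDiff 𝓘(ℝ, E) 𝓘(ℝ, E') ∞ f) {p : M} :
    MDifferentiableAt 𝓘(ℝ, E) 𝓘(ℝ, E') f p :=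
  hf.mdifferentiableAt (by simp)

theorem tderiv_mul_left_mul_left (a b p : G) (v : E) :
    tderiv E E (fun y : G => a * y) (b * p) (tderiv E E (fun y : G => b * y) p v) =
      tderiv E E (fun y : G => a * b * y) p v := by
  rw [← tderiv_comp_apply (contMDiff_mul_left' a).mdiffAt (contMDiff_mul_left' b).mdiffAt]
  simp only [mul_assoc]

theorem eventually_contMDiffAt_groupChart :
    ∀ᶠ v : E in 𝓝 0, ContMDiffAt 𝓘(ℝ, E) 𝓘(ℝ, E) ∞ (groupChart E G) v := by
  have h2 : ContMDiff 𝓘(ℝ, E) 𝓘(ℝ, E) ∞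
      (fun v : E => v + extChartAt 𝓘(ℝ, E) (1 : G) 1) :=
    (contDiff_id.add contDiff_const).contMDiff
  have h3 : Tendsto (fun v : E => v + extChartAt 𝓘(ℝ, E) (1 : G) 1) (𝓝 0)
      (𝓝 (extChartAt 𝓘(ℝ, E) (1 : G) 1)) := by
    simpa using h2.continuous.tendsto 0
  filter_upwards [h3.eventually (eventually_mem_nhds_iff.2
    (extChartAt_target_mem_nhds (I := 𝓘(ℝ, E)) (1 : G)))] with v hv
  exact ((contMDiffOn_extChartAt_symm (1 : G)).contMDiffAt hv).comp v (h2 v)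

/-- A map into `G` is smooth at a point where it is continuous if its coordinates around the image
point are. -/
theorem contMDiffAt_of_groupCoord {V N : Type*} [NormedAddCommGroup V] [NormedSpace ℝ V]
    [TopologicalSpace N] [ChartedSpace V N] {γ : N → G} {t : N} (hc : ContinuousAt γ t)
    (h : ContMDiffAt 𝓘(ℝ, V) 𝓘(ℝ, E) ∞ (fun s => groupCoord E ((γ t)⁻¹ * γ s)) t) :
    ContMDiffAt 𝓘(ℝ, V) 𝓘(ℝ, E) ∞ γ t := by
  have : IsTopologicalGroup G := topologicalGroup_of_lieGroup 𝓘(ℝ, E) ∞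
  have h0 : groupCoord E ((γ t)⁻¹ * γ t) = 0 := by simp
  have h1 : ContMDiffAt 𝓘(ℝ, V) 𝓘(ℝ, E) ∞
      (fun s => γ t * groupChart E G (groupCoord E ((γ t)⁻¹ * γ s))) t := by
    refine (contMDiff_mul_left' (γ t)).contMDiffAt.comp t ?_
    refine ContMDiffAt.comp (g := groupChart E G) t ?_ h
    rw [h0]
    exact contMDiffAt_groupChart
  refine h1.congr_of_eventuallyEq ?_
  have h2 : Tendsto (fun s => (γ t)⁻¹ * γ s) (𝓝 t) (𝓝 1) := by
    have : Tendsto (fun s => (γ t)⁻¹ * γ s) (𝓝 t) (𝓝 ((γ t)⁻¹ * γ t)) := hc.tendsto.const_mul _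
    simpa using this
  filter_upwards [h2.eventually (groupChart_groupCoord (E := E) (G := G))] with s hs
  rw [hs, mul_inv_cancel_left]

theorem hasMFDerivAt_curve_iff {γ : ℝ → G} {t : ℝ} {v : E} :
    HasMFDerivAt 𝓘(ℝ, ℝ) 𝓘(ℝ, E) γ t ((1 : ℝ →L[ℝ] ℝ).smulRight v : ℝ →L[ℝ] E) ↔
      MDifferentiableAt 𝓘(ℝ, ℝ) 𝓘(ℝ, E) γ t ∧ tderiv ℝ E γ t 1 = v := by
  constructor
  · intro h
    refine ⟨h.mdifferentiableAt, ?_⟩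
    have h1 : tderiv ℝ E γ t = ((1 : ℝ →L[ℝ] ℝ).smulRight v : ℝ →L[ℝ] E) := h.mfderiv
    rw [h1]
    simp
  · rintro ⟨h1, h2⟩
    have h3 : tderiv ℝ E γ t = ((1 : ℝ →L[ℝ] ℝ).smulRight v : ℝ →L[ℝ] E) := by
      ext
      simp [h2]
    rw [← h3]
    exact h1.hasMFDerivAt

theorem IsMIntegralCurveOn.hasDerivAt_comp {X : G → E} {γ : ℝ → G}
    {s : Set ℝ} (hs : IsOpen s) (hγ : IsMIntegralCurveOn γ (modelField X) s) {f : G → F}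
    (hf : ContMDiff 𝓘(ℝ, E) 𝓘(ℝ, F) ∞ f) {t : ℝ} (ht : t ∈ s) :
    HasDerivAt (fun r => f (γ r)) (tderiv E F f (γ t) (X (γ t))) t := by
  obtain ⟨h1, h2⟩ := hasMFDerivAt_curve_iff.1 ((hγ t ht).hasMFDerivAt (hs.mem_nhds ht))
  have := hasDerivAt_comp_curve (hf.mdiffAt (p := γ t)) h1
  rwa [h2] at this

/-- Bootstrapping: the derivative of `f ∘ γ` is `(X f) ∘ γ`, and `X f` is again smooth. The
induction therefore runs over all `f` simultaneously. -/
theorem IsMIntegralCurveOn.contDiffOn_comp {X : G → E}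
    (hX : IsSmoothField X) {γ : ℝ → G} {s : Set ℝ} (hs : IsOpen s)
    (hγ : IsMIntegralCurveOn γ (modelField X) s) {f : G → F} (hf : ContMDiff 𝓘(ℝ, E) 𝓘(ℝ, F) ∞ f) :
    ContDiffOn ℝ ∞ (fun r => f (γ r)) s := by
  rw [contDiffOn_infty]
  intro n
  induction n generalizing f with
  | zero =>
    exact contDiffOn_zero.2 (hf.continuous.comp_continuousOn hγ.continuousOn)
  | succ n ih =>
    have h1 := fun t ht => hγ.hasDerivAt_comp hs hf (t := t) ht
    push_cast
    rw [contDiffOn_succ_iff_deriv_of_isOpen hs]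
    refine ⟨fun t ht => (h1 t ht).differentiableAt.differentiableWithinAt, by simp, ?_⟩
    exact (ih (hX.contMDiff_tderiv hf)).congr fun t ht => (h1 t ht).deriv

/-- Integral curves of smooth vector fields are smooth. -/
theorem IsMIntegralCurveOn.contMDiffAt {X : G → E}
    (hX : IsSmoothField X) {γ : ℝ → G} {s : Set ℝ} (hs : IsOpen s)
    (hγ : IsMIntegralCurveOn γ (modelField X) s) {t : ℝ} (ht : t ∈ s) :
    ContMDiffAt 𝓘(ℝ, ℝ) 𝓘(ℝ, E) ∞ γ t := by
  refine contMDiffAt_of_groupCoord (hγ.continuousOn.continuousAt (hs.mem_nhds ht)) ?_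
  have h1 : ContMDiff 𝓘(ℝ, E) 𝓘(ℝ, E) ∞ (fun p : G => groupCoord E ((γ t)⁻¹ * p)) :=
    contMDiff_groupCoord.comp (contMDiff_mul_left' _)
  exact ((hγ.contDiffOn_comp hX hs h1).contDiffAt (hs.mem_nhds ht)).contMDiffAt

theorem IsMIntegralCurve.contMDiff {X : G → E}
    (hX : IsSmoothField X) {γ : ℝ → G} (hγ : IsMIntegralCurve γ (modelField X)) :
    ContMDiff 𝓘(ℝ, ℝ) 𝓘(ℝ, E) ∞ γ := fun t =>
  (hγ.isMIntegralCurveOn univ).contMDiffAt hX isOpen_univ (mem_univ t)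

theorem IsSmoothField.eqOn_Ioo {X : G → E} (hX : IsSmoothField X)
    {γ γ' : ℝ → G} {a b t₀ : ℝ} (ht₀ : t₀ ∈ Ioo a b) (hγ : IsMIntegralCurveOn γ (modelField X) (Ioo a b))
    (hγ' : IsMIntegralCurveOn γ' (modelField X) (Ioo a b)) (h : γ t₀ = γ' t₀) : EqOn γ γ' (Ioo a b) := by
  have : IsManifold 𝓘(ℝ, E) 1 G := IsManifold.of_le (n := ∞) (by simp)
  exact isMIntegralCurveOn_Ioo_eqOn_of_contMDiff_boundaryless ht₀ (ContMDiff.of_le hX (by simp)) hγ hγ' h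

theorem IsSmoothField.eq_of_isMIntegralCurve {X : G → E}
    (hX : IsSmoothField X) {γ γ' : ℝ → G} {t₀ : ℝ} (hγ : IsMIntegralCurve γ (modelField X))
    (hγ' : IsMIntegralCurve γ' (modelField X)) (h : γ t₀ = γ' t₀) : γ = γ' := by
  have : IsManifold 𝓘(ℝ, E) 1 G := IsManifold.of_le (n := ∞) (by simp)
  exact isMIntegralCurve_Ioo_eq_of_contMDiff_boundaryless (ContMDiff.of_le hX (by simp)) hγ hγ' h

/-- A smooth vector field has a local flow, smooth in the initial condition. -/
theorem IsSmoothField.exists_local_flow {X : G → E}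
    (hX : IsSmoothField X) (p₀ : G) :
    ∃ ε > 0, ∃ Φ : ℝ → G → G, ∀ᶠ p in 𝓝 p₀, Φ 0 p = p ∧
      IsMIntegralCurveOn (fun t => Φ t p) (modelField X) (Ioo (-ε) ε) ∧
      ∀ t ∈ Ioo (-ε) ε, ContMDiffAt 𝓘(ℝ, E) 𝓘(ℝ, E) ∞ (Φ t) p := by
  have : IsTopologicalGroup G := topologicalGroup_of_lieGroup 𝓘(ℝ, E) ∞
  set crd : G → E := fun p => groupCoord E (p₀⁻¹ * p) with hcrd
  have hcrds : ContMDiff 𝓘(ℝ, E) 𝓘(ℝ, E) ∞ crd :=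
    contMDiff_groupCoord.comp (contMDiff_mul_left' _)
  set Xc : G → E := fun p => tderiv E E crd p (X p) with hXc
  have hXcs : ContMDiff 𝓘(ℝ, E) 𝓘(ℝ, E) ∞ Xc := hX.contMDiff_tderiv hcrds
  set cht : E → G := fun v => p₀ * groupChart E G v with hcht
  have hchts : ∀ᶠ v : E in 𝓝 0, ContMDiffAt 𝓘(ℝ, E) 𝓘(ℝ, E) ∞ cht v := by
    filter_upwards [eventually_contMDiffAt_groupChart (E := E) (G := G)] with v hv
    exact (contMDiff_mul_left' p₀).contMDiffAt.comp v hv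
  have hcht0 : Tendsto cht (𝓝 0) (𝓝 p₀) := by
    have := (hchts.self_of_nhds).continuousAt.tendsto
    simpa [hcht] using this
  have hcrd0 : Tendsto crd (𝓝 p₀) (𝓝 0) := by
    have := hcrds.continuous.tendsto p₀
    simpa [hcrd] using this
  have hright : ∀ᶠ v : E in 𝓝 0, crd (cht v) = v := by
    filter_upwards [groupCoord_groupChart (E := E) (G := G)] with v hv
    simp [hcrd, hcht, hv]
  have hleft : ∀ᶠ p in 𝓝 p₀, cht (crd p) = p := by
    have h2 : Tendsto (fun p => p₀⁻¹ * p) (𝓝 p₀) (𝓝 1) := by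
      have : Tendsto (fun p => p₀⁻¹ * p) (𝓝 p₀) (𝓝 (p₀⁻¹ * p₀)) := tendsto_id.const_mul _
      simpa using this
    filter_upwards [h2.eventually (groupChart_groupCoord (E := E) (G := G))] with p hp
    simp [hcrd, hcht, hp]
  have hleft' : ∀ᶠ v : E in 𝓝 0, ∀ᶠ p in 𝓝 (cht v), cht (crd p) = p :=
    hcht0.eventually (eventually_eventually_nhds.2 hleft)
  obtain ⟨R, hR, hball⟩ := Metric.eventually_nhds_iff_ball.1 ((hchts.and hright).and hleft')
  -- The field read in coordinates is cut off so as to be compactly supported, but is unchanged on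
  -- the ball of radius `R / 4`.
  let b : ContDiffBump (0 : E) := ⟨R / 4, R / 2, by linarith, by linarith⟩
  have hf : ContDiff ℝ ∞ (fun v => b v • Xc (cht v)) := by
    rw [contDiff_iff_contDiffAt]
    intro v
    by_cases hv : v ∈ Metric.ball (0 : E) R
    · exact b.contDiff.contDiffAt.smul
        (hXcs.contMDiffAt.comp v (hball v hv).1.1).contDiffAt
    · have h0 : (fun v => b v • Xc (cht v)) =ᶠ[𝓝 v] fun _ => 0 := by
        have h1 : (Metric.closedBall (0 : E) (R / 2))ᶜ ∈ 𝓝 v := by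
          refine Metric.isClosed_closedBall.isOpen_compl.mem_nhds fun h => hv ?_
          exact Metric.closedBall_subset_ball (by linarith) h
        filter_upwards [h1] with w hw
        have : b w = 0 := b.zero_of_le_dist (by
          have := hw
          simp only [mem_compl_iff, Metric.mem_closedBall, not_le] at this
          exact this.le)
        rw [this, zero_smul]
      exact contDiffAt_const.congr_of_eventuallyEq h0
  obtain ⟨ε, hε, Φ, hΦ0, hΦd, hΦs, B, hB⟩ := exists_smooth_flow hf
    (b.hasCompactSupport.smul_right (f' := fun v => Xc (cht v)))
  have hB0 : 0 ≤ B := by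
    have h1 := (norm_nonneg _).trans (hB (ε / 2) ⟨by linarith, by linarith⟩ 0)
    have h2 : 0 < |ε / 2| := by positivity
    nlinarith
  -- In time `ε'` a point moves by at most `R / 8`, so from the ball of radius `R / 8` it stays
  -- where the cut-off equals `1`.
  set ε' := min ε (R / (8 * (B + 1))) with hε'
  have hε'pos : 0 < ε' := by positivity
  have hsub : Ioo (-ε') ε' ⊆ Ioo (-ε) ε :=
    Ioo_subset_Ioo (neg_le_neg (min_le_left _ _)) (min_le_left _ _)
  have hsmall : ∀ v ∈ Metric.ball (0 : E) (R / 8), ∀ t ∈ Ioo (-ε') ε',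
      Φ t v ∈ Metric.ball (0 : E) (R / 4) := by
    intro v hv t ht
    have h1 := hB t (hsub ht) v
    have h2 : |t| < R / (8 * (B + 1)) := (abs_lt.2 ht).trans_le (min_le_right _ _)
    have h3 : B * |t| ≤ R / 8 := by
      calc B * |t| ≤ (B + 1) * (R / (8 * (B + 1))) := by gcongr; linarith
        _ = R / 8 := by field_simp
    rw [mem_ball_zero_iff] at hv ⊢
    calc ‖Φ t v‖ = ‖v + (Φ t v - v)‖ := by congr 1; abel
      _ ≤ ‖v‖ + ‖Φ t v - v‖ := norm_add_le _ _
      _ < R / 4 := by linarith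
  refine ⟨ε', hε'pos, fun t p => cht (Φ t (crd p)), ?_⟩
  filter_upwards [hleft, hcrd0.eventually (Metric.ball_mem_nhds (0 : E) (show 0 < R / 8 by linarith))]
    with p hp hpR
  refine ⟨by rw [hΦ0, hp], fun t ht => HasMFDerivAt.hasMFDerivWithinAt ?_, fun t ht => ?_⟩
  · refine hasMFDerivAt_curve_iff.2 ?_
    have hin := hsmall _ hpR t ht
    obtain ⟨⟨h1, h2⟩, h3⟩ := hball _ (Metric.ball_subset_ball (by linarith) hin)
    have hd := hΦd (crd p) t (hsub ht)
    have hdm : MDifferentiableAt 𝓘(ℝ, ℝ) 𝓘(ℝ, E) (fun s => Φ s (crd p)) t :=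
      hd.differentiableAt.mdifferentiableAt
    have hm : MDifferentiableAt 𝓘(ℝ, E) 𝓘(ℝ, E) cht (Φ t (crd p)) :=
      h1.mdifferentiableAt (by simp)
    refine ⟨MDifferentiableAt.comp (g := cht) t hm hdm, ?_⟩
    refine (tderiv_comp_apply (g := cht) (f := fun s => Φ s (crd p)) hm hdm 1).trans ?_
    rw [tderiv_eq_fderiv, fderiv_apply_one_eq_deriv, hd.deriv]
    have hb1 : b (Φ t (crd p)) = 1 := b.one_of_mem_closedBall (Metric.ball_subset_closedBall hin)
    rw [hb1, one_smul]
    -- The composite `cht ∘ crd` is the identity near this point, so the differential of `cht`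
    -- carries the coordinate expression of `X` back to `X`.
    have h4 : tderiv E E (fun q => cht (crd q)) (cht (Φ t (crd p))) = ContinuousLinearMap.id ℝ E := by
      rw [Filter.EventuallyEq.tderiv_eq (g := fun q => q) h3, tderiv_id]
    have hm' : MDifferentiableAt 𝓘(ℝ, E) 𝓘(ℝ, E) cht (crd (cht (Φ t (crd p)))) := by
      rw [h2]; exact hm
    have h5 : tderiv E E (fun q => cht (crd q)) (cht (Φ t (crd p))) (X (cht (Φ t (crd p)))) =
        X (cht (Φ t (crd p))) := congrArg (fun L : E →L[ℝ] E => L (X (cht (Φ t (crd p))))) h4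
    rw [tderiv_comp_apply hm' hcrds.mdiffAt, h2] at h5
    exact h5
  · have hin := hsmall _ hpR t ht
    obtain ⟨⟨h1, -⟩, -⟩ := hball _ (Metric.ball_subset_ball (by linarith) hin)
    exact ContMDiffAt.comp (g := cht) p h1 ((hΦs t).contMDiff.contMDiffAt.comp p hcrds.contMDiffAt)

end SmoothFields

/-! ### Uniform existence times and one-parameter subgroups. -/

section CompleteFlows

open Filter Topology Asymptotics Bundle

variable {E : Type*} [NormedAddCommGroup E] [NormedSpace ℝ E] [FiniteDimensional ℝ E]
  {F : Type*} [NormedAddCommGroup F] [NormedSpace ℝ F]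
  {G : Type*} [Group G] [TopologicalSpace G] [ChartedSpace E G] [LieGroup 𝓘(ℝ, E) ∞ G]
  [T2Space G]

/-- A smooth vector field has local flows on a uniform time interval around a compact set. -/
theorem IsSmoothField.exists_local_flow_of_isCompact {X : G → E} (hX : IsSmoothField X) {K : Set G}
    (hK : IsCompact K) :
    ∃ ε > 0, ∀ p ∈ K, ∃ Φ : ℝ → G → G, ∀ᶠ q in 𝓝 p, Φ 0 q = q ∧
      IsMIntegralCurveOn (fun t => Φ t q) (modelField X) (Ioo (-ε) ε) ∧
      ∀ t ∈ Ioo (-ε) ε, ContMDiffAt 𝓘(ℝ, E) 𝓘(ℝ, E) ∞ (Φ t) q := by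
  have hmono : ∀ {ε ε' : ℝ} {p : G}, ε' ≤ ε → (∃ Φ : ℝ → G → G, ∀ᶠ q in 𝓝 p, Φ 0 q = q ∧
      IsMIntegralCurveOn (fun t => Φ t q) (modelField X) (Ioo (-ε) ε) ∧
      ∀ t ∈ Ioo (-ε) ε, ContMDiffAt 𝓘(ℝ, E) 𝓘(ℝ, E) ∞ (Φ t) q) →
      ∃ Φ : ℝ → G → G, ∀ᶠ q in 𝓝 p, Φ 0 q = q ∧
      IsMIntegralCurveOn (fun t => Φ t q) (modelField X) (Ioo (-ε') ε') ∧
      ∀ t ∈ Ioo (-ε') ε', ContMDiffAt 𝓘(ℝ, E) 𝓘(ℝ, E) ∞ (Φ t) q := by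
    rintro ε ε' p hle ⟨Φ, hΦ⟩
    have hsub : Ioo (-ε') ε' ⊆ Ioo (-ε) ε := Ioo_subset_Ioo (neg_le_neg hle) hle
    refine ⟨Φ, hΦ.mono fun q hq => ⟨hq.1, hq.2.1.mono hsub, fun t ht => hq.2.2 t (hsub ht)⟩⟩
  refine hK.induction_on (p := fun s => ∃ ε > 0, ∀ p ∈ s, ∃ Φ : ℝ → G → G, ∀ᶠ q in 𝓝 p,
    Φ 0 q = q ∧ IsMIntegralCurveOn (fun t => Φ t q) (modelField X) (Ioo (-ε) ε) ∧
      ∀ t ∈ Ioo (-ε) ε, ContMDiffAt 𝓘(ℝ, E) 𝓘(ℝ, E) ∞ (Φ t) q) ?_ ?_ ?_ ?_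
  · exact ⟨1, one_pos, by simp⟩
  · rintro s t hst ⟨ε, hε, h⟩
    exact ⟨ε, hε, fun p hp => h p (hst hp)⟩
  · rintro s t ⟨ε, hε, h⟩ ⟨ε', hε', h'⟩
    refine ⟨min ε ε', lt_min hε hε', fun p hp => ?_⟩
    rcases hp with hp | hp
    · exact hmono (min_le_left _ _) (h p hp)
    · exact hmono (min_le_right _ _) (h' p hp)
  · intro p _
    obtain ⟨ε, hε, Φ, hΦ⟩ := hX.exists_local_flow p
    exact ⟨{q | ∀ᶠ q' in 𝓝 q, _}, mem_nhdsWithin_of_mem_nhds (eventually_eventually_nhds.2 hΦ),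
      ε, hε, fun q hq => ⟨Φ, hq⟩⟩

theorem IsMIntegralCurveOn.map {X Y : G → E} {γ : ℝ → G} {s : Set ℝ} (hs : IsOpen s)
    (hγ : IsMIntegralCurveOn γ (modelField X) s) {Q : G → G}
    (hQ : ContMDiff 𝓘(ℝ, E) 𝓘(ℝ, E) ∞ Q) (hXY : ∀ p, tderiv E E Q p (X p) = Y (Q p)) :
    IsMIntegralCurveOn (fun t => Q (γ t)) (modelField Y) s := by
  intro t ht
  obtain ⟨h1, h2⟩ := hasMFDerivAt_curve_iff.1 ((hγ t ht).hasMFDerivAt (hs.mem_nhds ht))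
  refine HasMFDerivAt.hasMFDerivWithinAt (hasMFDerivAt_curve_iff.2
    ⟨MDifferentiableAt.comp (g := Q) t hQ.mdiffAt h1, ?_⟩)
  refine (tderiv_comp_apply hQ.mdiffAt h1 1).trans ?_
  rw [h2]
  exact hXY _

theorem IsMIntegralCurve.map {X Y : G → E} {γ : ℝ → G}
    (hγ : IsMIntegralCurve γ (modelField X)) {Q : G → G}
    (hQ : ContMDiff 𝓘(ℝ, E) 𝓘(ℝ, E) ∞ Q) (hXY : ∀ p, tderiv E E Q p (X p) = Y (Q p)) :
    IsMIntegralCurve (fun t => Q (γ t)) (modelField Y) := by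
  rw [isMIntegralCurve_iff_isMIntegralCurveOn] at hγ ⊢
  exact hγ.map isOpen_univ hQ hXY

theorem isMIntegralCurve_iff {X : G → E} {γ : ℝ → G} :
    IsMIntegralCurve γ (modelField X) ↔
      ∀ t, MDifferentiableAt 𝓘(ℝ, ℝ) 𝓘(ℝ, E) γ t ∧ tderiv ℝ E γ t 1 = X (γ t) :=
  forall_congr' fun _ => hasMFDerivAt_curve_iff

theorem IsMIntegralCurve.tderiv_eq {X : G → E} {γ : ℝ → G}
    (hγ : IsMIntegralCurve γ (modelField X)) (t : ℝ) : tderiv ℝ E γ t 1 = X (γ t) :=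
  (isMIntegralCurve_iff.1 hγ t).2

/-! ### One-parameter subgroups -/

/-- Left translations carry an integral curve of the left-invariant field through the identity to
all other points, with the same existence time, so the field is complete. The homomorphism property
follows from uniqueness of integral curves. -/
theorem exists_oneParameterSubgroup (v : E) : ∃ c : ℝ → G, ContMDiff 𝓘(ℝ, ℝ) 𝓘(ℝ, E) ∞ c ∧
    (∀ s t, c (s + t) = c s * c t) ∧ tderiv ℝ E c 0 1 = v := by
  have : IsManifold 𝓘(ℝ, E) 1 G := IsManifold.of_le (n := ∞) (by simp)
  set X : G → E := fun p => tderiv E E (fun z => p * z) 1 v with hXdef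
  have hX : IsSmoothField X := isSmoothField_mul_left contMDiff_const
  have hinv : ∀ a p : G, tderiv E E (fun y => a * y) p (X p) = X (a * p) := by
    intro a p
    have := tderiv_mul_left_mul_left (E := E) a p 1 v
    rwa [mul_one] at this
  obtain ⟨ε, hε, Φ, hΦ⟩ := hX.exists_local_flow 1
  obtain ⟨h0, h1, -⟩ := hΦ.self_of_nhds
  obtain ⟨c, hc0, hc⟩ := exists_isMIntegralCurve_of_isMIntegralCurveOn (v := modelField X)
    (ContMDiff.of_le hX (by simp)) hε (fun x => ⟨fun t => x * Φ t 1, by simp [h0],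
      h1.map isOpen_Ioo (contMDiff_mul_left' x) (hinv x)⟩) (1 : G)
  refine ⟨c, hc.contMDiff hX, fun s t => ?_, ?_⟩
  · have h2 : IsMIntegralCurve (fun r => c (r + s)) (modelField X) := hc.comp_add s
    have h3 := hc.map (contMDiff_mul_left' (c s)) (hinv (c s))
    have := hX.eq_of_isMIntegralCurve (t₀ := 0) h2 h3 (by simp [hc0])
    have := congrFun this t
    simpa [add_comm] using this
  · rw [hc.tderiv_eq, hc0, hXdef]
    simp [tderiv_id]

theorem oneParam_zero {c : ℝ → G} (hadd : ∀ s t, c (s + t) = c s * c t) : c 0 = 1 := by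
  have := hadd 0 0
  simpa using this

theorem oneParam_neg {c : ℝ → G} (hadd : ∀ s t, c (s + t) = c s * c t) (s : ℝ) : c (-s) = (c s)⁻¹ := by
  rw [eq_inv_iff_mul_eq_one, ← hadd, neg_add_cancel, oneParam_zero hadd]

theorem tderiv_comp_add {V N : Type*} [NormedAddCommGroup V] [NormedSpace ℝ V]
    [TopologicalSpace N] [ChartedSpace V N] {γ : ℝ → N} {s a : ℝ}
    (hγ : MDifferentiableAt 𝓘(ℝ, ℝ) 𝓘(ℝ, V) γ (s + a)) :
    tderiv ℝ V (fun r => γ (r + a)) s 1 = tderiv ℝ V γ (s + a) 1 := by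
  have h1 : HasDerivAt (fun r : ℝ => r + a) 1 s := (hasDerivAt_id s).add_const a
  rw [tderiv_comp_apply (f := fun r : ℝ => r + a) hγ h1.differentiableAt.mdifferentiableAt,
    tderiv_eq_fderiv (f := fun r : ℝ => r + a), fderiv_apply_one_eq_deriv, h1.deriv]

theorem tderiv_comp_neg {V N : Type*} [NormedAddCommGroup V] [NormedSpace ℝ V]
    [TopologicalSpace N] [ChartedSpace V N] {γ : ℝ → N} {s : ℝ}
    (hγ : MDifferentiableAt 𝓘(ℝ, ℝ) 𝓘(ℝ, V) γ (-s)) :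
    tderiv ℝ V (fun r => γ (-r)) s 1 = -tderiv ℝ V γ (-s) 1 := by
  have h1 : HasDerivAt (fun r : ℝ => -r) (-1) s := (hasDerivAt_id s).neg
  rw [tderiv_comp_apply (f := fun r : ℝ => -r) hγ h1.differentiableAt.mdifferentiableAt,
    tderiv_eq_fderiv (f := fun r : ℝ => -r), fderiv_apply_one_eq_deriv, h1.deriv, map_neg]

theorem tderiv_oneParam_mul {c : ℝ → G} (hc : ContMDiff 𝓘(ℝ, ℝ) 𝓘(ℝ, E) ∞ c)
    (hadd : ∀ s t, c (s + t) = c s * c t) (s : ℝ) (x : G) :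
    tderiv ℝ E (fun r => c r * x) s 1 =
      tderiv E E (fun y => y * (c s * x)) 1 (tderiv ℝ E c 0 1) := by
  have h0 := oneParam_zero hadd
  have h1 : (fun r => c r * x) = fun r => c (r + -s) * (c s * x) := by
    funext r
    rw [← mul_assoc, ← hadd, neg_add_cancel_right]
  have h2 : ContMDiff 𝓘(ℝ, ℝ) 𝓘(ℝ, E) ∞ (fun r => c (r + -s)) :=
    hc.comp ((contDiff_id.add contDiff_const).contMDiff)
  rw [h1, tderiv_comp_apply (contMDiff_mul_right' (c s * x)).mdiffAt h2.mdiffAt,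
    tderiv_comp_add hc.mdiffAt]
  simp only [add_neg_cancel, h0]

theorem tderiv_mul_oneParam {c : ℝ → G} (hc : ContMDiff 𝓘(ℝ, ℝ) 𝓘(ℝ, E) ∞ c)
    (hadd : ∀ s t, c (s + t) = c s * c t) (s : ℝ) (x : G) :
    tderiv ℝ E (fun r => x * c r) s 1 =
      tderiv E E (fun y => x * c s * y) 1 (tderiv ℝ E c 0 1) := by
  have h0 := oneParam_zero hadd
  have h1 : (fun r => x * c r) = fun r => (x * c s) * c (r + -s) := by
    funext r
    rw [mul_assoc, ← hadd]
    congr 2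
    ring
  have h2 : ContMDiff 𝓘(ℝ, ℝ) 𝓘(ℝ, E) ∞ (fun r => c (r + -s)) :=
    hc.comp ((contDiff_id.add contDiff_const).contMDiff)
  rw [h1, tderiv_comp_apply (contMDiff_mul_left' (x * c s)).mdiffAt h2.mdiffAt,
    tderiv_comp_add hc.mdiffAt]
  simp only [add_neg_cancel, h0]

theorem neg_mem_subgroupLieAlgebra {H : Subgroup G} {ξ : E} (h : ξ ∈ subgroupLieAlgebra E H) :
    -ξ ∈ subgroupLieAlgebra E H := by
  obtain ⟨c, hc, hadd, hmem, hd⟩ := h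
  refine ⟨fun t => c (-t), hc.comp contDiff_neg.contMDiff, fun s t => ?_, fun t => hmem _, ?_⟩
  · change c (-(s + t)) = c (-s) * c (-t)
    rw [neg_add, hadd]
  · have h1 : MDifferentiableAt 𝓘(ℝ, ℝ) 𝓘(ℝ, E) c (-0) := hc.mdiffAt
    refine (tderiv_comp_neg h1).trans ?_
    rw [neg_zero]
    exact congrArg Neg.neg hd

theorem tderiv_mul_curves {γ δ : ℝ → G} {s : ℝ} (hγ : MDifferentiableAt 𝓘(ℝ, ℝ) 𝓘(ℝ, E) γ s)
    (hδ : MDifferentiableAt 𝓘(ℝ, ℝ) 𝓘(ℝ, E) δ s) :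
    tderiv ℝ E (fun r => γ r * δ r) s 1 =
      tderiv E E (fun y => y * δ s) (γ s) (tderiv ℝ E γ s 1) +
        tderiv E E (fun y => γ s * y) (δ s) (tderiv ℝ E δ s 1) := by
  have h1 : MDifferentiableAt (𝓘(ℝ, E).prod 𝓘(ℝ, E)) 𝓘(ℝ, E) (fun x : G × G => x.1 * x.2)
      (γ s, δ s) := (contMDiff_mul 𝓘(ℝ, E) (∞ : WithTop ℕ∞) (G := G)).mdifferentiableAt (by simp)
  have h2 := mfderiv_comp s (g := fun x : G × G => x.1 * x.2) (f := fun r => (γ r, δ r)) h1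
    (hγ.prodMk hδ)
  have h3 := mfderiv_prodMk hγ hδ
  have h4 := mfderiv_prod_eq_add_apply (v := (tderiv ℝ E γ s 1, tderiv ℝ E δ s 1)) h1
  have h5 : tderiv ℝ E (fun r => γ r * δ r) s 1 =
      mfderiv (𝓘(ℝ, E).prod 𝓘(ℝ, E)) 𝓘(ℝ, E) (fun x : G × G => x.1 * x.2) (γ s, δ s)
        (mfderiv 𝓘(ℝ, ℝ) (𝓘(ℝ, E).prod 𝓘(ℝ, E)) (fun r => (γ r, δ r)) s (1 : ℝ)) :=
    congrArg (fun L : ℝ →L[ℝ] E => L 1) h2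
  refine h5.trans ?_
  rw [h3]
  exact h4

end CompleteFlows

/-! ### Completeness of vertical, equivariant perturbations of a right-invariant field. -/

section PerturbedFlows

open Filter Topology Asymptotics Bundle

variable {E : Type*} [NormedAddCommGroup E] [NormedSpace ℝ E] [FiniteDimensional ℝ E]
  {G : Type*} [Group G] [TopologicalSpace G] [ChartedSpace E G] [LieGroup 𝓘(ℝ, E) ∞ G]
  [T2Space G]

theorem isLittleO_sub_sq (s : ℝ) : (fun t : ℝ => (t - s) ^ 2) =o[𝓝[>] s] fun t => t - s := by
  have h0 : Tendsto (fun t : ℝ => t - s) (𝓝[>] s) (𝓝 0) := by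
    have : Tendsto (fun t : ℝ => t - s) (𝓝 s) (𝓝 (s - s)) := tendsto_id.sub_const s
    rw [sub_self] at this
    exact this.mono_left nhdsWithin_le_nhds
  have := ((isLittleO_one_iff ℝ).2 h0).mul_isBigO (isBigO_refl (fun t : ℝ => t - s) (𝓝[>] s))
  exact this.congr (fun t => by ring) (fun t => by rw [one_mul])

/-- A curve which moves by `A γ` up to a vector tangent to the cosets of `H` stays over the
translates by the one-parameter group of `A`. -/
theorem mem_of_tderiv_eq_sub {H : Subgroup G} (hH : IsClosed (H : Set G)) {c γ : ℝ → G} {b : ℝ}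
    (hc : ContMDiff 𝓘(ℝ, ℝ) 𝓘(ℝ, E) ∞ c) (hadd : ∀ s t, c (s + t) = c s * c t) (hb : 0 ≤ b)
    (hγ : ∀ t ∈ Icc 0 b, ContMDiffAt 𝓘(ℝ, ℝ) 𝓘(ℝ, E) ∞ γ t)
    (hd : ∀ t ∈ Icc 0 b, ∃ ζ : E, ζ ∈ subgroupLieAlgebra E H ∧ tderiv ℝ E γ t 1 =
      tderiv E E (fun y => y * γ t) 1 (tderiv ℝ E c 0 1) - tderiv E E (fun y => γ t * y) 1 ζ) :
    (c b * γ 0)⁻¹ * γ b ∈ H := by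
  have : IsTopologicalGroup G := topologicalGroup_of_lieGroup 𝓘(ℝ, E) ∞
  have hc0 := oneParam_zero hadd
  set p : ℝ → G := fun t => (c t * γ 0)⁻¹ * γ t with hp
  have hcont : ContinuousOn p (Icc 0 b) := by
    have h1 : ContinuousOn γ (Icc 0 b) := fun t ht => (hγ t ht).continuousAt.continuousWithinAt
    have h2 : Continuous fun t => (c t * γ 0)⁻¹ := (hc.continuous.mul_const _).inv
    exact h2.continuousOn.mul h1
  have key := inv_mul_mem_of_hasJet (E := E) hH hcont (fun s hs => ?_) b ⟨hb, le_rfl⟩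
  · simpa [hp, hc0] using key
  have hs' : s ∈ Icc 0 b := ⟨hs.1, hs.2.le⟩
  obtain ⟨ζ, hζ, hdζ⟩ := hd s hs'
  -- This is the increment of `p` written as a smooth curve, `(p s)⁻¹ * p t = k (t - s)`. In its
  -- velocity the right-invariant parts cancel and `-ζ ∈ 𝔥` remains.
  set k : ℝ → G := fun r => (γ s)⁻¹ * (c (-r) * γ (r + s)) with hk
  have hk0 : k 0 = 1 := by simp [hk, hc0]
  have hγs : ContMDiffAt 𝓘(ℝ, ℝ) 𝓘(ℝ, E) ∞ (fun r => γ (r + s)) 0 := by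
    refine ContMDiffAt.comp (g := γ) (0 : ℝ) ?_ ((contDiff_id.add contDiff_const).contMDiff _)
    simpa using hγ s hs'
  have hcn : ContMDiff 𝓘(ℝ, ℝ) 𝓘(ℝ, E) ∞ (fun r => c (-r)) := hc.comp contDiff_neg.contMDiff
  have hks : ContMDiffAt 𝓘(ℝ, ℝ) 𝓘(ℝ, E) ∞ k 0 :=
    (contMDiff_mul_left' _).contMDiffAt.comp (0 : ℝ) (hcn.contMDiffAt.mul hγs)
  have hkd : tderiv ℝ E k 0 1 = -ζ := by
    have h1 : tderiv ℝ E (fun r => c (-r) * γ (r + s)) 0 1 =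
        -tderiv E E (fun y => γ s * y) 1 ζ := by
      rw [tderiv_mul_curves hcn.mdiffAt (hγs.mdifferentiableAt (by simp)),
        tderiv_comp_neg hc.mdiffAt, tderiv_comp_add (by
          rw [zero_add]; exact (hγ s hs').mdifferentiableAt (by simp))]
      simp only [neg_zero, hc0, zero_add, one_mul, tderiv_id, hdζ, map_neg]
      simp
      abel
    rw [hk, tderiv_comp_apply (f := fun r => c (-r) * γ (r + s)) (contMDiff_mul_left' _).mdiffAt
      ((hcn.contMDiffAt.mul hγs).mdifferentiableAt (by simp)), h1, map_neg]
    simp only [neg_zero, hc0, zero_add, one_mul]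
    have h2 := tderiv_mul_left_mul_left (E := E) (γ s)⁻¹ (γ s) 1 ζ
    rw [mul_one] at h2
    rw [h2]
    simp [tderiv_id]
  have hz0 : Tendsto (fun t : ℝ => t - s) (𝓝[>] s) (𝓝 0) := by
    have : Tendsto (fun t : ℝ => t - s) (𝓝 s) (𝓝 (s - s)) := tendsto_id.sub_const s
    rw [sub_self] at this
    exact this.mono_left nhdsWithin_le_nhds
  refine ⟨fun t => t - s, fun t => t - s, -ζ, isLittleO_sub_sq s, isBigO_refl _ _, hz0,
    neg_mem_subgroupLieAlgebra hζ, ?_⟩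
  have hj := HasJet.of_curve hks hk0 (isLittleO_sub_sq s) (isBigO_refl _ _) hz0
  rw [hkd] at hj
  refine hj.congr (Eventually.of_forall fun t => ?_)
  simp only [hk, hp, neg_sub, sub_add_cancel]
  have : c (s - t) = c s * (c t)⁻¹ := by rw [← oneParam_neg hadd, ← hadd, sub_eq_add_neg]
  rw [this]
  group

/-- The smooth vector field `X` is invariant under the right translations by elements of `H`, and
differs from the right-invariant vector field `p ↦ A p` by vectors tangent to the cosets of `H`. -/
structure IsVerticalPerturbation (H : Subgroup G) (A : E) (X : G → E) : Prop where
  smooth : IsSmoothField X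
  vertical : ∀ p, ∃ ζ : E, ζ ∈ subgroupLieAlgebra E H ∧
    X p = tderiv E E (fun y => y * p) 1 A - tderiv E E (fun y => p * y) 1 ζ
  equivariant : ∀ p, ∀ a ∈ H, tderiv E E (fun y => y * a) p (X p) = X (p * a)

variable {H : Subgroup G} {A : E} {X : G → E}

/-- For `t ≤ 0` time is reversed: the reversed curve is of the same type for the generator `-A`, and
`𝔥` is stable under negation. -/
theorem IsVerticalPerturbation.mem (hX : IsVerticalPerturbation H A X)
    (hH : IsClosed (H : Set G)) {c γ : ℝ → G} (hc : ContMDiff 𝓘(ℝ, ℝ) 𝓘(ℝ, E) ∞ c)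
    (hadd : ∀ s t, c (s + t) = c s * c t) (hcA : tderiv ℝ E c 0 1 = A) {a : ℝ}
    (hγ : IsMIntegralCurveOn γ (modelField X) (Ioo (-a) a)) {t : ℝ} (ht : t ∈ Ioo (-a) a) :
    (c t * γ 0)⁻¹ * γ t ∈ H := by
  have hs := fun r hr => hγ.contMDiffAt hX.smooth isOpen_Ioo (t := r) hr
  have hd : ∀ r ∈ Ioo (-a) a, tderiv ℝ E γ r 1 = X (γ r) := fun r hr =>
    (hasMFDerivAt_curve_iff.1 ((hγ r hr).hasMFDerivAt (Ioo_mem_nhds hr.1 hr.2))).2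
  rcases le_total 0 t with h0 | h0
  · refine mem_of_tderiv_eq_sub (E := E) hH hc hadd h0 (fun r hr => hs r ?_) fun r hr => ?_
    · exact ⟨by linarith [hr.1, ht.1, ht.2], hr.2.trans_lt ht.2⟩
    · obtain ⟨ζ, hζ, h⟩ := hX.vertical (γ r)
      refine ⟨ζ, hζ, ?_⟩
      rw [hcA, ← h]
      exact hd r ⟨by linarith [hr.1, ht.1, ht.2], hr.2.trans_lt ht.2⟩
  · have hmem : ∀ r ∈ Icc 0 (-t), -r ∈ Ioo (-a) a := fun r hr =>
      ⟨by linarith [hr.2, ht.1], by linarith [hr.1, ht.1, ht.2]⟩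
    have key := mem_of_tderiv_eq_sub (E := E) (γ := fun r => γ (-r)) (c := fun r => c (-r)) (b := -t) hH
      (hc.comp contDiff_neg.contMDiff) (fun s r => by rw [← hadd, neg_add]) (by linarith)
      (fun r hr => ContMDiffAt.comp (g := γ) r (hs _ (hmem r hr)) (contDiff_neg.contMDiff _))
      (fun r hr => ?_)
    · simpa using key
    · obtain ⟨ζ, hζ, h⟩ := hX.vertical (γ (-r))
      refine ⟨-ζ, neg_mem_subgroupLieAlgebra hζ, ?_⟩
      rw [tderiv_comp_neg hc.mdiffAt, tderiv_comp_neg ((hs _ (hmem r hr)).mdifferentiableAt (by simp)),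
        neg_zero, hcA, hd _ (hmem r hr), h, map_neg, map_neg]
      abel

theorem IsSmoothField.exists_extension (hX : IsSmoothField X) {γ σ : ℝ → G} {a b t₁ ε : ℝ}
    (hγ : IsMIntegralCurveOn γ (modelField X) (Ioo a b))
    (hσ : IsMIntegralCurveOn σ (modelField X) (Ioo (-ε) ε)) (ht₁ : t₁ ∈ Ioo a b) (hε : 0 < ε)
    (h : γ t₁ = σ 0) {a' b' : ℝ} (ha' : min a (t₁ - ε) ≤ a') (hb' : b' ≤ max b (t₁ + ε))
    (h0 : (0 : ℝ) ∈ Ioo a b) :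
    ∃ δ : ℝ → G, δ 0 = γ 0 ∧ IsMIntegralCurveOn δ (modelField X) (Ioo a' b') := by
  have : IsManifold 𝓘(ℝ, E) 1 G := IsManifold.of_le (n := ∞) (by simp)
  have h1 : IsMIntegralCurveOn (fun t => σ (t + -t₁)) (modelField X) (Ioo (t₁ - ε) (t₁ + ε)) :=
    (hσ.comp_add (-t₁)).mono fun t ht => by
      simp only [mem_ofPred_eq, mem_Ioo] at ht ⊢
      constructor <;> linarith [ht.1, ht.2]
  refine ⟨_, ?_, (isMIntegralCurveOn_piecewise (ContMDiff.of_le hX (by simp)) hγ h1 (t₀ := t₁)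
    ⟨ht₁, by constructor <;> linarith⟩ (by simp [h])).mono fun t ht => ?_⟩
  · rw [piecewise_eq_of_mem _ _ _ h0]
  · rcases lt_trichotomy t t₁ with h2 | h2 | h2
    · rcases min_lt_iff.1 (ha'.trans_lt ht.1) with h3 | h3
      · exact Or.inl ⟨h3, h2.trans ht₁.2⟩
      · exact Or.inr ⟨h3, by linarith⟩
    · exact Or.inl (h2 ▸ ht₁)
    · rcases lt_max_iff.1 (ht.2.trans_le hb') with h3 | h3
      · exact Or.inl ⟨ht₁.1.trans h2, h3⟩
      · exact Or.inr ⟨by linarith, h3⟩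

/-- On `[-R, R]` a solution from `x` can only visit the cosets `c s x H`. The points `c s x` form a
compact arc, with a uniform existence time for local solutions, and right translation by `H` spreads
this time over the whole cosets. A solution can hence be prolonged by a fixed amount until it covers
the interval. -/
theorem IsVerticalPerturbation.exists_isMIntegralCurve (hX : IsVerticalPerturbation H A X)
    (hH : IsClosed (H : Set G)) (x : G) :
    ∃ γ : ℝ → G, γ 0 = x ∧ IsMIntegralCurve γ (modelField X) := by
  have : IsManifold 𝓘(ℝ, E) 1 G := IsManifold.of_le (n := ∞) (by simp)
  have : IsTopologicalGroup G := topologicalGroup_of_lieGroup 𝓘(ℝ, E) ∞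
  obtain ⟨c, hc, hadd, hcA⟩ := exists_oneParameterSubgroup (G := G) A
  refine (exists_isMIntegralCurve_iff_exists_isMIntegralCurveOn_Ioo
    (ContMDiff.of_le hX.smooth (by simp)) x).2 fun R' => ?_
  obtain ⟨R, hR, hR'⟩ : ∃ R > 0, R' ≤ R := ⟨max R' 1, by positivity, le_max_left _ _⟩
  suffices h : ∃ γ : ℝ → G, γ 0 = x ∧ IsMIntegralCurveOn γ (modelField X) (Ioo (-R) R) by
    obtain ⟨γ, h0, h1⟩ := h
    exact ⟨γ, h0, h1.mono (Ioo_subset_Ioo (neg_le_neg hR') hR')⟩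
  have hK : IsCompact ((fun s => c s * x) '' Icc (-R) R) :=
    isCompact_Icc.image (hc.continuous.mul_const x)
  obtain ⟨ε₀, hε₀, hflow⟩ := hX.smooth.exists_local_flow_of_isCompact hK
  set ε := min ε₀ R with hε
  have hεpos : 0 < ε := lt_min hε₀ hR
  have hstart : ∀ s ∈ Icc (-R) R, ∀ q : G, (c s * x)⁻¹ * q ∈ H → ∃ σ : ℝ → G, σ 0 = q ∧
      IsMIntegralCurveOn σ (modelField X) (Ioo (-ε) ε) := by
    intro s hs q hq
    obtain ⟨Φ, hΦ⟩ := hflow _ ⟨s, hs, rfl⟩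
    obtain ⟨h0, h1, -⟩ := hΦ.self_of_nhds
    have h2 := h1.map isOpen_Ioo (contMDiff_mul_right' ((c s * x)⁻¹ * q))
      (fun p => hX.equivariant p _ hq)
    refine ⟨_, ?_, h2.mono (Ioo_subset_Ioo (neg_le_neg (min_le_left _ _)) (min_le_left _ _))⟩
    simp only [h0]
    group
  -- The half-length starts at `ε` and grows by at most `ε / 2`: a piece of radius `ε` is glued at
  -- distance `ε / 2` inside each end, first on the right and then on the left, and growth stops at
  -- `R`.
  set b : ℕ → ℝ := fun n => min (ε / 2 * (n + 2)) R with hb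
  have hbpos : ∀ n, ε ≤ b n := by
    intro n
    refine le_min ?_ (min_le_right _ _)
    have : (0 : ℝ) ≤ n := n.cast_nonneg
    nlinarith
  have hbR : ∀ n, b n ≤ R := fun n => min_le_right _ _
  have hbs : ∀ n, b (n + 1) ≤ b n + ε / 2 := by
    intro n
    simp only [hb]
    push_cast
    rcases min_cases (ε / 2 * ((n : ℝ) + 2)) R with ⟨h, _⟩ | ⟨h, _⟩
    · rw [h]
      exact (min_le_left _ _).trans (by linarith)
    · rw [h]
      exact (min_le_right _ _).trans (by linarith)
  have key : ∀ n, ∃ γ : ℝ → G, γ 0 = x ∧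
      IsMIntegralCurveOn γ (modelField X) (Ioo (-b n) (b n)) := by
    intro n
    induction n with
    | zero =>
      obtain ⟨σ, h0, h1⟩ := hstart 0 ⟨by linarith, hR.le⟩ x (by simp [oneParam_zero hadd])
      have : b 0 ≤ ε := (min_le_left _ _).trans (by simp)
      exact ⟨σ, h0, h1.mono (Ioo_subset_Ioo (neg_le_neg this) this)⟩
    | succ n ih =>
      obtain ⟨γ, hγ0, hγ⟩ := ih
      have hbn := hbpos n
      have h0 : (0 : ℝ) ∈ Ioo (-b n) (b n) := ⟨by linarith, by linarith⟩
      have hpos : b n - ε / 2 ∈ Ioo (-b n) (b n) := ⟨by linarith, by linarith⟩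
      have hneg : -(b n - ε / 2) ∈ Ioo (-b n) (b n) := ⟨by linarith, by linarith⟩
      have hin : ∀ t ∈ Ioo (-b n) (b n), t ∈ Icc (-R) R := fun t ht =>
        ⟨by linarith [ht.1, hbR n], by linarith [ht.2, hbR n]⟩
      obtain ⟨σ, hσ0, hσ⟩ := hstart _ (hin _ hpos) (γ (b n - ε / 2)) (by
        rw [← hγ0]; exact hX.mem hH hc hadd hcA hγ hpos)
      obtain ⟨σ', hσ'0, hσ'⟩ := hstart _ (hin _ hneg) (γ (-(b n - ε / 2))) (by
        rw [← hγ0]; exact hX.mem hH hc hadd hcA hγ hneg)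
      obtain ⟨δ, hδ0, hδ⟩ := hX.smooth.exists_extension hγ hσ hpos hεpos hσ0.symm (a' := -b n)
        (b' := b (n + 1)) (min_le_left _ _) ((hbs n).trans ((by linarith : _ ≤ b n - ε / 2 + ε).trans
          (le_max_right _ _))) h0
      have hbpos' := hbpos (n + 1)
      have hle : b n ≤ b (n + 1) := by
        simp only [hb]
        push_cast
        gcongr
        linarith
      have heq : δ (-(b n - ε / 2)) = σ' 0 := by
        rw [hσ'0]
        exact hX.smooth.eqOn_Ioo h0 (hδ.mono (Ioo_subset_Ioo le_rfl hle)) hγ hδ0 hneg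
      obtain ⟨δ', hδ'0, hδ'⟩ := hX.smooth.exists_extension hδ hσ' (t₁ := -(b n - ε / 2))
        ⟨hneg.1, hneg.2.trans_le hle⟩ hεpos heq (a' := -b (n + 1)) (b' := b (n + 1))
        ((min_le_right _ _).trans (by linarith [hbs n])) (le_max_left _ _) ⟨h0.1, by linarith⟩
      exact ⟨δ', by rw [hδ'0, hδ0, hγ0], hδ'⟩
  obtain ⟨n, hn⟩ := exists_nat_gt (R / (ε / 2))
  have hbn : b n = R := by
    refine min_eq_right ?_
    rw [div_lt_iff₀ (by positivity)] at hn
    nlinarith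
  obtain ⟨γ, h0, h1⟩ := key n
  rw [hbn] at h1
  exact ⟨γ, h0, h1⟩

/-- The flow of a vertical perturbation of a right-invariant vector field. -/
theorem IsVerticalPerturbation.exists_flow (hX : IsVerticalPerturbation H A X)
    (hH : IsClosed (H : Set G)) :
    ∃ Ψ : ℝ → G → G, (∀ x, Ψ 0 x = x) ∧ (∀ x, IsMIntegralCurve (fun t => Ψ t x) (modelField X)) ∧
      (∀ s t x, Ψ (s + t) x = Ψ s (Ψ t x)) ∧
      (∀ t, ContMDiff 𝓘(ℝ, E) 𝓘(ℝ, E) ∞ (Ψ t)) ∧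
      (∀ t x, ∀ a ∈ H, Ψ t (x * a) = Ψ t x * a) ∧
      ∀ c : ℝ → G, ContMDiff 𝓘(ℝ, ℝ) 𝓘(ℝ, E) ∞ c → (∀ s t, c (s + t) = c s * c t) →
        tderiv ℝ E c 0 1 = A → ∀ t x, (c t * x)⁻¹ * Ψ t x ∈ H := by
  choose γ hγ0 hγ using hX.exists_isMIntegralCurve hH
  have hgroup : ∀ s t x, γ x (s + t) = γ (γ x t) s := by
    intro s t x
    have h1 : IsMIntegralCurve (fun r => γ x (r + t)) (modelField X) := (hγ x).comp_add t
    exact congrFun (hX.smooth.eq_of_isMIntegralCurve (t₀ := 0) h1 (hγ _) (by simp [hγ0])) s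
  refine ⟨fun t x => γ x t, hγ0, hγ, hgroup, fun t x => ?_, fun t x a ha => ?_, ?_⟩
  · have hK : IsCompact ((fun s => γ x s) '' uIcc 0 t) := isCompact_uIcc.image (hγ x).continuous
    obtain ⟨ε, hε, hflow⟩ := hX.smooth.exists_local_flow_of_isCompact hK
    have hloc : ∀ s ∈ uIcc 0 t, ∀ r ∈ Ioo (-ε) ε,
        ContMDiffAt 𝓘(ℝ, E) 𝓘(ℝ, E) ∞ (fun y => γ y r) (γ x s) := by
      intro s hs r hr
      obtain ⟨Φ, hΦ⟩ := hflow _ ⟨s, hs, rfl⟩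
      refine (hΦ.self_of_nhds.2.2 r hr).congr_of_eventuallyEq ?_
      filter_upwards [hΦ] with q hq
      exact hX.smooth.eqOn_Ioo (t₀ := 0) ⟨by linarith, hε⟩ ((hγ q).isMIntegralCurveOn _) hq.2.1
        (by rw [hγ0, hq.1]) hr
    -- The time-`t` map is the `N`-fold composite of the time-`t / N` map, each factor being smooth
    -- near the orbit by the local flows.
    obtain ⟨N, hN⟩ := exists_nat_gt (|t| / ε)
    have hN0 : (0 : ℝ) < N := (by positivity : 0 ≤ |t| / ε).trans_lt hN
    have hr : t / N ∈ Ioo (-ε) ε := by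
      rw [mem_Ioo, ← abs_lt, abs_div, abs_of_pos hN0, div_lt_iff₀ hN0]
      rwa [div_lt_iff₀ hε, mul_comm] at hN
    have key : ∀ n : ℕ, n ≤ N → ContMDiffAt 𝓘(ℝ, E) 𝓘(ℝ, E) ∞ (fun y => γ y (n * (t / N))) x := by
      intro n
      induction n with
      | zero =>
        intro _
        simp only [Nat.cast_zero, zero_mul, hγ0]
        exact contMDiffAt_id
      | succ n ih =>
        intro hn
        have hmem : (n : ℝ) * (t / N) ∈ uIcc 0 t := by
          have h1 : (n : ℝ) * (t / N) = (n / N : ℝ) * t := by ring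
          have h2 : (n / N : ℝ) ∈ Icc (0 : ℝ) 1 := by
            refine ⟨by positivity, (div_le_one hN0).2 ?_⟩
            exact_mod_cast (Nat.le_succ n).trans hn
          rw [h1, mem_uIcc]
          rcases le_total 0 t with ht | ht
          · exact Or.inl ⟨mul_nonneg h2.1 ht, by nlinarith [h2.2]⟩
          · exact Or.inr ⟨by nlinarith [h2.2], mul_nonpos_of_nonneg_of_nonpos h2.1 ht⟩
        have h3 := ContMDiffAt.comp (g := fun y => γ y (t / N)) x (hloc _ hmem _ hr)
          (ih ((Nat.le_succ n).trans hn))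
        refine h3.congr_of_eventuallyEq (Eventually.of_forall fun y => ?_)
        simp only [Function.comp_apply]
        rw [← hgroup]
        congr 1
        push_cast
        ring
    have := key N le_rfl
    rwa [mul_div_cancel₀ _ hN0.ne'] at this
  · have h1 := (hγ x).map (contMDiff_mul_right' a) (fun p => hX.equivariant p a ha)
    exact congrFun (hX.smooth.eq_of_isMIntegralCurve (t₀ := 0) (hγ (x * a)) h1
      (by simp [hγ0])) t
  · intro c hc hadd hcA t x
    have := hX.mem hH hc hadd hcA ((hγ x).isMIntegralCurveOn (Ioo (-(|t| + 1)) (|t| + 1))) (t := t)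
      (by rw [mem_Ioo, ← abs_lt]; linarith)
    rwa [hγ0] at this

end PerturbedFlows

/-! ### Connection forms and the horizontal field. -/

section Connections

open Filter Topology Asymptotics Bundle

variable {E : Type*} [NormedAddCommGroup E] [NormedSpace ℝ E] [FiniteDimensional ℝ E]
  {G : Type*} [Group G] [TopologicalSpace G] [ChartedSpace E G] [LieGroup 𝓘(ℝ, E) ∞ G]
  [T2Space G]
  {H : Subgroup G}
  {θ : ∀ x : G, TangentSpace 𝓘(ℝ, E) x →L[ℝ] GroupLieAlgebra 𝓘(ℝ, E) G}

/-- A Lie algebra valued form, with the tangent spaces identified with the model space. -/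
def modelForm (θ : ∀ x : G, TangentSpace 𝓘(ℝ, E) x →L[ℝ] GroupLieAlgebra 𝓘(ℝ, E) G) (p : G) :
    E →L[ℝ] E := θ p

/-- A Lie algebra valued form read in the left trivialization of the tangent bundle. -/
noncomputable def leftForm
    (θ : ∀ x : G, TangentSpace 𝓘(ℝ, E) x →L[ℝ] GroupLieAlgebra 𝓘(ℝ, E) G) (p : G) : E →L[ℝ] E :=
  (modelForm θ p).comp (tderiv E E (fun y : G => p * y) 1)

theorem leftForm_apply (p : G) (v : E) :
    leftForm θ p v = modelForm θ p (tderiv E E (fun y : G => p * y) 1 v) := rfl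

theorem IsConnectionForm.leftForm_eq (hconn : IsConnectionForm H θ) {ξ : E}
    (hξ : ξ ∈ subgroupLieAlgebra E H) (p : G) : leftForm θ p ξ = ξ :=
  hconn.calibrated ξ hξ p

theorem IsConnectionForm.modelForm_mem (hconn : IsConnectionForm H θ) (p : G) (v : E) :
    modelForm θ p v ∈ subgroupLieAlgebra E H :=
  hconn.mem p v

theorem IsConnectionForm.modelForm_mul (hconn : IsConnectionForm H θ) (p : G) {a : G} (ha : a ∈ H)
    (v : E) :
    modelForm θ (p * a) (tderiv E E (fun y : G => y * a) p v) =
      modelAd E a⁻¹ (modelForm θ p v) :=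
  hconn.equivariant p v a ha

/-- Differentiating `p y a = p a (a⁻¹ y a)` at `y = 1`. -/
theorem tderiv_mul_right_mul_left (p a : G) (v : E) :
    tderiv E E (fun y : G => y * a) p (tderiv E E (fun y : G => p * y) 1 v) =
      tderiv E E (fun y : G => p * a * y) 1 (modelAd E a⁻¹ v) := by
  have h1 := tderiv_comp_apply (f := fun y : G => p * y) (g := fun y : G => y * a) (p := (1 : G))
    (contMDiff_mul_right' (E := E) a).mdiffAt (contMDiff_mul_left' p).mdiffAt v
  have h2 := tderiv_comp_apply (f := fun y : G => a⁻¹ * y * a⁻¹⁻¹) (g := fun y : G => p * a * y)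
    (p := (1 : G)) (contMDiff_mul_left' (E := E) (p * a)).mdiffAt (contMDiff_conj a⁻¹ a⁻¹⁻¹).mdiffAt v
  rw [mul_one] at h1
  rw [modelAd, ← h1]
  have h3 : a⁻¹ * (1 : G) * a⁻¹⁻¹ = 1 := by simp
  rw [h3] at h2
  rw [← h2]
  congr 2
  funext y
  group

theorem tderiv_mul_right_mul_right (p a : G) (v : E) :
    tderiv E E (fun y : G => y * a) p (tderiv E E (fun y : G => y * p) 1 v) =
      tderiv E E (fun y : G => y * (p * a)) 1 v := by
  have h1 := tderiv_comp_apply (f := fun y : G => y * p) (g := fun y : G => y * a) (p := (1 : G))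
    (contMDiff_mul_right' (E := E) a).mdiffAt (contMDiff_mul_right' p).mdiffAt v
  rw [one_mul] at h1
  rw [← h1]
  simp only [mul_assoc]

theorem tderiv_mul_left_mul_left_one (a p : G) (v : E) :
    tderiv E E (fun y : G => a * y) p (tderiv E E (fun y : G => p * y) 1 v) =
      tderiv E E (fun y : G => a * p * y) 1 v := by
  have := tderiv_mul_left_mul_left a p 1 v
  rwa [mul_one] at this

theorem tderiv_inv_mul_mul (p : G) (v : E) :
    tderiv E E (fun y : G => p⁻¹ * y) p (tderiv E E (fun y : G => p * y) 1 v) = v := by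
  rw [tderiv_mul_left_mul_left_one, inv_mul_cancel]
  simp [tderiv_id]

theorem tderiv_mul_inv_mul (p : G) (v : E) :
    tderiv E E (fun y : G => p * y) 1 (tderiv E E (fun y : G => p⁻¹ * y) p v) = v := by
  have := tderiv_mul_left_mul_left (E := E) p p⁻¹ p v
  rw [inv_mul_cancel, mul_inv_cancel] at this
  rw [this]
  simp [tderiv_id]

theorem IsConnectionForm.leftForm_mul (hconn : IsConnectionForm H θ) (p : G) {a : G} (ha : a ∈ H)
    (v : E) : leftForm θ (p * a) (modelAd E a⁻¹ v) = modelAd E a⁻¹ (leftForm θ p v) := by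
  rw [leftForm_apply, leftForm_apply, ← tderiv_mul_right_mul_left, hconn.modelForm_mul p ha]

/-- The form at the identity maps into `𝔥` and fixes `𝔥`. So `𝔥` is the fixed space of a linear map,
which gives its linear structure without the closed subgroup theorem. -/
theorem IsConnectionForm.mem_subgroupLieAlgebra_iff (hconn : IsConnectionForm H θ) {ξ : E} :
    ξ ∈ subgroupLieAlgebra E H ↔ leftForm θ 1 ξ = ξ :=
  ⟨fun h => hconn.leftForm_eq h 1, fun h => by rw [← h]; exact hconn.modelForm_mem _ _⟩

theorem IsConnectionForm.smul_mem (hconn : IsConnectionForm H θ) {ξ : E} (r : ℝ)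
    (h : ξ ∈ subgroupLieAlgebra E H) : r • ξ ∈ subgroupLieAlgebra E H := by
  rw [hconn.mem_subgroupLieAlgebra_iff] at h ⊢
  rw [map_smul, h]

theorem IsConnectionForm.mem_verticalSpace_iff (hconn : IsConnectionForm H θ) {x : G} {v : E} :
    v ∈ (verticalSpace H x : Submodule ℝ (TangentSpace 𝓘(ℝ, E) x)) ↔
      ∃ ξ : E, ξ ∈ subgroupLieAlgebra E H ∧ v = tderiv E E (fun y => x * y) 1 ξ := by
  constructor
  · intro h
    refine Submodule.span_induction (p := fun (v : E) _ => ∃ ξ : E, ξ ∈ subgroupLieAlgebra E H ∧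
      v = tderiv E E (fun y => x * y) 1 ξ) ?_ ?_ ?_ ?_ h
    · rintro _ ⟨ξ, hξ, rfl⟩
      exact ⟨ξ, hξ, rfl⟩
    · exact ⟨0, hconn.mem_subgroupLieAlgebra_iff.2 (map_zero _), (map_zero _).symm⟩
    · rintro _ _ _ _ ⟨ξ, hξ, rfl⟩ ⟨ζ, hζ, rfl⟩
      refine ⟨ξ + ζ, ?_, (map_add _ _ _).symm⟩
      rw [hconn.mem_subgroupLieAlgebra_iff] at hξ hζ ⊢
      rw [map_add, hξ, hζ]
    · rintro r _ _ ⟨ξ, hξ, rfl⟩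
      exact ⟨r • ξ, hconn.smul_mem r hξ, (map_smul _ _ _).symm⟩
  · rintro ⟨ξ, hξ, rfl⟩
    exact Submodule.subset_span ⟨ξ, hξ, rfl⟩

theorem mem_horizontalSpace_iff {x : G} {v : E} :
    v ∈ (horizontalSpace θ x : Submodule ℝ (TangentSpace 𝓘(ℝ, E) x)) ↔ modelForm θ x v = 0 :=
  Iff.rfl

/-- The horizontal part of the right-invariant vector field `p ↦ A p`. -/
noncomputable def horizontalField
    (θ : ∀ x : G, TangentSpace 𝓘(ℝ, E) x →L[ℝ] GroupLieAlgebra 𝓘(ℝ, E) G) (A : E) (p : G) : E :=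
  tderiv E E (fun y => y * p) 1 A -
    tderiv E E (fun y => p * y) 1 (modelForm θ p (tderiv E E (fun y => y * p) 1 A))

theorem IsConnectionForm.modelForm_horizontalField (hconn : IsConnectionForm H θ) (A : E) (p : G) :
    modelForm θ p (horizontalField θ A p) = 0 := by
  rw [horizontalField, map_sub, ← leftForm_apply, hconn.leftForm_eq (hconn.modelForm_mem _ _),
    sub_self]

theorem IsConnectionForm.isVerticalPerturbation (hconn : IsConnectionForm H θ) (A : E) :
    IsVerticalPerturbation H A (horizontalField θ A) where
  smooth := by
    have h1 : IsSmoothField (fun p : G => tderiv E E (fun y => y * p) 1 A) :=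
      isSmoothField_mul_right A
    exact h1.sub (isSmoothField_mul_left (hconn.smooth.comp h1))
  vertical p := ⟨_, hconn.modelForm_mem _ _, rfl⟩
  equivariant p a ha := by
    rw [horizontalField, horizontalField, map_sub, tderiv_mul_right_mul_right,
      tderiv_mul_right_mul_left, ← hconn.modelForm_mul p ha, tderiv_mul_right_mul_right]

end Connections

/-! ### Jets of Hölder paths and of solutions of Young equations. -/

section YoungPaths

open Filter Topology Asymptotics Bundle

variable {E : Type*} [NormedAddCommGroup E] [NormedSpace ℝ E] [FiniteDimensional ℝ E]
  {F : Type*} [NormedAddCommGroup F] [NormedSpace ℝ F]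
  {G : Type*} [Group G] [TopologicalSpace G] [ChartedSpace E G] [LieGroup 𝓘(ℝ, E) ∞ G]
  [T2Space G]
  {α : ℝ≥0} {Z : ℝ → ℝ} {τ a b : ℝ}

theorem rpow_isLittleO {γ : ℝ} (hγ : 1 < γ) (s : ℝ) :
    (fun t : ℝ => |t - s| ^ γ) =o[𝓝[>] s] fun t => t - s := by
  have h0 : Tendsto (fun t : ℝ => |t - s| ^ (γ - 1)) (𝓝[>] s) (𝓝 0) := by
    have : ContinuousAt (fun t : ℝ => |t - s| ^ (γ - 1)) s :=
      ContinuousAt.rpow_const (by fun_prop) (Or.inr (by linarith))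
    have h := this.tendsto
    simp only [sub_self, abs_zero, Real.zero_rpow (show γ - 1 ≠ 0 by linarith)] at h
    exact h.mono_left nhdsWithin_le_nhds
  have := ((isLittleO_one_iff ℝ).2 h0).mul_isBigO (isBigO_refl (fun t : ℝ => t - s) (𝓝[>] s))
  refine this.congr' ?_ (Eventually.of_forall fun t => one_mul _)
  filter_upwards [self_mem_nhdsWithin] with t ht
  have h1 : 0 < t - s := sub_pos.2 ht
  rw [abs_of_pos h1]
  nth_rewrite 2 [← Real.rpow_one (t - s)]
  rw [← Real.rpow_add h1]
  congr 1
  ring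

/-- This is how `α > 1/2` enters the calculus of jets: second-order terms in the increments are
negligible. -/
theorem holder_sq_isLittleO (hα : 1 / 2 < α) (s : ℝ) :
    (fun t : ℝ => (|t - s| ^ (α : ℝ)) ^ 2) =o[𝓝[>] s] fun t => t - s := by
  have h := rpow_isLittleO (γ := α * 2) (by linarith) s
  refine h.congr_left fun t => ?_
  rw [Real.rpow_mul (abs_nonneg _), Real.rpow_two]

/-- Hölder paths and Young equations are tested on real functions only; in finite dimension, linear
functionals of the coordinate recover the vector estimate. -/
theorem isBigO_of_clm {ι : Type*} {l : Filter ι} {f : ι → E} {g : ι → ℝ}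
    (h : ∀ L : E →L[ℝ] ℝ, (fun t => L (f t)) =O[l] g) : f =O[l] g := by
  set e := (Module.finBasis ℝ E).equivFunL
  have h1 : (fun t => e (f t)) =O[l] g := isBigO_pi.2 fun i =>
    h ((ContinuousLinearMap.proj (R := ℝ) (φ := fun _ : Fin (Module.finrank ℝ E) => ℝ) i).comp
      (e : E →L[ℝ] (Fin (Module.finrank ℝ E) → ℝ)))
  have h2 := ((e.symm : (Fin (Module.finrank ℝ E) → ℝ) →L[ℝ] E).isBigO_comp (fun t => e (f t)) l).trans h1
  simpa using h2

theorem isLittleO_of_clm {ι : Type*} {l : Filter ι} {f : ι → E} {g : ι → ℝ}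
    (h : ∀ L : E →L[ℝ] ℝ, (fun t => L (f t)) =o[l] g) : f =o[l] g := by
  set e := (Module.finBasis ℝ E).equivFunL
  have h1 : (fun t => e (f t)) =o[l] g := isLittleO_pi.2 fun i =>
    h ((ContinuousLinearMap.proj (R := ℝ) (φ := fun _ : Fin (Module.finrank ℝ E) => ℝ) i).comp
      (e : E →L[ℝ] (Fin (Module.finrank ℝ E) → ℝ)))
  have h2 := ((e.symm : (Fin (Module.finrank ℝ E) → ℝ) →L[ℝ] E).isBigO_comp (fun t => e (f t)) l).trans_isLittleO h1
  simpa using h2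

theorem IsHolderOn.isBigO {Y : Type*} [NormedAddCommGroup Y] {f : ℝ → Y}
    (hf : IsHolderOn α f (Icc a b)) {s : ℝ} (hs : s ∈ Ico a b) :
    (fun t => f t - f s) =O[𝓝[>] s] fun t => |t - s| ^ (α : ℝ) := by
  obtain ⟨C, -, hC⟩ := hf.exists_dist_le
  refine IsBigO.of_bound C ?_
  filter_upwards [Ioo_mem_nhdsGT hs.2] with t ht
  have := hC t ⟨hs.1.trans ht.1.le, ht.2.le⟩ s ⟨hs.1, hs.2.le⟩
  rw [dist_eq_norm] at this
  rwa [Real.norm_of_nonneg (by positivity)]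

theorem IsHolderOn.continuousOn {Y : Type*} [PseudoEMetricSpace Y] {f : ℝ → Y} {s : Set ℝ}
    (hα : 0 < α) (hf : IsHolderOn α f s) : ContinuousOn f s := by
  obtain ⟨C, hC⟩ := hf
  exact hC.continuousOn hα

theorem IsHolderPath.continuousOn (hα : 0 < α) {x : ℝ → G} {s : Set ℝ}
    (hx : IsHolderPath E α x s) : ContinuousOn x s := by
  intro t ht U hU
  obtain ⟨f, hf, -, h1, -, h0⟩ := exists_contMDiff_separating (E := E) hU
  have h2 := (IsHolderOn.continuousOn hα (hx f hf)) t ht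
  have h3 : ∀ᶠ r in 𝓝[s] t, 0 < f (x r) := h2.eventually (lt_mem_nhds (by simp [h1]))
  change ∀ᶠ r in 𝓝[s] t, x r ∈ U
  filter_upwards [h3] with r hr
  by_contra hne
  rw [h0 _ hne] at hr
  exact lt_irrefl _ hr

theorem IsHolderPath.mono {x : ℝ → G} {s t : Set ℝ} (hx : IsHolderPath E α x s) (hts : t ⊆ s) :
    IsHolderPath E α x t := fun f hf => (hx f hf).mono hts

theorem contMDiff_clm_groupCoord (L : E →L[ℝ] ℝ) (p : G) :
    ContMDiff 𝓘(ℝ, E) 𝓘(ℝ, ℝ) ∞ (fun y : G => L (groupCoord E (p⁻¹ * y))) :=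
  L.contMDiff.comp (contMDiff_groupCoord.comp (contMDiff_mul_left' _))

/-- The increments of a Hölder path, with respect to their own coordinates. -/
theorem IsHolderPath.hasJet (hα : 0 < α) {x : ℝ → G} (hx : IsHolderPath E α x (Icc a b)) {s : ℝ}
    (hs : s ∈ Ico a b) :
    HasJet (𝓝[>] s) (fun t => |t - s| ^ (α : ℝ)) (fun t => t - s) (fun t => (x s)⁻¹ * x t)
      (fun t => groupCoord E ((x s)⁻¹ * x t)) := by
  have : IsTopologicalGroup G := topologicalGroup_of_lieGroup 𝓘(ℝ, E) ∞
  refine ⟨?_, isBigO_of_clm fun L => ?_, by simp⟩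
  · have h1 : Tendsto x (𝓝[Ioo s b] s) (𝓝 (x s)) :=
      ((hx.continuousOn hα) s ⟨hs.1, hs.2.le⟩).mono_left
        (nhdsWithin_mono _ fun t ht => ⟨hs.1.trans ht.1.le, ht.2.le⟩)
    rw [nhdsWithin_Ioo_eq_nhdsGT hs.2] at h1
    have := h1.const_mul (x s)⁻¹
    rwa [inv_mul_cancel] at this
  · have := (hx _ (contMDiff_clm_groupCoord L (x s))).isBigO hs
    simpa using this

/-- The infinitesimal description of the solutions of Young equations. -/
theorem SolvesYDE.hasJet (hα : 0 < α) {x : ℝ → G} {W : ∀ t : ℝ, TangentSpace 𝓘(ℝ, E) (x t)}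
    (hx : SolvesYDE α Z τ x W) {s : ℝ} (hs : s ∈ Ico 0 τ) :
    HasJet (𝓝[>] s) (fun t => |t - s| ^ (α : ℝ)) (fun t => t - s) (fun t => (x s)⁻¹ * x t)
      (fun t => (Z t - Z s) • tderiv E E (fun y => (x s)⁻¹ * y) (x s) (W s)) := by
  have hτ : 0 ≤ τ := hs.1.trans hs.2.le
  have hj := hx.1.hasJet hα hs
  refine ⟨hj.1, hj.2, isLittleO_of_clm fun L => ?_⟩
  have hfs := contMDiff_clm_groupCoord (E := E) L (x s)
  have hint := hx.2 _ hfs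
  obtain ⟨hZ, ⟨β, hβ, hW⟩, -⟩ := hint τ ⟨hτ, le_rfl⟩
  -- The integrals over `[0, s]` and `[0, t]` are both increments of the same test function. Young's
  -- estimate on `[0, τ]` thus compares `f (x t) - f (x s)` with the velocity at time `s`.
  obtain ⟨C, hC, hbound⟩ := exists_norm_increment_le hβ hZ hW
  refine IsBigO.trans_isLittleO (IsBigO.of_bound C ?_)
    (rpow_isLittleO (γ := (α : ℝ) + β) (by exact_mod_cast hβ) s)
  filter_upwards [Ioo_mem_nhdsGT hs.2] with t ht
  have h1 := hbound s t hs.1 ht.1.le ht.2.le _ _ (hint s ⟨hs.1, hs.2.le⟩)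
    (hint t ⟨hs.1.trans ht.1.le, ht.2.le⟩)
  have hd : dirDeriv (E := E) (fun y => L (groupCoord E ((x s)⁻¹ * y))) (x s) (W s) =
      L (tderiv E E (fun y => (x s)⁻¹ * y) (x s) (W s)) := by
    have h2 := tderiv_comp_apply (f := fun y : G => groupCoord E ((x s)⁻¹ * y)) (g := fun v => L v)
      (p := x s) L.differentiableAt.mdifferentiableAt
      (contMDiff_groupCoord.comp (contMDiff_mul_left' (x s)⁻¹)).mdiffAt (W s)
    have h3 := tderiv_comp_apply (f := fun y : G => (x s)⁻¹ * y) (g := groupCoord E)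
      (p := x s) contMDiff_groupCoord.mdiffAt (contMDiff_mul_left' (x s)⁻¹).mdiffAt (W s)
    rw [inv_mul_cancel, tderiv_groupCoord_one] at h3
    refine h2.trans ?_
    rw [tderiv_eq_fderiv (f := fun v => L v), L.fderiv, h3]
    rfl
  simp only [hd] at h1
  rw [Real.norm_of_nonneg (by positivity : (0 : ℝ) ≤ |t - s| ^ ((α : ℝ) + β)),
    abs_of_pos (sub_pos.2 ht.1)]
  refine le_trans (le_of_eq ?_) h1
  congr 1
  simp [mul_comm]

/-- A smooth curve evaluated along a Hölder path of the parameter solves the Young equation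
given by its velocity. -/
theorem solvesYDE_of_curve (hα : 1 / 2 < α) (hZ : IsHolderOn α Z (Icc 0 τ)) {γ : ℝ → G}
    (hγ : ContMDiff 𝓘(ℝ, ℝ) 𝓘(ℝ, E) ∞ γ) :
    SolvesYDE (E := E) α Z τ (fun t => γ (Z t - Z 0))
      (fun t => tderiv ℝ E γ (Z t - Z 0) 1) := by
  have hα0 : 0 < α := lt_trans (by positivity) hα
  have hsh : ∀ {f : G → ℝ}, ContMDiff 𝓘(ℝ, E) 𝓘(ℝ, ℝ) ∞ f →
      ContDiff ℝ ∞ (fun z => f (γ (z - Z 0))) := fun hf =>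
    ((hf.comp hγ).contDiff).comp (contDiff_id.sub contDiff_const)
  refine ⟨fun f hf => ContDiffAt.isHolderOn_comp hα0 hZ fun z _ =>
    ((hsh hf).of_le (by simp)).contDiffAt, fun f hf t ht => ?_⟩
  have hf' := hsh hf
  have hd : ContDiff ℝ ∞ (deriv fun z => f (γ (z - Z 0))) := hf'.deriv' 
  -- The chain rule is used with integrator `Y = id`, so that `Y ∘ Z` is `Z`, and with `Λ` the
  -- derivative of `f` along the curve.
  have key := hasYoungIntegral_comp (E := ℝ) (F := ℝ) hα ht.1
    (hZ.mono (Icc_subset_Icc_right ht.2))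
    (Λ := fun z => deriv (fun z => f (γ (z - Z 0))) z • ContinuousLinearMap.id ℝ ℝ) (Y := id)
    (V := fun z => f (γ (z - Z 0)))
    (fun z _ => ((hd.of_le (by simp)).smul contDiff_const).contDiffAt)
    (fun z _ => contDiff_id.contDiffAt) (fun z _ => by
      have := ((hf'.of_le (m := 1) (by simp)).differentiable (by simp) z).hasDerivAt
      simpa using this)
  refine key.congr (fun s _ => ?_) (fun s _ => rfl)
  congr 1
  have h1 : HasDerivAt (fun r => f (γ (r - Z 0)))
      (tderiv E ℝ f (γ (Z s - Z 0)) (tderiv ℝ E γ (Z s - Z 0) 1)) (Z s) := by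
    have h2 : HasDerivAt (fun r => f (γ r)) (tderiv E ℝ f (γ (Z s - Z 0))
      (tderiv ℝ E γ (Z s - Z 0) 1)) (Z s - Z 0) := hasDerivAt_comp_curve hf.mdiffAt hγ.mdiffAt
    simpa using h2.comp_sub_const (Z s) (Z 0)
  exact h1.deriv.symm

end YoungPaths

/-! ### Integrals of 1-forms along Hölder paths. -/

section FormIntegrals

open Filter Topology Asymptotics Bundle

theorem HasYoungIntegral.exists_primitive {E F : Type*} [NormedAddCommGroup E] [NormedSpace ℝ E]
    [NormedAddCommGroup F] [NormedSpace ℝ F] [CompleteSpace F]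
    {α : ℝ≥0} {L : ℝ → E →L[ℝ] F} {y : ℝ → E} {a b : ℝ} {v : F} (hab : a ≤ b)
    (h : HasYoungIntegral α L y a b v) :
    ∃ J : ℝ → F, J a = 0 ∧ J b = v ∧ IsHolderOn α J (Icc a b) ∧ ∃ γ C : ℝ, 1 < γ ∧
      ∀ s t, a ≤ s → s ≤ t → t ≤ b → ‖J t - J s - L s (y t - y s)‖ ≤ C * (t - s) ^ γ := by
  choose! J hJ using fun t ht => h.exists_initial (t := t) ht
  have hv := h
  obtain ⟨hy, ⟨β, hβ, hL⟩, -⟩ := h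
  obtain ⟨C, hC, hbound⟩ := exists_norm_increment_le (F := F) hβ hy hL
  obtain ⟨Cy, hCy, hyb⟩ := hy.exists_dist_le
  obtain ⟨CL, hCL, hLb⟩ := hL.exists_dist_le
  have hb : ∀ s t, a ≤ s → s ≤ t → t ≤ b →
      ‖J t - J s - L s (y t - y s)‖ ≤ C * (t - s) ^ (α + β : ℝ) := fun s t h1 h2 h3 =>
    hbound s t h1 h2 h3 _ _ (hJ s ⟨h1, h2.trans h3⟩) (hJ t ⟨h1.trans h2, h3⟩)
  refine ⟨J, (hJ a ⟨le_rfl, hab⟩).self, (hJ b ⟨hab, le_rfl⟩).unique hab hv, ?_, α + β, C,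
    by exact_mod_cast hβ, hb⟩
  have hM : ∀ s ∈ Icc a b, ‖L s‖ ≤ CL * (b - a) ^ (β : ℝ) + ‖L a‖ := by
    intro s hs
    have h1 := hLb s hs a ⟨le_rfl, hab⟩
    rw [dist_eq_norm, abs_of_nonneg (sub_nonneg.2 hs.1)] at h1
    have h2 : (s - a) ^ (β : ℝ) ≤ (b - a) ^ (β : ℝ) :=
      Real.rpow_le_rpow (sub_nonneg.2 hs.1) (by linarith [hs.2]) β.coe_nonneg
    calc ‖L s‖ = ‖(L s - L a) + L a‖ := by rw [sub_add_cancel]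
      _ ≤ ‖L s - L a‖ + ‖L a‖ := norm_add_le _ _
      _ ≤ _ := by gcongr; exact h1.trans (by gcongr)
  set M := CL * (b - a) ^ (β : ℝ) + ‖L a‖ with hMdef
  have hM0 : 0 ≤ M := (norm_nonneg _).trans (hM a ⟨le_rfl, hab⟩)
  have key : ∀ s t, a ≤ s → s ≤ t → t ≤ b →
      dist (J s) (J t) ≤ (C * (b - a) ^ (β : ℝ) + M * Cy) * |s - t| ^ (α : ℝ) := by
    intro s t h1 h2 h3
    have h4 : dist (y t) (y s) ≤ _ := hyb t ⟨h1.trans h2, h3⟩ s ⟨h1, h2.trans h3⟩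
    rw [dist_comm, dist_eq_norm, abs_sub_comm, abs_of_nonneg (sub_nonneg.2 h2)]
    rw [dist_eq_norm, abs_of_nonneg (sub_nonneg.2 h2)] at h4
    have h5 : (t - s) ^ (α + β : ℝ) ≤ (b - a) ^ (β : ℝ) * (t - s) ^ (α : ℝ) := by
      rw [Real.rpow_add_of_nonneg (sub_nonneg.2 h2) α.coe_nonneg β.coe_nonneg, mul_comm]
      gcongr
    calc ‖J t - J s‖ = ‖(J t - J s - L s (y t - y s)) + L s (y t - y s)‖ := by
          rw [sub_add_cancel]
      _ ≤ ‖J t - J s - L s (y t - y s)‖ + ‖L s (y t - y s)‖ := norm_add_le _ _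
      _ ≤ C * ((b - a) ^ (β : ℝ) * (t - s) ^ (α : ℝ)) + M * (Cy * (t - s) ^ (α : ℝ)) := by
          refine add_le_add ((hb s t h1 h2 h3).trans (by gcongr)) ((L s).le_opNorm _ |>.trans ?_)
          exact mul_le_mul (hM s ⟨h1, h2.trans h3⟩) h4 (norm_nonneg _) hM0
      _ = _ := by ring
  refine isHolderOn_of_dist_le (C := C * (b - a) ^ (β : ℝ) + M * Cy) fun s hs t ht => ?_
  rcases le_total s t with h1 | h1
  · exact key s t hs.1 h1 ht.2
  · rw [dist_comm, abs_sub_comm]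
    exact key t s ht.1 h1 hs.2

variable {E : Type*} [NormedAddCommGroup E] [NormedSpace ℝ E] [FiniteDimensional ℝ E]
  {G : Type*} [Group G] [TopologicalSpace G] [ChartedSpace E G] [LieGroup 𝓘(ℝ, E) ∞ G]
  [T2Space G]
  {θ : ∀ x : G, TangentSpace 𝓘(ℝ, E) x →L[ℝ] GroupLieAlgebra 𝓘(ℝ, E) G}
  {α : ℝ≥0} {u : ℝ → G} {a b : ℝ} {v : E}

theorem formInChart_eq (c : G) (y : E) :
    formInChart (fun p => (lieAlgebraToModel E G).comp (θ p)) c y =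
      (modelForm θ ((extChartAt 𝓘(ℝ, E) c).symm y)).comp
        (tderiv E E (extChartAt 𝓘(ℝ, E) c).symm y) := rfl

theorem mdifferentiableAt_extChartAt_symm' {c : G} {y : E}
    (hy : y ∈ (extChartAt 𝓘(ℝ, E) c).target) :
    MDifferentiableAt 𝓘(ℝ, E) 𝓘(ℝ, E) (extChartAt 𝓘(ℝ, E) c).symm y :=
  ((contMDiffOn_extChartAt_symm (n := ∞) c).contMDiffAt
    ((isOpen_extChartAt_target c).mem_nhds hy)).mdifferentiableAt (by simp)

/-- The chart and its inverse cancel under the differential, so the coordinate expression of the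
form agrees with its expression in the left trivialization, in which jets are written. -/
theorem formInChart_tderiv {c p : G} (hp : p ∈ (extChartAt 𝓘(ℝ, E) c).source) (w : E) :
    formInChart (fun p => (lieAlgebraToModel E G).comp (θ p)) c (extChartAt 𝓘(ℝ, E) c p)
      (tderiv E E (fun k => extChartAt 𝓘(ℝ, E) c (p * k)) 1 w) = leftForm θ p w := by
  have : IsTopologicalGroup G := topologicalGroup_of_lieGroup 𝓘(ℝ, E) ∞
  set φ := extChartAt 𝓘(ℝ, E) c with hφ
  have h1 : MDifferentiableAt 𝓘(ℝ, E) 𝓘(ℝ, E) (fun k => φ (p * k)) 1 := by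
    refine MDifferentiableAt.comp (g := φ) (f := fun k => p * k) (1 : G) ?_
      (contMDiff_mul_left' p).mdiffAt
    rw [mul_one]
    exact (contMDiffAt_extChartAt' (n := ∞) (by have := hp; rwa [hφ, extChartAt_source] at this)).mdifferentiableAt (by simp)
  have h2 : MDifferentiableAt 𝓘(ℝ, E) 𝓘(ℝ, E) φ.symm (φ (p * 1)) := by
    rw [mul_one]
    exact mdifferentiableAt_extChartAt_symm' (φ.map_source hp)
  have h3 := tderiv_comp_apply (f := fun k => φ (p * k)) h2 h1 w
  have h4 : (fun k => φ.symm (φ (p * k))) =ᶠ[𝓝 1] fun k => p * k := by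
    have hc : Tendsto (fun k => p * k) (𝓝 1) (𝓝 p) := by
      have : Tendsto (fun k => p * k) (𝓝 1) (𝓝 (p * 1)) := tendsto_id.const_mul p
      rwa [mul_one] at this
    filter_upwards [hc.eventually ((isOpen_extChartAt_source c).mem_nhds hp)] with k hk
    exact φ.left_inv hk
  rw [h4.tderiv_eq, mul_one] at h3
  rw [formInChart_eq, ContinuousLinearMap.comp_apply, ← h3, φ.left_inv hp, leftForm_apply]

/-- The integral of a form along a Hölder path has a primitive, which is described to first order
by the form. -/
theorem HasFormIntegral.exists_primitive (hα : 1 / 2 < α)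
    (h : HasFormIntegral (E := E) α (fun p => (lieAlgebraToModel E G).comp (θ p)) u a b v) :
    a ≤ b ∧ (IsHolderPath E α u (Icc a b) → ∃ J : ℝ → E, ContinuousOn J (Icc a b) ∧ J a = 0 ∧
      J b = v ∧ ∀ s ∈ Ico a b,
        (fun t => J t - J s - leftForm θ (u s) (groupCoord E ((u s)⁻¹ * u t))) =o[𝓝[>] s]
          fun t => t - s) := by
  have hα0 : 0 < α := lt_trans (by positivity) hα
  induction h with
  | chart c a b v hab hmem hint =>
    refine ⟨hab, fun hu => ?_⟩
    obtain ⟨J, hJa, hJb, hJ, γ, C, hγ, hbound⟩ := hint.exists_primitive hab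
    refine ⟨J, hJ.continuousOn hα0, hJa, hJb, fun s hs => ?_⟩
    set φ := extChartAt 𝓘(ℝ, E) c with hφ
    have hus := hmem s ⟨hs.1, hs.2.le⟩
    have hf : ContMDiffAt 𝓘(ℝ, E) 𝓘(ℝ, E) ∞ (fun k => φ (u s * k)) 1 := by
      refine ContMDiffAt.comp (g := φ) (f := fun k => u s * k) (1 : G) ?_
        (contMDiff_mul_left' (u s)).contMDiffAt
      rw [mul_one]
      exact contMDiffAt_extChartAt' (by have := hus; rwa [hφ, extChartAt_source] at this)
    have h1 := (hu.hasJet hα0 hs).comp_isLittleO (holder_sq_isLittleO hα s) hf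
    set Ls := formInChart (fun p => (lieAlgebraToModel E G).comp (θ p)) c (φ (u s)) with hLs
    -- To first order the increment of the chart coordinate is linear in the group coordinate of the
    -- increment of `u`; this removes the chart from the estimate.
    have h2 := (Ls.isBigO_comp _ _).trans_isLittleO h1
    have h3 : (fun t => J t - J s - Ls (φ (u t) - φ (u s))) =o[𝓝[>] s] fun t => t - s := by
      refine IsBigO.trans_isLittleO (IsBigO.of_bound C ?_) (rpow_isLittleO hγ s)
      filter_upwards [Ioo_mem_nhdsGT hs.2] with t ht
      have := hbound s t hs.1 ht.1.le ht.2.le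
      rwa [Real.norm_of_nonneg (by positivity), abs_of_pos (sub_pos.2 ht.1)]
    refine (h3.add h2).congr_left fun t => ?_
    simp only [mul_inv_cancel_left, mul_one, map_sub]
    rw [formInChart_tderiv hus]
    abel
  | add a b c v w h₁ h₂ ih₁ ih₂ =>
    obtain ⟨hab, ih₁⟩ := ih₁
    obtain ⟨hbc, ih₂⟩ := ih₂
    refine ⟨hab.trans hbc, fun hu => ?_⟩
    obtain ⟨J₁, hc₁, ha₁, hb₁, hJ₁⟩ := ih₁ (hu.mono (Icc_subset_Icc_right hbc))
    obtain ⟨J₂, hc₂, ha₂, hb₂, hJ₂⟩ := ih₂ (hu.mono (Icc_subset_Icc_left hab))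
    have hright : ∀ t, b ≤ t → (if t ≤ b then J₁ t else v + J₂ t) = v + J₂ t := by
      intro t ht
      split_ifs with h
      · rw [le_antisymm h ht, ha₂, hb₁, add_zero]
      · rfl
    refine ⟨fun t => if t ≤ b then J₁ t else v + J₂ t, ?_, ?_, ?_, fun s hs => ?_⟩
    · rw [← Icc_union_Icc_eq_Icc hab hbc]
      refine ContinuousOn.union_of_isClosed (hc₁.congr fun t ht => if_pos ht.2)
        ((continuousOn_const.add hc₂).congr fun t ht => hright t ht.1) isClosed_Icc isClosed_Icc
    · simp only [hab, if_true, ha₁]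
    · exact (hright c hbc).trans (by rw [hb₂])
    · rcases lt_or_ge s b with hsb | hsb
      · refine (hJ₁ s ⟨hs.1, hsb⟩).congr' ?_ EventuallyEq.rfl
        filter_upwards [Ioo_mem_nhdsGT hsb] with t ht
        rw [if_pos ht.2.le, if_pos hsb.le]
      · refine (hJ₂ s ⟨hsb, hs.2⟩).congr' ?_ EventuallyEq.rfl
        filter_upwards [self_mem_nhdsWithin] with t ht
        rw [hright t (hsb.trans (le_of_lt ht)), hright s hsb]
        abel

/-- The increments of a path with vanishing form integrals are horizontal to first order. -/
theorem isLittleO_leftForm_of_hasFormIntegral (hα : 1 / 2 < α) {τ : ℝ}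
    (hu : IsHolderPath E α u (Icc 0 τ))
    (h : ∀ t ∈ Icc 0 τ,
      HasFormIntegral (E := E) α (fun p => (lieAlgebraToModel E G).comp (θ p)) u 0 t 0)
    {s : ℝ} (hs : s ∈ Ico 0 τ) :
    (fun t => leftForm θ (u s) (groupCoord E ((u s)⁻¹ * u t))) =o[𝓝[>] s] fun t => t - s := by
  have hτ : 0 ≤ τ := hs.1.trans hs.2.le
  obtain ⟨J, hc, h0, -, hJ⟩ := ((h τ ⟨hτ, le_rfl⟩).exists_primitive hα).2 hu
  have hzero : ∀ t ∈ Icc 0 τ, J t = 0 := by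
    intro t ht
    have hsub : Icc 0 t ⊆ Icc 0 τ := Icc_subset_Icc_right ht.2
    obtain ⟨J', hc', h0', ht', hJ'⟩ := ((h t ht).exists_primitive hα).2 (hu.mono hsub)
    -- The integral over `[0, t]` is witnessed by its own primitive `J'`. It has the same
    -- first-order increments as `J`, so the two agree on `[0, t]` and `J t = J' t = 0`.
    have := constant_of_has_deriv_right_zero (f := fun r => J r - J' r) ((hc.mono hsub).sub hc')
      (fun r hr => hasDerivWithinAt_zero_of_isLittleO
        (((hJ r ⟨hr.1, hr.2.trans_le ht.2⟩).sub (hJ' r hr)).congr_left fun q => by abel))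
      t ⟨ht.1, le_rfl⟩
    simpa [h0, h0', ht'] using this
  refine (hJ s hs).neg_left.congr' ?_ EventuallyEq.rfl
  filter_upwards [Ioo_mem_nhdsGT hs.2] with t ht
  rw [hzero t ⟨hs.1.trans ht.1.le, ht.2.le⟩, hzero s ⟨hs.1, hs.2.le⟩]
  simp

theorem contDiffAt_formInChart
    (hθ : ContMDiff 𝓘(ℝ, E).tangent 𝓘(ℝ, E) ∞
      (fun p : TangentBundle 𝓘(ℝ, E) G => lieAlgebraToModel E G (θ p.1 p.2))) {c : G} {y : E}
    (hy : y ∈ (extChartAt 𝓘(ℝ, E) c).target) :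
    ContDiffAt ℝ ∞ (formInChart (fun p => (lieAlgebraToModel E G).comp (θ p)) c) y := by
  have hopen : IsOpen (extChartAt 𝓘(ℝ, E) c).target := isOpen_extChartAt_target c
  suffices h : ContDiffOn ℝ ∞ (formInChart (fun p => (lieAlgebraToModel E G).comp (θ p)) c)
      (extChartAt 𝓘(ℝ, E) c).target from h.contDiffAt (hopen.mem_nhds hy)
  rw [contDiffOn_clm_apply]
  intro w
  have h1 := (contMDiffOn_extChartAt_symm (I := 𝓘(ℝ, E)) (n := ∞) c).contMDiffOn_tangentMapWithin
    (m := ∞) (by simp) hopen.uniqueMDiffOn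
  have h2 : ContMDiff 𝓘(ℝ, E) 𝓘(ℝ, E).tangent ∞
      (fun y : E => (⟨y, w⟩ : TangentBundle 𝓘(ℝ, E) E)) :=
    fun y => (contMDiffAt_vectorSpace_iff_contDiffAt (V := fun _ : E => w)).2 contDiffAt_const
  have h3 := (hθ.comp_contMDiffOn h1).comp h2.contMDiffOn (s := (extChartAt 𝓘(ℝ, E) c).target)
    (fun y hy => hy)
  refine (contMDiffOn_iff_contDiffOn.1 h3).congr fun y hy => ?_
  have h4 : mfderivWithin 𝓘(ℝ, E) 𝓘(ℝ, E) (extChartAt 𝓘(ℝ, E) c).symm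
      (extChartAt 𝓘(ℝ, E) c).target y = mfderiv 𝓘(ℝ, E) 𝓘(ℝ, E) (extChartAt 𝓘(ℝ, E) c).symm y :=
    mfderivWithin_of_isOpen hopen hy
  simp only [Function.comp_apply, tangentMapWithin]
  rw [h4]
  rfl

/-- The integral of a smooth form along a horizontal smooth curve, evaluated along a Hölder path of
the parameter, vanishes. -/
theorem hasFormIntegral_of_curve (hα : 1 / 2 < α)
    (hθ : ContMDiff 𝓘(ℝ, E).tangent 𝓘(ℝ, E) ∞
      (fun p : TangentBundle 𝓘(ℝ, E) G => lieAlgebraToModel E G (θ p.1 p.2)))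
    {Z : ℝ → ℝ} {τ : ℝ} (hZ : IsHolderOn α Z (Icc 0 τ)) {γ : ℝ → G}
    (hγ : ContMDiff 𝓘(ℝ, ℝ) 𝓘(ℝ, E) ∞ γ) (hhor : ∀ z, modelForm θ (γ z) (tderiv ℝ E γ z 1) = 0)
    (hτ : 0 ≤ τ) :
    HasFormIntegral (E := E) α (fun p => (lieAlgebraToModel E G).comp (θ p))
      (fun t => γ (Z t - Z 0)) 0 τ 0 := by
  have hα0 : 0 < α := lt_trans (by positivity) hα
  have hchart : ∀ a b : ℝ, 0 ≤ a → a ≤ b → b ≤ τ → ∀ c : G,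
      (∀ s ∈ Icc a b, γ (Z s - Z 0) ∈ (extChartAt 𝓘(ℝ, E) c).source) →
      HasFormIntegral (E := E) α (fun p => (lieAlgebraToModel E G).comp (θ p))
        (fun t => γ (Z t - Z 0)) a b 0 := by
    intro a b ha hab hb c hc
    refine HasFormIntegral.chart c a b 0 hab hc ?_
    set φ := extChartAt 𝓘(ℝ, E) c with hφ
    have hYs : ∀ z ∈ Z '' Icc a b, ContDiffAt ℝ ∞ (fun z => φ (γ (z - Z 0))) z := by
      rintro _ ⟨s, hs, rfl⟩
      have h1 : ContMDiffAt 𝓘(ℝ, ℝ) 𝓘(ℝ, E) ∞ (fun z => γ (z - Z 0)) (Z s) :=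
        (hγ.comp (contDiff_id.sub contDiff_const).contMDiff) (Z s)
      have h2 : ContMDiffAt 𝓘(ℝ, E) 𝓘(ℝ, E) ∞ φ (γ (Z s - Z 0)) :=
        contMDiffAt_extChartAt' (by have := hc s hs; rwa [hφ, extChartAt_source] at this)
      exact (ContMDiffAt.comp (g := φ) (f := fun z => γ (z - Z 0)) (Z s) h2 h1).contDiffAt
    -- The form vanishes on the velocity of `γ`, so the constant `0` is an admissible primitive `V`.
    have key := hasYoungIntegral_comp hα hab (hZ.mono (Icc_subset_Icc ha hb))
      (Λ := fun z => formInChart (fun p => (lieAlgebraToModel E G).comp (θ p)) c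
        (φ (γ (z - Z 0)))) (Y := fun z => φ (γ (z - Z 0))) (V := fun _ => (0 : E)) ?_
      (fun z hz => (hYs z hz).of_le (by simp)) ?_
    · simpa using key
    · rintro _ ⟨s, hs, rfl⟩
      exact (ContDiffAt.comp (g := formInChart _ c) (Z s)
        (contDiffAt_formInChart hθ (φ.map_source (hc s hs))) (hYs _ ⟨s, hs, rfl⟩)).of_le (by simp)
    · rintro _ ⟨s, hs, rfl⟩
      have hp := hc s hs
      set p := γ (Z s - Z 0) with hpdef
      have h2 : MDifferentiableAt 𝓘(ℝ, E) 𝓘(ℝ, E) φ p :=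
        (contMDiffAt_extChartAt' (n := ∞) (by have := hp; rwa [hφ, extChartAt_source] at this)).mdifferentiableAt (by simp)
      have h3 : HasDerivAt (fun r => φ (γ r)) (tderiv E E φ p (tderiv ℝ E γ (Z s - Z 0) 1))
        (Z s - Z 0) := hasDerivAt_comp_curve h2 hγ.mdiffAt
      have h4 : deriv (fun z => φ (γ (z - Z 0))) (Z s) =
          tderiv E E φ p (tderiv ℝ E γ (Z s - Z 0) 1) := (h3.comp_sub_const (Z s) (Z 0)).deriv
      have h5 : formInChart (fun p => (lieAlgebraToModel E G).comp (θ p)) c (φ p)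
          (tderiv E E φ p (tderiv ℝ E γ (Z s - Z 0) 1)) = 0 := by
        have h6 := tderiv_comp_apply (mdifferentiableAt_extChartAt_symm' (φ.map_source hp)) h2
          (tderiv ℝ E γ (Z s - Z 0) 1)
        have h7 : (fun q => φ.symm (φ q)) =ᶠ[𝓝 p] fun q => q := by
          filter_upwards [(isOpen_extChartAt_source c).mem_nhds hp] with q hq
          exact φ.left_inv hq
        rw [h7.tderiv_eq, tderiv_id] at h6
        rw [formInChart_eq, ContinuousLinearMap.comp_apply, ← h6, φ.left_inv hp]
        exact hhor _
      simp only [h4, h5]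
      exact hasDerivAt_const _ _
  have hcont : ContinuousOn (fun t => γ (Z t - Z 0)) (Icc 0 τ) :=
    hγ.continuous.comp_continuousOn ((hZ.continuousOn hα0).sub continuousOn_const)
  -- The path crosses several charts: compactness gives a subdivision with each piece inside one
  -- chart domain, and the vanishing integrals add up.
  obtain ⟨t, ht0, htm, ⟨m, hm⟩, hsub⟩ := exists_monotone_Icc_subset_open_cover_Icc hτ
    (c := fun c : G => {s : Icc (0 : ℝ) τ | γ (Z s - Z 0) ∈ (extChartAt 𝓘(ℝ, E) c).source})
    (fun c => (isOpen_extChartAt_source c).preimage hcont.domRestrict)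
    (fun s _ => mem_iUnion.2 ⟨γ (Z s - Z 0), mem_extChartAt_source _⟩)
  have hstep : ∀ n, HasFormIntegral (E := E) α (fun p => (lieAlgebraToModel E G).comp (θ p))
      (fun t => γ (Z t - Z 0)) (t n) (t (n + 1)) 0 := by
    intro n
    obtain ⟨c, hc⟩ := hsub n
    refine hchart _ _ (t n).2.1 (htm n.le_succ) (t (n + 1)).2.2 c fun s hs => ?_
    exact hc (a := ⟨s, (t n).2.1.trans hs.1, hs.2.trans (t (n + 1)).2.2⟩) ⟨hs.1, hs.2⟩
  have hall : ∀ n, HasFormIntegral (E := E) α (fun p => (lieAlgebraToModel E G).comp (θ p))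
      (fun t => γ (Z t - Z 0)) 0 (t (n + 1)) 0 := by
    intro n
    induction n with
    | zero =>
      have := hstep 0
      rwa [ht0] at this
    | succ n ih =>
      have := HasFormIntegral.add _ _ _ _ _ ih (hstep (n + 1))
      rwa [add_zero] at this
  have := hall m
  rwa [hm (m + 1) (Nat.le_succ m)] at this

end FormIntegrals

/-! ### Uniqueness of horizontal paths and of solutions of the right-invariant equation. -/

section Uniqueness

open Filter Topology Asymptotics Bundle

variable {E : Type*} [NormedAddCommGroup E] [NormedSpace ℝ E] [FiniteDimensional ℝ E]
  {G : Type*} [Group G] [TopologicalSpace G] [ChartedSpace E G] [LieGroup 𝓘(ℝ, E) ∞ G]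
  [T2Space G]
  {H : Subgroup G}
  {θ : ∀ x : G, TangentSpace 𝓘(ℝ, E) x →L[ℝ] GroupLieAlgebra 𝓘(ℝ, E) G}
  {α : ℝ≥0} {Z : ℝ → ℝ} {τ : ℝ}

/-- The increments of the quotient `v⁻¹ u` of two paths. -/
theorem HasJet.inv_mul_increment {u v : ℝ → G} {s : ℝ} {l : Filter ℝ} {ρ r : ℝ → ℝ} {j k : ℝ → E}
    (hρ : (fun t => ρ t ^ 2) =o[l] r) (hu : HasJet l ρ r (fun t => (u s)⁻¹ * u t) j)
    (hv : HasJet l ρ r (fun t => (v s)⁻¹ * v t) k) :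
    HasJet l ρ r (fun t => ((v s)⁻¹ * u s)⁻¹ * ((v t)⁻¹ * u t))
      (fun t => modelAd E ((v s)⁻¹ * u s)⁻¹ (-k t) + j t) := by
  have h1 := ((hv.inv hρ).conj hρ ((v s)⁻¹ * u s)⁻¹).mul hu hρ
  refine h1.congr (Eventually.of_forall fun t => ?_)
  group

/-- Two horizontal paths over the same path in `G ⧸ H` with the same initial point agree. -/
theorem IsConnectionForm.eq_of_horizontal [FirstCountableTopology G] (hH : IsClosed (H : Set G))
    (hconn : IsConnectionForm H θ) (hα : 1 / 2 < α) {u v : ℝ → G}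
    (hu : IsHolderPath E α u (Icc 0 τ)) (hv : IsHolderPath E α v (Icc 0 τ))
    (hhu : ∀ s ∈ Ico 0 τ, (fun t => leftForm θ (u s) (groupCoord E ((u s)⁻¹ * u t))) =o[𝓝[>] s]
      fun t => t - s)
    (hhv : ∀ s ∈ Ico 0 τ, (fun t => leftForm θ (v s) (groupCoord E ((v s)⁻¹ * v t))) =o[𝓝[>] s]
      fun t => t - s)
    (hmem : ∀ t ∈ Icc 0 τ, (v t)⁻¹ * u t ∈ H) (h0 : u 0 = v 0) :
    ∀ t ∈ Icc 0 τ, u t = v t := by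
  have : IsTopologicalGroup G := topologicalGroup_of_lieGroup 𝓘(ℝ, E) ∞
  have hα0 : 0 < α := lt_trans (by positivity) hα
  intro t ht
  have key := eq_of_hasJet_zero (E := E) (p := fun t => (v t)⁻¹ * u t) (a := 0) (b := τ)
    ((hv.continuousOn hα0).inv.mul (hu.continuousOn hα0)) (fun s hs => ?_) t ht
  · rw [h0, inv_mul_cancel, inv_mul_eq_one] at key
    exact key.symm
  have hρ := holder_sq_isLittleO hα s
  have hs' : s ∈ Icc 0 τ := ⟨hs.1, hs.2.le⟩
  refine ⟨_, hρ, ?_⟩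
  have hj := HasJet.inv_mul_increment hρ (hu.hasJet hα0 hs) (hv.hasJet hα0 hs)
  set b := (v s)⁻¹ * u s with hb
  set κ : ℝ → G := fun t => b⁻¹ * ((v t)⁻¹ * u t) with hκ
  set P := leftForm θ (u s) with hP
  -- The increment of `v` is horizontal at `v s`; since `u s = v s * b` with `b ∈ H`, equivariance
  -- of the connection makes its conjugate by `b⁻¹` horizontal at `u s`.
  have h1 : (fun t => P (modelAd E b⁻¹ (-groupCoord E ((v s)⁻¹ * v t)) +
      groupCoord E ((u s)⁻¹ * u t))) =o[𝓝[>] s] fun t => t - s := by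
    have h2 := ((modelAd E b⁻¹).isBigO_comp _ _).trans_isLittleO (hhv s hs).neg_left
    refine (h2.add (hhu s hs)).congr_left fun t => ?_
    have h3 := hconn.leftForm_mul (v s) (hmem s hs') (-groupCoord E ((v s)⁻¹ * v t))
    rw [mul_inv_cancel_left] at h3
    rw [map_add, h3, ← map_neg]
  have h2 : (fun t => P (groupCoord E (κ t))) =o[𝓝[>] s] fun t => t - s := by
    have h3 := (P.isBigO_comp _ _).trans_isLittleO hj.isLittleO
    refine (h3.add h1).congr_left fun t => ?_
    rw [← map_add, sub_add_cancel]
  have hκH : ∀ᶠ t in 𝓝[>] s, κ t ∈ (H : Set G) := by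
    filter_upwards [Ioo_mem_nhdsGT hs.2] with t ht
    exact H.mul_mem (H.inv_mem (hmem s hs')) (hmem t ⟨hs.1.trans ht.1.le, ht.2.le⟩)
  -- The increment `κ` lies in `H`, where its coordinate is almost fixed by `P`. With `δ = 1/2` its
  -- norm is at most twice that of its image under `P`, which is `o(t - s)`.
  have h3 : ∀ᶠ t in 𝓝[>] s, ‖groupCoord E (κ t) - P (groupCoord E (κ t))‖ ≤
      1 / 2 * ‖groupCoord E (κ t)‖ :=
    (tendsto_nhdsWithin_iff.2 ⟨hj.tendsto, hκH⟩).eventually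
      (eventually_norm_sub_le_of_mem hH exists_oneParameterSubgroup
        (fun ξ hξ => hconn.leftForm_eq hξ (u s)) (by norm_num : (0 : ℝ) < 1 / 2))
  have h4 : (fun t => groupCoord E (κ t)) =O[𝓝[>] s] fun t => P (groupCoord E (κ t)) := by
    refine IsBigO.of_bound 2 ?_
    filter_upwards [h3] with t ht
    have h5 : ‖groupCoord E (κ t)‖ ≤ ‖groupCoord E (κ t) - P (groupCoord E (κ t))‖ +
        ‖P (groupCoord E (κ t))‖ := by
      calc ‖groupCoord E (κ t)‖ = ‖(groupCoord E (κ t) - P (groupCoord E (κ t))) +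
          P (groupCoord E (κ t))‖ := by rw [sub_add_cancel]
        _ ≤ _ := norm_add_le _ _
    linarith
  exact ⟨hj.tendsto, hj.isBigO, by simpa using h4.trans_isLittleO h2⟩

theorem tderiv_inv_mul_mul_right (p : G) (A : E) :
    tderiv E E (fun y : G => p⁻¹ * y) p (tderiv E E (fun y : G => y * p) 1 A) =
      modelAd E p⁻¹ A := by
  have h1 := tderiv_comp_apply (f := fun y : G => y * p) (g := fun y : G => p⁻¹ * y) (p := (1 : G))
    (contMDiff_mul_left' (E := E) p⁻¹).mdiffAt (contMDiff_mul_right' p).mdiffAt A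
  rw [one_mul] at h1
  rw [← h1, modelAd]
  congr 2
  funext y
  group

/-- Solutions of the right-invariant equation are unique. -/
theorem SolvesYDE.eq_mul (hα : 1 / 2 < α) {A : E} {g y : ℝ → G}
    (hg : SolvesYDE (E := E) α Z τ g (fun t => tderiv E E (fun q => q * g t) 1 A)) (hg0 : g 0 = 1)
    (hy : SolvesYDE (E := E) α Z τ y (fun t => tderiv E E (fun q => q * y t) 1 A)) :
    ∀ t ∈ Icc 0 τ, y t = g t * y 0 := by
  have : IsTopologicalGroup G := topologicalGroup_of_lieGroup 𝓘(ℝ, E) ∞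
  have hα0 : 0 < α := lt_trans (by positivity) hα
  intro t ht
  have key := eq_of_hasJet_zero (E := E) (p := fun t => (g t)⁻¹ * y t) (a := 0) (b := τ)
    ((hg.1.continuousOn hα0).inv.mul (hy.1.continuousOn hα0)) (fun s hs => ?_) t ht
  · rw [hg0, inv_one, one_mul, inv_mul_eq_iff_eq_mul] at key
    exact key
  have hρ := holder_sq_isLittleO hα s
  refine ⟨_, hρ, ?_⟩
  have hj := HasJet.inv_mul_increment hρ (hy.hasJet hα0 hs) (hg.hasJet hα0 hs)
  refine hj.congr_jet ((isLittleO_zero _ _).congr_left fun t => ?_)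
  -- In the left trivialization the velocities are `Ad (g s)⁻¹ A` and `Ad (y s)⁻¹ A`. Conjugation by
  -- `(g s)⁻¹ * y s` matches them, so the jet of `g⁻¹ y` vanishes.
  have h1 : modelAd E ((g s)⁻¹ * y s)⁻¹ (tderiv E E (fun q => (g s)⁻¹ * q) (g s)
      (tderiv E E (fun q => q * g s) 1 A)) = tderiv E E (fun q => (y s)⁻¹ * q) (y s)
      (tderiv E E (fun q => q * y s) 1 A) := by
    rw [tderiv_inv_mul_mul_right, tderiv_inv_mul_mul_right, ← ContinuousLinearMap.comp_apply,
      ← modelAd_mul]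
    congr 2
    group
  rw [map_neg, map_smul, h1]
  simp

/-- Solutions of Young equations whose velocity is vertical stay in a coset. -/
theorem SolvesYDE.inv_mul_mem (hH : IsClosed (H : Set G)) (hα : 1 / 2 < α)
    (hZ : IsHolderOn α Z (Icc 0 τ)) {y : ℝ → G} {W : ∀ t : ℝ, TangentSpace 𝓘(ℝ, E) (y t)}
    (hy : SolvesYDE α Z τ y W)
    (hW : ∀ t ∈ Icc 0 τ, ∃ ξ : E, ξ ∈ subgroupLieAlgebra E H ∧
      @Eq E (W t) (tderiv E E (fun q => y t * q) 1 ξ)) :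
    ∀ t ∈ Icc 0 τ, (y 0)⁻¹ * y t ∈ H := by
  have hα0 : 0 < α := lt_trans (by positivity) hα
  refine inv_mul_mem_of_hasJet (E := E) hH (hy.1.continuousOn hα0) fun s hs => ?_
  have hs' : s ∈ Icc 0 τ := ⟨hs.1, hs.2.le⟩
  obtain ⟨ξ, hξ, hWξ⟩ := hW s hs'
  refine ⟨_, fun t => Z t - Z s, ξ, holder_sq_isLittleO hα s, hZ.isBigO hs, ?_, hξ, ?_⟩
  · have h1 : Tendsto Z (𝓝[Ioo s τ] s) (𝓝 (Z s)) :=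
      ((hZ.continuousOn hα0) s hs').mono_left
        (nhdsWithin_mono _ fun t ht => ⟨hs.1.trans ht.1.le, ht.2.le⟩)
    rw [nhdsWithin_Ioo_eq_nhdsGT hs.2] at h1
    simpa using h1.sub_const (Z s)
  · have h1 := hy.hasJet hα0 hs
    have h2 : tderiv E E (fun q => (y s)⁻¹ * q) (y s) (W s) = ξ :=
      (congrArg (tderiv E E (fun q => (y s)⁻¹ * q) (y s)) hWξ).trans (tderiv_inv_mul_mul _ _)
    rwa [h2] at h1

/-- Solutions of Young equations whose velocity is horizontal have horizontal increments. -/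
theorem SolvesYDE.isLittleO_leftForm (hα : 1 / 2 < α) {y : ℝ → G}
    {W : ∀ t : ℝ, TangentSpace 𝓘(ℝ, E) (y t)} (hy : SolvesYDE α Z τ y W)
    (hW : ∀ t ∈ Icc 0 τ, modelForm θ (y t) (W t) = 0) {s : ℝ} (hs : s ∈ Ico 0 τ) :
    (fun t => leftForm θ (y s) (groupCoord E ((y s)⁻¹ * y t))) =o[𝓝[>] s] fun t => t - s := by
  have hα0 : 0 < α := lt_trans (by positivity) hα
  have h1 := ((leftForm θ (y s)).isBigO_comp _ _).trans_isLittleO (hy.hasJet hα0 hs).isLittleO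
  have h2 : leftForm θ (y s) (tderiv E E (fun q => (y s)⁻¹ * q) (y s) (W s)) = 0 :=
    (congrArg (modelForm θ (y s)) (tderiv_mul_inv_mul _ _)).trans (hW s ⟨hs.1, hs.2.le⟩)
  refine h1.congr_left fun t => ?_
  rw [map_sub, map_smul, h2, smul_zero, sub_zero]

/-- The velocities lie in tangent spaces at points that are only propositionally equal, so they are
compared in the common model space. -/
theorem SolvesYDE.congr {x y : ℝ → G} {W : ∀ t : ℝ, TangentSpace 𝓘(ℝ, E) (x t)}
    {W' : ∀ t : ℝ, TangentSpace 𝓘(ℝ, E) (y t)} (hx : SolvesYDE α Z τ x W)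
    (hxy : ∀ t ∈ Icc 0 τ, y t = x t) (hW : ∀ t ∈ Icc 0 τ, @Eq E (W' t) (W t)) :
    SolvesYDE α Z τ y W' := by
  refine ⟨fun f hf => (hx.1 f hf).congr fun t ht => by rw [hxy t ht], fun f hf t ht => ?_⟩
  have hτ : (0 : ℝ) ∈ Icc 0 τ := ⟨le_rfl, ht.1.trans ht.2⟩
  rw [hxy t ht, hxy 0 hτ]
  refine (hx.2 f hf t ht).congr (fun s hs => ?_) (fun s _ => rfl)
  have hs' : s ∈ Icc 0 τ := ⟨hs.1, hs.2.trans ht.2⟩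
  have h1 : tderiv E ℝ f (y s) (W' s) = tderiv E ℝ f (x s) (W s) := by
    rw [hxy s hs']
    exact congrArg (tderiv E ℝ f (x s)) (hW s hs')
  exact congrArg (· • ContinuousLinearMap.id ℝ ℝ) h1

end Uniqueness

/-! ### The horizontal flow, its decomposition and its lifts. -/

section Decomposition

open Filter Topology Asymptotics Bundle

variable {E : Type*} [NormedAddCommGroup E] [NormedSpace ℝ E] [FiniteDimensional ℝ E]
  {G : Type*} [Group G] [TopologicalSpace G] [ChartedSpace E G] [LieGroup 𝓘(ℝ, E) ∞ G]
  [T2Space G]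
  {H : Subgroup G}
  {θ : ∀ x : G, TangentSpace 𝓘(ℝ, E) x →L[ℝ] GroupLieAlgebra 𝓘(ℝ, E) G}
  {α : ℝ≥0} {Z : ℝ → ℝ} {τ : ℝ}

/-- The flow of the horizontal part of a right-invariant vector field, together with the
one-parameter subgroup which generates the right-invariant vector field. -/
structure IsHorizontalFlow (H : Subgroup G)
    (θ : ∀ x : G, TangentSpace 𝓘(ℝ, E) x →L[ℝ] GroupLieAlgebra 𝓘(ℝ, E) G) (A : E)
    (c : ℝ → G) (Ψ : ℝ → G → G) : Prop where
  smooth : ContMDiff 𝓘(ℝ, ℝ) 𝓘(ℝ, E) ∞ c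
  add : ∀ s t, c (s + t) = c s * c t
  deriv : tderiv ℝ E c 0 1 = A
  zero : ∀ x, Ψ 0 x = x
  curve : ∀ x, ContMDiff 𝓘(ℝ, ℝ) 𝓘(ℝ, E) ∞ (fun t => Ψ t x)
  velocity : ∀ t x, tderiv ℝ E (fun t => Ψ t x) t 1 = horizontalField θ A (Ψ t x)
  flow : ∀ s t x, Ψ (s + t) x = Ψ s (Ψ t x)
  smooth_map : ∀ t, ContMDiff 𝓘(ℝ, E) 𝓘(ℝ, E) ∞ (Ψ t)
  equivariant : ∀ t x, ∀ a ∈ H, Ψ t (x * a) = Ψ t x * a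
  mem : ∀ t x, (c t * x)⁻¹ * Ψ t x ∈ H

theorem IsConnectionForm.exists_horizontalFlow (hH : IsClosed (H : Set G))
    (hconn : IsConnectionForm H θ) (A : E) : ∃ c Ψ, IsHorizontalFlow H θ A c Ψ := by
  obtain ⟨c, hc, hadd, hcA⟩ := exists_oneParameterSubgroup (G := G) A
  obtain ⟨Ψ, h0, hint, hflow, hs, heq, hmem⟩ := (hconn.isVerticalPerturbation A).exists_flow hH
  exact ⟨c, Ψ, hc, hadd, hcA, h0, fun x => (hint x).contMDiff (hconn.isVerticalPerturbation A).smooth,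
    fun t x => (hint x).tderiv_eq t, hflow, hs, heq, hmem c hc hadd hcA⟩

namespace IsHorizontalFlow

variable {A : E} {c : ℝ → G} {Ψ : ℝ → G → G}

theorem c_zero (hΨ : IsHorizontalFlow H θ A c Ψ) : c 0 = 1 := oneParam_zero hΨ.add

theorem left_inv (hΨ : IsHorizontalFlow H θ A c Ψ) (z : ℝ) (x : G) : Ψ (-z) (Ψ z x) = x := by
  rw [← hΨ.flow, neg_add_cancel, hΨ.zero]

theorem right_inv (hΨ : IsHorizontalFlow H θ A c Ψ) (z : ℝ) (x : G) : Ψ z (Ψ (-z) x) = x := by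
  rw [← hΨ.flow, add_neg_cancel, hΨ.zero]

theorem mem_inv (hΨ : IsHorizontalFlow H θ A c Ψ) (z : ℝ) (x : G) :
    (Ψ z x)⁻¹ * (c z * x) ∈ H := by
  have := H.inv_mem (hΨ.mem z x)
  simpa [mul_assoc] using this

/-- Since `c z * x = Ψ z x * b` with `b ∈ H`, equivariance gives `Ψ (-z) (c z * x) = x * b`. This is
the formula `ψ = x h` of the theorem. -/
theorem neg_apply (hΨ : IsHorizontalFlow H θ A c Ψ) (z : ℝ) (x : G) :
    Ψ (-z) (c z * x) = x * (Ψ z x)⁻¹ * (c z * x) := by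
  have h1 : c z * x = Ψ z x * ((Ψ z x)⁻¹ * (c z * x)) := by group
  rw [h1, hΨ.equivariant _ _ _ (hΨ.mem_inv z x), hΨ.left_inv]
  group

theorem modelForm_velocity (hΨ : IsHorizontalFlow H θ A c Ψ) (hconn : IsConnectionForm H θ)
    (z : ℝ) (x : G) :
    modelForm θ (Ψ z x) (tderiv ℝ E (fun t => Ψ t x) z 1) = 0 := by
  rw [hΨ.velocity, hconn.modelForm_horizontalField]

/-- The horizontal flow maps vertical vectors to vertical vectors. -/
theorem tderiv_vertical (hΨ : IsHorizontalFlow H θ A c Ψ) (z : ℝ) (x : G) {ξ : E}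
    (hξ : ξ ∈ subgroupLieAlgebra E H) :
    tderiv E E (Ψ z) x (tderiv E E (fun y => x * y) 1 ξ) =
      tderiv E E (fun y => Ψ z x * y) 1 ξ := by
  obtain ⟨d, hd, hadd, hmem, hdξ⟩ := hξ
  have hdξ' : tderiv ℝ E d 0 1 = ξ := hdξ
  have hd0 := oneParam_zero hadd
  have h1 := tderiv_mul_oneParam (E := E) hd hadd 0 x
  have h2 := tderiv_mul_oneParam (E := E) hd hadd 0 (Ψ z x)
  have h3 : (fun r => Ψ z (x * d r)) = fun r => Ψ z x * d r := by
    funext r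
    exact hΨ.equivariant z x _ (hmem r)
  have h4 := tderiv_comp_apply (f := fun r => x * d r) (g := Ψ z) (p := (0 : ℝ))
    (hΨ.smooth_map z).mdiffAt ((contMDiff_mul_left' (E := E) x).comp hd).mdiffAt 1
  rw [h3, h2, h1, hdξ', hd0] at h4
  simpa using h4.symm

/-- The vertical component of the flow of the right-invariant vector field. -/
theorem tderiv_vertical_component (hΨ : IsHorizontalFlow H θ A c Ψ)
    (hconn : IsConnectionForm H θ) (z : ℝ) (x : G) :
    tderiv ℝ E (fun z => x * (Ψ z x)⁻¹ * (c z * x)) z 1 =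
      tderiv E E (fun y => x * (Ψ z x)⁻¹ * (c z * x) * y) 1
        (modelForm θ (c z * x) (tderiv E E (fun y => y * (c z * x)) 1 A)) := by
  set q := Ψ z x with hq
  set γ : ℝ → G := fun z => x * (Ψ z x)⁻¹ * (c z * x) with hγ
  have hcx : ContMDiff 𝓘(ℝ, ℝ) 𝓘(ℝ, E) ∞ (fun z => c z * x) :=
    (contMDiff_mul_right' x).comp hΨ.smooth
  have hb : ContMDiff 𝓘(ℝ, ℝ) 𝓘(ℝ, E) ∞ (fun z => (Ψ z x)⁻¹ * (c z * x)) :=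
    (hΨ.curve x).inv.mul hcx
  have hγb : γ = fun z => x * ((Ψ z x)⁻¹ * (c z * x)) := by
    funext z
    simp only [hγ, mul_assoc]
  set b := q⁻¹ * (c z * x) with hbdef
  have hqb : q * b = c z * x := by simp [hbdef]
  have h1 := tderiv_mul_curves (E := E) (γ := fun z => Ψ z x) (δ := fun z => (Ψ z x)⁻¹ * (c z * x))
    (s := z) (hΨ.curve x).mdiffAt hb.mdiffAt
  have h2 : (fun z => Ψ z x * ((Ψ z x)⁻¹ * (c z * x))) = fun z => c z * x := by
    funext z
    simp
  -- Product rule for `Ψ z x * b = c z * x`. By equivariance the first factor contributes the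
  -- horizontal part of the field at `c z * x`, so the motion of `b` accounts for the vertical part.
  rw [h2, tderiv_oneParam_mul hΨ.smooth hΨ.add, hΨ.deriv, hΨ.velocity,
    (hconn.isVerticalPerturbation A).equivariant _ _ (hΨ.mem_inv z x)] at h1
  simp only [← hq, ← hbdef, hqb] at h1
  have h3 : tderiv E E (fun y => q * y) b
      (tderiv ℝ E (fun z => (Ψ z x)⁻¹ * (c z * x)) z 1) =
      tderiv E E (fun y => c z * x * y) 1
        (modelForm θ (c z * x) (tderiv E E (fun y => y * (c z * x)) 1 A)) := by
    rw [horizontalField] at h1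
    have h4 := sub_eq_zero.2 h1
    rw [← sub_eq_zero, ← neg_eq_zero, ← h4]
    abel
  have h5 : tderiv ℝ E γ z 1 = tderiv E E (fun y => x * y) b
      (tderiv ℝ E (fun z => (Ψ z x)⁻¹ * (c z * x)) z 1) := by
    rw [hγb]
    exact tderiv_comp_apply (f := fun z => (Ψ z x)⁻¹ * (c z * x)) (g := fun y => x * y)
      (contMDiff_mul_left' x).mdiffAt hb.mdiffAt 1
  have h6 : tderiv E E (fun y => x * y) b
      (tderiv ℝ E (fun z => (Ψ z x)⁻¹ * (c z * x)) z 1) =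
      tderiv E E (fun y => x * q⁻¹ * y) (q * b) (tderiv E E (fun y => q * y) b
        (tderiv ℝ E (fun z => (Ψ z x)⁻¹ * (c z * x)) z 1)) := by
    rw [tderiv_mul_left_mul_left, inv_mul_cancel_right]
  rw [h5, h6, h3, hqb, tderiv_mul_left_mul_left_one]

theorem contMDiff_vertical_component (hΨ : IsHorizontalFlow H θ A c Ψ) (x : G) :
    ContMDiff 𝓘(ℝ, ℝ) 𝓘(ℝ, E) ∞ (fun z => x * (Ψ z x)⁻¹ * (c z * x)) :=
  ((contMDiff_mul_left' x).comp (hΨ.curve x).inv).mul ((contMDiff_mul_right' x).comp hΨ.smooth)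

/-- The horizontal flow as a family of diffeomorphisms. -/
def horizontalDiffeo (hΨ : IsHorizontalFlow H θ A c Ψ) (z : ℝ) : G ≃ₘ⟮𝓘(ℝ, E), 𝓘(ℝ, E)⟯ G where
  toFun := Ψ z
  invFun := Ψ (-z)
  left_inv := hΨ.left_inv z
  right_inv := hΨ.right_inv z
  contMDiff_toFun := hΨ.smooth_map z
  contMDiff_invFun := hΨ.smooth_map (-z)

/-- The vertical component of the flow as a family of diffeomorphisms. -/
def verticalDiffeo (hΨ : IsHorizontalFlow H θ A c Ψ) (z : ℝ) : G ≃ₘ⟮𝓘(ℝ, E), 𝓘(ℝ, E)⟯ G where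
  toFun x := Ψ (-z) (c z * x)
  invFun x := (c z)⁻¹ * Ψ z x
  left_inv x := by
    change (c z)⁻¹ * Ψ z (Ψ (-z) (c z * x)) = x
    rw [hΨ.right_inv, inv_mul_cancel_left]
  right_inv x := by
    change Ψ (-z) (c z * ((c z)⁻¹ * Ψ z x)) = x
    rw [mul_inv_cancel_left, hΨ.left_inv]
  contMDiff_toFun := (hΨ.smooth_map (-z)).comp (contMDiff_mul_left' (c z))
  contMDiff_invFun := (contMDiff_mul_left' (c z)⁻¹).comp (hΨ.smooth_map z)

theorem verticalDiffeo_apply (hΨ : IsHorizontalFlow H θ A c Ψ) (z : ℝ) (x : G) :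
    hΨ.verticalDiffeo z x = Ψ (-z) (c z * x) := rfl

theorem solvesYDE (hΨ : IsHorizontalFlow H θ A c Ψ) (hα : 1 / 2 < α)
    (hZ : IsHolderOn α Z (Icc 0 τ)) (x : G) :
    SolvesYDE (E := E) α Z τ (fun t => Ψ (Z t - Z 0) x)
      (fun t => horizontalField (E := E) θ A (Ψ (Z t - Z 0) x)) :=
  (solvesYDE_of_curve hα hZ (hΨ.curve x)).congr (fun _ _ => rfl)
    fun t _ => (hΨ.velocity (Z t - Z 0) x).symm

/-- The field at `Ψ z x` splits as its horizontal part plus `Ψ z x ζ` with `ζ ∈ 𝔥`, and `Ψ z x ζ` is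
the image of `x ζ` under the differential of `Ψ z`; hence the choice of the vertical field.
Transversality holds because the image of the vertical space is vertical, and the form is injective
there. -/
theorem isFlowDecomposition (hΨ : IsHorizontalFlow H θ A c Ψ) (hconn : IsConnectionForm H θ)
    (hα : 1 / 2 < α) (hZ : IsHolderOn α Z (Icc 0 τ)) :
    IsFlowDecomposition α Z τ (rightInvariantField A) (horizontalSpace θ) (verticalSpace H)
      (fun t x => c (Z t - Z 0) * x) (fun t => hΨ.horizontalDiffeo (Z t - Z 0))
      (fun t => hΨ.verticalDiffeo (Z t - Z 0)) := by
  refine ⟨fun t _ x => ?_, fun x => ?_, fun t _ x => ?_,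
    fun t x => horizontalField (E := E) θ A (Ψ (Z t - Z 0) x),
    fun t x => tderiv E E (fun y => x * y) 1 (modelForm (E := E) θ (Ψ (Z t - Z 0) x)
      (tderiv E E (fun y => y * Ψ (Z t - Z 0) x) 1 A)), fun t _ x => ⟨?_, ?_, ?_⟩,
    fun x => hΨ.solvesYDE hα hZ x, fun x => ?_⟩
  · exact (hΨ.right_inv _ _).symm
  · change Ψ (Z 0 - Z 0) x = x
    rw [sub_self, hΨ.zero]
  · refine Submodule.disjoint_def.2 fun v hv hv' => ?_
    obtain ⟨w, hw, hwv⟩ := Submodule.mem_map.1 hv'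
    obtain ⟨ξ, hξ, hwξ⟩ := hconn.mem_verticalSpace_iff.1 hw
    have h1 : @Eq E v (tderiv E E (fun y => Ψ (Z t - Z 0) x * y) 1 ξ) := by
      rw [← hΨ.tderiv_vertical _ _ hξ, ← hwξ]
      exact hwv.symm
    have h2 : modelForm θ (Ψ (Z t - Z 0) x) v = 0 := mem_horizontalSpace_iff.1 hv
    rw [h1, ← leftForm_apply, hconn.leftForm_eq hξ] at h2
    rw [h2, map_zero] at h1
    exact h1
  · exact (mem_horizontalSpace_iff (E := E)).2 (hconn.modelForm_horizontalField A _)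
  · exact hconn.mem_verticalSpace_iff.2 ⟨_, hconn.modelForm_mem _ _, rfl⟩
  · have h1 := hΨ.tderiv_vertical (Z t - Z 0) x (hconn.modelForm_mem (Ψ (Z t - Z 0) x)
      (tderiv E E (fun y => y * Ψ (Z t - Z 0) x) 1 A))
    have h2 : tderiv E E (fun y => y * Ψ (Z t - Z 0) x) 1 A =
        horizontalField θ A (Ψ (Z t - Z 0) x) + tderiv E E (Ψ (Z t - Z 0)) x
          (tderiv E E (fun y => x * y) 1 (modelForm θ (Ψ (Z t - Z 0) x)
            (tderiv E E (fun y => y * Ψ (Z t - Z 0) x) 1 A))) := by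
      rw [h1, horizontalField, sub_add_cancel]
    exact h2
  · refine (solvesYDE_of_curve hα hZ (hΨ.contMDiff_vertical_component x)).congr
      (fun t _ => hΨ.neg_apply _ _) fun t _ => ?_
    rw [hΨ.tderiv_vertical_component hconn, verticalDiffeo_apply]
    change tderiv E E (fun y => Ψ (-(Z t - Z 0)) (c (Z t - Z 0) * x) * y) 1
      (modelForm (E := E) θ (Ψ (Z t - Z 0) (Ψ (-(Z t - Z 0)) (c (Z t - Z 0) * x)))
        (tderiv E E (fun y => y * Ψ (Z t - Z 0) (Ψ (-(Z t - Z 0)) (c (Z t - Z 0) * x))) 1 A)) = _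
    rw [hΨ.right_inv, hΨ.neg_apply]

theorem isHorizontalLift (hΨ : IsHorizontalFlow H θ A c Ψ) (hconn : IsConnectionForm H θ)
    (hα : 1 / 2 < α) (hZ : IsHolderOn α Z (Icc 0 τ)) (x : G) :
    IsHorizontalLift α H θ τ (fun t => QuotientGroup.mk (c (Z t - Z 0) * x)) x
      (fun t => Ψ (Z t - Z 0) x) where
  holder := (hΨ.solvesYDE hα hZ x).1
  start := by rw [sub_self, hΨ.zero]
  proj t _ := QuotientGroup.eq.2 (hΨ.mem_inv _ _)
  horizontal t ht := hasFormIntegral_of_curve hα hconn.smooth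
    (hZ.mono (Icc_subset_Icc_right ht.2)) (hΨ.curve x)
    (fun z => hΨ.modelForm_velocity hconn z x) ht.1

/-- A horizontal lift of the flow of the right-invariant vector field is given by the horizontal
flow. -/
theorem eq_of_isHorizontalLift [FirstCountableTopology G] (hΨ : IsHorizontalFlow H θ A c Ψ)
    (hH : IsClosed (H : Set G))
    (hconn : IsConnectionForm H θ) (hα : 1 / 2 < α) (hZ : IsHolderOn α Z (Icc 0 τ)) {x : G}
    {u : ℝ → G}
    (hu : IsHorizontalLift α H θ τ (fun t => QuotientGroup.mk (c (Z t - Z 0) * x)) x u) :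
    ∀ t ∈ Icc 0 τ, u t = Ψ (Z t - Z 0) x := by
  have hv := hΨ.isHorizontalLift hconn hα hZ x
  refine hconn.eq_of_horizontal hH hα hu.holder hv.holder
    (fun s hs => isLittleO_leftForm_of_hasFormIntegral hα hu.holder hu.horizontal hs)
    (fun s hs => isLittleO_leftForm_of_hasFormIntegral hα hv.holder hv.horizontal hs)
    (fun t ht => QuotientGroup.eq.1 ((hv.proj t ht).trans (hu.proj t ht).symm)) ?_
  rw [hu.start, hv.start]

/-- The horizontal component of a decomposition of the flow of the right-invariant vector field is
the horizontal flow. -/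
theorem eq_of_isFlowDecomposition [FirstCountableTopology G] (hΨ : IsHorizontalFlow H θ A c Ψ)
    (hH : IsClosed (H : Set G))
    (hconn : IsConnectionForm H θ) (hα : 1 / 2 < α) (hZ : IsHolderOn α Z (Icc 0 τ))
    {η ψ : ℝ → (G ≃ₘ⟮𝓘(ℝ, E), 𝓘(ℝ, E)⟯ G)}
    (hd : IsFlowDecomposition α Z τ (rightInvariantField A) (horizontalSpace θ) (verticalSpace H)
      (fun t x => c (Z t - Z 0) * x) η ψ) (x : G) :
    ∀ t ∈ Icc 0 τ, η t x = Ψ (Z t - Z 0) x := by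
  obtain ⟨hφ, hη0, -, h, w, hhw, hη, hψ⟩ := hd
  have hv := hΨ.isHorizontalLift hconn hα hZ x
  -- The velocity of `ψ` is vertical, so `ψ t y` stays in the coset of `ψ 0 y`, which is `y` because
  -- `φ` and `η` start at the identity.
  have hψmem : ∀ y, ∀ t ∈ Icc 0 τ, y⁻¹ * ψ t y ∈ H := by
    intro y t ht
    have h1 := (hψ y).inv_mul_mem hH hα hZ (fun t ht => hconn.mem_verticalSpace_iff.1
      (hhw t ht (ψ t y)).2.1) t ht
    have h2 := hφ 0 ⟨le_rfl, ht.1.trans ht.2⟩ y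
    simp only [sub_self, hΨ.c_zero, one_mul, hη0] at h2
    rwa [← h2] at h1
  refine hconn.eq_of_horizontal hH hα (hη x).1 hv.holder
    (fun s hs => (hη x).isLittleO_leftForm hα
      (fun t ht => mem_horizontalSpace_iff.1 (hhw t ht x).1) hs)
    (fun s hs => isLittleO_leftForm_of_hasFormIntegral hα hv.holder hv.horizontal hs)
    (fun t ht => ?_) ?_
  · have h1 := hφ t ht ((ψ t).symm x)
    have h2 := hψmem ((ψ t).symm x) t ht
    rw [Diffeomorph.apply_symm_apply] at h1 h2
    have h3 := H.mul_mem (hΨ.mem_inv (Z t - Z 0) x) (H.inv_mem h2)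
    rw [← h1]
    simpa [mul_assoc] using h3
  · rw [hη0, hv.start]

end IsHorizontalFlow

end Decomposition

theorem mainTheorem8
    {E : Type*} [NormedAddCommGroup E] [NormedSpace ℝ E] [FiniteDimensional ℝ E]
    {G : Type*} [Group G] [TopologicalSpace G] [ChartedSpace E G] [LieGroup 𝓘(ℝ, E) ∞ G]
    [T2Space G] [SecondCountableTopology G] [ConnectedSpace G]
    (H : Subgroup G) (hH : IsClosed (H : Set G))
    (θ : ∀ x : G, TangentSpace 𝓘(ℝ, E) x →L[ℝ] GroupLieAlgebra 𝓘(ℝ, E) G)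
    (hconn : IsConnectionForm H θ)
    (A : GroupLieAlgebra 𝓘(ℝ, E) G)
    (α : ℝ≥0) (hα : 1 / 2 < α) (hα1 : α ≤ 1)
    (T : ℝ) (hT : 0 < T) (Z : ℝ → ℝ) (hZ : IsHolderOn α Z (Icc 0 T)) :
    ∃ g : ℝ → G,
      -- `g` solves `dg = A g dZ` with `g_0 = 1`, and `φ_t(x) = g_t x` is the solution flow
      (g 0 = 1 ∧ SolvesYDE α Z T g (fun t => rightInvariantField A (g t))) ∧
      (∀ y : ℝ → G, SolvesYDE α Z T y (fun t => rightInvariantField A (y t)) ↔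
        ∀ t ∈ Icc 0 T, y t = g t * y 0) ∧
      -- the curves `g^{H,x}` exist
      (∀ x : G, ∃ gH : ℝ → G, IsHolderPath E α gH (Icc 0 T) ∧
        IsHorizontalLift α H θ T (fun t => QuotientGroup.mk (g t * x)) x (fun t => gH t * x)) ∧
      -- the decomposition exists on the whole interval
      (∃ η ψ : ℝ → (G ≃ₘ⟮𝓘(ℝ, E), 𝓘(ℝ, E)⟯ G),
        IsFlowDecomposition α Z T (rightInvariantField A) (horizontalSpace θ) (verticalSpace H)
          (fun t x => g t * x) η ψ) ∧
      -- and, on any interval `[0, τ]`, its components are the stated ones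
      ∀ τ ∈ Icc 0 T, ∀ η ψ : ℝ → (G ≃ₘ⟮𝓘(ℝ, E), 𝓘(ℝ, E)⟯ G),
        IsFlowDecomposition α Z τ (rightInvariantField A) (horizontalSpace θ) (verticalSpace H)
          (fun t x => g t * x) η ψ →
        ∀ (x : G) (gH : ℝ → G),
          IsHorizontalLift α H θ τ (fun t => QuotientGroup.mk (g t * x)) x (fun t => gH t * x) →
          ∀ t ∈ Icc 0 τ,
            η t x = gH t * x ∧
            ψ t x = x * (x⁻¹ * (gH t)⁻¹ * g t * x) ∧
            x⁻¹ * (gH t)⁻¹ * g t * x ∈ H := by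
  obtain ⟨c, Ψ, hΨ⟩ := hconn.exists_horizontalFlow hH A
  have hcurve : ∀ y : G, SolvesYDE (E := E) α Z T (fun t => c (Z t - Z 0) * y)
      (fun t => rightInvariantField A (c (Z t - Z 0) * y)) := by
    intro y
    refine (solvesYDE_of_curve hα hZ ((contMDiff_mul_right' y).comp hΨ.smooth)).congr
      (fun _ _ => rfl) fun t _ => ?_
    have h := tderiv_oneParam_mul (E := E) hΨ.smooth hΨ.add (Z t - Z 0) y
    rw [hΨ.deriv] at h
    exact h.symm
  have hg : SolvesYDE (E := E) α Z T (fun t => c (Z t - Z 0))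
      (fun t => rightInvariantField A (c (Z t - Z 0))) :=
    (hcurve 1).congr (fun t _ => (mul_one _).symm) fun t _ => by rw [mul_one]
  have hg0 : c (Z 0 - Z 0) = 1 := by rw [sub_self, hΨ.c_zero]
  -- Subtracting `Z 0` makes the path start at the identity. The curve `g^{H,x}` is `Ψ z x * x⁻¹`,
  -- so that it gives `Ψ z x` after multiplication by `x`.
  refine ⟨fun t => c (Z t - Z 0), ⟨hg0, hg⟩, fun y => ⟨fun hy => hg.eq_mul hα hg0 hy, fun hy => ?_⟩,
    fun x => ⟨fun t => Ψ (Z t - Z 0) x * x⁻¹, ?_, ?_⟩,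
    ⟨_, _, hΨ.isFlowDecomposition hconn hα hZ⟩, fun τ hτ η ψ hd x gH hlift t ht => ?_⟩
  · refine (hcurve (y 0)).congr hy fun t ht => ?_
    rw [hy t ht]
  · exact (solvesYDE_of_curve hα hZ ((contMDiff_mul_right' x⁻¹).comp (hΨ.curve x))).1
  · have h : (fun t => Ψ (Z t - Z 0) x * x⁻¹ * x) = fun t => Ψ (Z t - Z 0) x :=
      funext fun t => inv_mul_cancel_right _ _
    have h1 := hΨ.isHorizontalLift hconn hα hZ x
    rw [← h] at h1
    exact h1
  · have hZτ : IsHolderOn α Z (Icc 0 τ) := hZ.mono (Icc_subset_Icc_right hτ.2)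
    have h1 : gH t * x = Ψ (Z t - Z 0) x := hΨ.eq_of_isHorizontalLift hH hconn hα hZτ hlift t ht
    have h2 := hΨ.eq_of_isFlowDecomposition hH hconn hα hZτ hd
    have h3 : c (Z t - Z 0) * x = η t (ψ t x) := hd.1 t ht x
    rw [h2 _ t ht] at h3
    -- Once `η t` is known to be `Ψ z`, the factorization determines `ψ t` by inverting the flow.
    have h4 : ψ t x = Ψ (-(Z t - Z 0)) (c (Z t - Z 0) * x) := by rw [h3, hΨ.left_inv]
    refine ⟨(h2 x t ht).trans h1.symm, ?_, ?_⟩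
    · rw [h4, hΨ.neg_apply, ← h1]
      group
    · have h5 := hΨ.mem_inv (Z t - Z 0) x
      rw [← h1] at h5
      simpa [mul_assoc] using h5
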